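/- Let $n\ge 4$, let $X=\{1,\dots,n\}$, and let $G_n$ be the group of automorphisms of the rooted $n$-ary tree of words over $X$ that is generated by $a_1,\dots,a_n$, where $a_i=(1,\dots,1,a_i,1,\dots,1)\sigma_i$ with $a_i$ in the $i$-th coordinate and $\sigma_i=(1,2,\dots,i-1,i+1,\dots,n)$; that is, $a_i$ sends the word $iw$ to $i\,a_i(w)$ and the word $xw$ to $\sigma_i(x)\,w$ for $x\ne i$. For $m\ge 1$ let $\mathrm{Stab}(m)$ be the pointwise stabilizer in $G_n$ of level $m$ of the tree, and $\mathrm{Rist}(m)$ the subgroup generated by the elements of $G_n$ that act trivially outside the subtree rooted at some vertex of level $m$. The branch kernel and the congruence kernel of $G_n$ are the kernels of the natural maps from the profinite completion $\widehat{G_n}$ to $\varprojlim_{m\ge1} G_n/\mathrm{Rist}(m)$ and to $\varprojlim_{m\ge1} G_n/\mathrm{Stab}(m)$. For a tree automorphism $k$ and a word $v$, $v*k$ denotes the automorphism acting as $k$ on the subtree rooted at $v$ and trivially elsewhere, and $X^m*K=\prod_{|v|=m}v*K$. Put - $K_n=G_n$ if $n\ge 6$ is even; - $K_n=$ the subgroup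 of elements of $G_n$ represented by a word of even exponent sum in $a_1,\dots,a_n$, if $n$ is odd; - $K_4=\langle a_1a_3a_4^2,\ a_2a_1a_3a_1^{-1},\ a_1a_3^{-1}a_4a_3,\ G_4'\rangle$, and $M_n=K_n/K_n'$. Then every $\mathrm{Rist}(m)$ has finite index in $G_n$, $x*K_n\le K_n$ for every $x\in X$, and: 1. The branch kernel of $G_n$ equals the congruence kernel, as subgroups of $\widehat{G_n}$. 2. As a topological group it is isomorphic to the inverse limit $$\varprojlim_{m\ge 1} M_n^{\,X^m},$$ whose transition maps $M_n^{X^{m+1}}\to M_n^{X^m}$ are induced by the inclusions $X^{m+1}*K_n\le X^m*K_n$. 3. $M_n$ is a finite abelian group. If $n\ge 6$ is even, then $M_n=G_n/G_n'\cong(\mathbb Z/(n-1)\mathbb Z)^n$. If $n=4$ or $n\ge5$ is odd, then the exponent of $M_n$ is at least $n-1$ and at most $2(n-1)$. 4. There is a finite abelian group $A_n$ such that the branch kernel is also isomorphic, as a topological group, to $\varprojlim_{m\ge1}A_n^{\,m}$, where the map $A_n^{m+1}\to A_n^m$ forgets the last coordinate. Here $A_n$ is cyclic of order $n-1$ if $n\ge6$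 is even; $A_n\cong M_n$ if $n$ is odd; and the exponent of $A_n$ is at least $n-1$ and at most $2(n-1)$ if $n=4$ or $n$ is odd. -/

import Mathlib

noncomputable section

namespace HanoiCSP

/-! ### The rooted tree of words and its automorphism group -/

section Tree

variable {X : Type}

/-- Edges of the rooted tree on the set of finite words over `X`: a word is joined to each of its
extensions by one letter on the right. The root is the empty word. -/
def TreeEdge (u v : List X) : Prop := (∃ x, v = u ++ [x]) ∨ (∃ x, u = v ++ [x])

variable (X) in
/-- The group of automorphisms of the rooted tree: bijections of the vertex set that fix the root
and preserve edge incidence. The product is composition, `(f * g) u = f (g u)`. -/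
def treeAut : Subgroup (Equiv.Perm (List X)) where
  carrier := {f | f [] = [] ∧ ∀ u v, TreeEdge (f u) (f v) ↔ TreeEdge u v}
  one_mem' := ⟨rfl, fun _ _ => Iff.rfl⟩
  mul_mem' := by
    rintro f g ⟨hf, hf'⟩ ⟨hg, hg'⟩
    refine ⟨?_, fun u v => ?_⟩
    · rw [Equiv.Perm.mul_apply, hg, hf]
    · rw [Equiv.Perm.mul_apply, Equiv.Perm.mul_apply, hf', hg']
  inv_mem' := by
    rintro f ⟨hf, hf'⟩
    refine ⟨?_, fun u v => ?_⟩
    · rw [Equiv.Perm.inv_eq_iff_eq, hf]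
    · rw [← hf', ← Equiv.Perm.mul_apply, ← Equiv.Perm.mul_apply, mul_inv_cancel,
        Equiv.Perm.one_apply, Equiv.Perm.one_apply]

variable (X) in
/-- The automorphism group of the rooted tree, acting on words by evaluation: `g • u`. -/
abbrev TreeAut : Type := ↥(treeAut X)

theorem smul_nil (f : TreeAut X) : f • ([] : List X) = [] := f.2.1

theorem smul_concat (f : TreeAut X) (u : List X) (x : X) :
    ∃ y, f • (u ++ [x]) = f • u ++ [y] := by
  induction u using List.reverseRecOn generalizing x with
  | nil =>
    have h : TreeEdge (f • []) (f • ([] ++ [x])) := (f.2.2 _ _).2 (Or.inl ⟨x, rfl⟩)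
    rcases h with h | ⟨y, hy⟩
    · exact h
    · rw [smul_nil] at hy
      simp at hy
  | append_singleton v z ih =>
    have h : TreeEdge (f • (v ++ [z])) (f • (v ++ [z] ++ [x])) := (f.2.2 _ _).2 (Or.inl ⟨x, rfl⟩)
    rcases h with h | ⟨y, hy⟩
    · exact h
    · obtain ⟨y', hy'⟩ := ih z
      have h1 : f • v = f • (v ++ [z] ++ [x]) := by
        rw [hy'] at hy
        exact (List.append_inj' hy rfl).1
      have h2 := congrArg List.length (MulAction.injective f h1)
      simp at h2

theorem smul_append (f : TreeAut X) (u w : List X) :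
    ∃ w', f • (u ++ w) = f • u ++ w' ∧ w'.length = w.length := by
  induction w using List.reverseRecOn with
  | nil => exact ⟨[], by simp, rfl⟩
  | append_singleton v z ih =>
    obtain ⟨w', h1, h2⟩ := ih
    obtain ⟨y, hy⟩ := smul_concat f (u ++ v) z
    exact ⟨w' ++ [y], by rw [← List.append_assoc, hy, h1, List.append_assoc], by simp [h2]⟩

theorem length_smul (f : TreeAut X) (u : List X) : (f • u).length = u.length := by
  obtain ⟨w', h1, h2⟩ := smul_append f [] u
  rw [List.nil_append, smul_nil, List.nil_append] at h1
  rw [h1, h2]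

theorem smul_prefix_iff (f : TreeAut X) (u w : List X) : f • u <+: f • w ↔ u <+: w := by
  have key : ∀ (g : TreeAut X) (a b : List X), a <+: b → g • a <+: g • b := by
    rintro g a _ ⟨c, rfl⟩
    obtain ⟨c', h, -⟩ := smul_append g a c
    exact ⟨c', h.symm⟩
  refine ⟨fun h => ?_, key f u w⟩
  simpa using key f⁻¹ _ _ h

/-- A bijection that satisfies `f (u x) = (f u) y` is a tree automorphism. -/
theorem mem_treeAut_of_concat (f : Equiv.Perm (List X)) (h0 : f [] = [])
    (h : ∀ u x, ∃ y, f (u ++ [x]) = f u ++ [y]) : f ∈ treeAut X := by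
  have fwd : ∀ u v, TreeEdge u v → TreeEdge (f u) (f v) := by
    rintro u v (⟨x, rfl⟩ | ⟨x, rfl⟩)
    · exact Or.inl (h u x)
    · exact Or.inr (h v x)
  have aux : ∀ u v, (∃ y, f v = f u ++ [y]) → TreeEdge u v := by
    rintro u v ⟨y, hy⟩
    rcases List.eq_nil_or_concat v with rfl | ⟨v', z, rfl⟩
    · rw [h0] at hy
      simp at hy
    · rw [List.concat_eq_append] at hy ⊢
      obtain ⟨y', hy'⟩ := h v' z
      rw [hy'] at hy
      have : v' = u := f.injective (List.append_inj' hy rfl).1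
      subst this
      exact Or.inl ⟨z, rfl⟩
  refine ⟨h0, fun u v => ⟨?_, fwd u v⟩⟩
  rintro (huv | huv)
  · exact aux u v huv
  · exact (aux v u huv).symm

/-! ### Level stabilizers and rigid stabilizers -/

/-- The words of length `m`, i.e. the vertices of level `m`. -/
abbrev Level (X : Type) (m : ℕ) : Type := {u : List X // u.length = m}

variable (G : Subgroup (TreeAut X))

/-- The stabilizer of the level `m`. -/
def levelStab (m : ℕ) : Subgroup ↥G := ⨅ u : Level X m, MulAction.stabilizer ↥G u.1

/-- The rigid stabilizer of the vertex `u`: the elements that fix every vertex outside the subtree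
rooted at `u`. -/
def rist (u : List X) : Subgroup ↥G where
  carrier := {g | ∀ w : List X, ¬ u <+: w → g • w = w}
  one_mem' := fun w _ => one_smul _ w
  mul_mem' := fun {a b} ha hb w hw => by rw [mul_smul, hb w hw, ha w hw]
  inv_mem' := fun {a} ha w hw => by rw [inv_smul_eq_iff, ha w hw]

/-- The rigid stabilizer of the level `m`: the subgroup generated by the rigid stabilizers of the
vertices of level `m`. -/
def levelRist (m : ℕ) : Subgroup ↥G := ⨆ u : Level X m, rist G u.1

variable {G}

theorem mem_levelStab {m : ℕ} {g : ↥G} :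
    g ∈ levelStab G m ↔ ∀ u : List X, u.length = m → g • u = u := by
  simp [levelStab, Subgroup.mem_iInf, MulAction.mem_stabilizer_iff, Subtype.forall]

theorem length_smul' (g : ↥G) (u : List X) : (g • u).length = u.length := length_smul g.1 u

instance levelStab_normal (m : ℕ) : (levelStab G m).Normal where
  conj_mem := by
    intro k hk g
    rw [mem_levelStab] at hk ⊢
    intro u hu
    rw [mul_smul, mul_smul, hk _ (by rw [length_smul', hu]), smul_inv_smul]

theorem levelStab_succ_le (m : ℕ) : levelStab G (m + 1) ≤ levelStab G m := by
  intro g hg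
  rw [mem_levelStab] at hg ⊢
  intro u hu
  rcases isEmpty_or_nonempty X with hX | ⟨⟨x⟩⟩
  · have hu' : u = [] := Subsingleton.elim _ _
    rw [hu']
    exact smul_nil g.1
  · have h1 := hg (u ++ [x]) (by simp [hu])
    obtain ⟨y, hy⟩ := smul_concat g.1 u x
    have h2 : g • u ++ [y] = u ++ [x] := hy.symm.trans h1
    exact (List.append_inj' h2 rfl).1

theorem conj_mem_rist {u : List X} {k : ↥G} (hk : k ∈ rist G u) (g : ↥G) :
    g * k * g⁻¹ ∈ rist G (g • u) := by
  intro w hw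
  have : ¬ u <+: g⁻¹ • w := by
    intro h
    apply hw
    have := (smul_prefix_iff g.1 u (g⁻¹ • w)).2 h
    have h2 : g.1 • (g⁻¹ • w) = w := smul_inv_smul g w
    rw [h2] at this
    exact this
  rw [mul_smul, mul_smul, hk _ this, smul_inv_smul]

instance levelRist_normal (m : ℕ) : (levelRist G m).Normal where
  conj_mem := by
    intro k hk g
    have h : levelRist G m ≤ (levelRist G m).comap (MulAut.conj g).toMonoidHom := by
      refine iSup_le fun u => ?_
      intro a ha
      have h1 := conj_mem_rist ha g
      exact (le_iSup (fun v : Level X m => rist G v.1)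
        ⟨g • u.1, by rw [length_smul', u.2]⟩) h1
    exact h hk

theorem levelRist_succ_le (m : ℕ) : levelRist G (m + 1) ≤ levelRist G m := by
  refine iSup_le fun u => ?_
  refine le_trans ?_ (le_iSup (fun v : Level X m => rist G v.1)
    ⟨u.1.take m, by rw [List.length_take, u.2]; omega⟩)
  intro g hg w hw
  refine hg w fun h => hw ?_
  exact (List.take_prefix m u.1).trans h

instance levelStab_finiteIndex [Finite X] (m : ℕ) : (levelStab G m).FiniteIndex := by
  have hfin : Finite (Level X m) := by
    change Finite (List.Vector X m)
    infer_instance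
  refine Subgroup.finiteIndex_iInf fun u => ?_
  have horb : (MulAction.orbit ↥G u.1).Finite := by
    refine Set.Finite.subset (Set.finite_range (Subtype.val : Level X m → List X)) ?_
    rintro _ ⟨g, rfl⟩
    exact ⟨⟨g • u.1, by rw [length_smul', u.2]⟩, rfl⟩
  have : Finite (MulAction.orbit ↥G u.1) := horb
  have : Finite (↥G ⧸ MulAction.stabilizer ↥G u.1) :=
    Finite.of_equiv _ (MulAction.orbitEquivQuotientStabilizer ↥G u.1)
  exact Subgroup.finiteIndex_of_finite_quotient

/-! ### Planting an automorphism below a vertex of the first level -/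

variable [DecidableEq X]

/-- The underlying bijection of `x * k`. -/
def graftPerm (x : X) (k : Equiv.Perm (List X)) : Equiv.Perm (List X) where
  toFun
    | [] => []
    | y :: w => if y = x then y :: k w else y :: w
  invFun
    | [] => []
    | y :: w => if y = x then y :: k⁻¹ w else y :: w
  left_inv := by
    rintro (_ | ⟨y, w⟩)
    · rfl
    · by_cases h : y = x <;> simp [h]
  right_inv := by
    rintro (_ | ⟨y, w⟩)
    · rfl
    · by_cases h : y = x <;> simp [h]

/-- For a letter `x` and a tree automorphism `k`, the automorphism `x * k` which acts as `k` on the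
subtree rooted at `x` (`x w ↦ x (k w)`) and trivially outside of it. -/
def graft (x : X) : TreeAut X →* TreeAut X where
  toFun k := ⟨graftPerm x k.1, mem_treeAut_of_concat _ rfl (by
    rintro (_ | ⟨y, w⟩) z
    · refine ⟨z, ?_⟩
      have hk : k.1 [] = [] := k.2.1
      by_cases h : z = x <;> simp [graftPerm, h, hk]
    · by_cases h : y = x
      · obtain ⟨y', hy'⟩ := smul_concat k w z
        refine ⟨y', ?_⟩
        have hy2 : k.1 (w ++ [z]) = k.1 w ++ [y'] := hy'
        simp [graftPerm, h, hy2]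
      · exact ⟨z, by simp [graftPerm, h]⟩)⟩
  map_one' := by
    apply Subtype.ext
    apply Equiv.ext
    rintro (_ | ⟨y, w⟩)
    · rfl
    · by_cases h : y = x <;> simp [graftPerm, h]
  map_mul' a b := by
    apply Subtype.ext
    apply Equiv.ext
    rintro (_ | ⟨y, w⟩)
    · rfl
    · by_cases h : y = x <;> simp [graftPerm, h]

end Tree

/-! ### Inverse limits of sequences of discrete groups -/

section InvLim

variable (A : ℕ → Type) [∀ m, Group (A m)] (t : ∀ m, A (m + 1) →* A m)

/-- The compatible sequences, as a subgroup of the product. -/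
def compatible : Subgroup (∀ m, A m) where
  carrier := {x | ∀ m, t m (x (m + 1)) = x m}
  one_mem' := fun m => map_one (t m)
  mul_mem' := fun {x y} hx hy m => by rw [Pi.mul_apply, Pi.mul_apply, map_mul, hx, hy]
  inv_mem' := fun {x} hx m => by rw [Pi.inv_apply, Pi.inv_apply, map_inv, hx]

/-- The inverse limit of the sequence `⋯ → A 2 → A 1 → A 0` of discrete groups. -/
def InvLim : Type := ↥(compatible A t)

instance : Group (InvLim A t) := inferInstanceAs (Group ↥(compatible A t))

/-- The topology induced by the product of the discrete topologies. -/
instance : TopologicalSpace (InvLim A t) :=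
  TopologicalSpace.induced (fun x => x.1) (@Pi.topologicalSpace ℕ A fun _ => ⊥)

end InvLim

/-! ### Completions and kernels -/

section Completion

open ProfiniteGrp.ProfiniteCompletion

variable {G : Type} [Group G]

variable (G) in
/-- The profinite completion, the inverse limit of all quotients by normal subgroups of finite
index. -/
abbrev ProfCompletion : Type := completion (GrpCat.of G)

variable (N : ℕ → Subgroup G) [∀ m, (N m).Normal] (hN : ∀ m, N (m + 1) ≤ N m)

/-- The completion of `G` with respect to a descending sequence of normal subgroups, the inverse
limit of the quotients `G ⧸ N m`. -/
abbrev SeqCompletion : Type :=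
  InvLim (fun m => G ⧸ N m) (fun m => QuotientGroup.map (N (m + 1)) (N m) (MonoidHom.id G) (hN m))

/-- The canonical map from the profinite completion to the completion with respect to a descending
sequence of normal subgroups of finite index. -/
def toSeqCompletion (hf : ∀ m, (N m).FiniteIndex) :
    ProfCompletion G →* SeqCompletion N hN where
  toFun x := ⟨fun m => x.1 (@FiniteIndexNormalSubgroup.mk (GrpCat.of G) _ (N m) inferInstance (hf m)),
    fun m => x.2 (CategoryTheory.homOfLE (show
      @FiniteIndexNormalSubgroup.mk (GrpCat.of G) _ (N (m + 1)) inferInstance (hf (m + 1)) ≤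
        @FiniteIndexNormalSubgroup.mk (GrpCat.of G) _ (N m) inferInstance (hf m) from hN m))⟩
  map_one' := rfl
  map_mul' _ _ := rfl

end Completion

section Kernels

variable {X : Type} [Finite X] (G : Subgroup (TreeAut X))

/-- The congruence kernel: the kernel of the map from the profinite completion to the congruence
completion, the inverse limit of `G / Stab_G(m)`, `m ≥ 1`. -/
def congruenceKernel : Subgroup (ProfCompletion ↥G) :=
  (toSeqCompletion (fun m => levelStab G (m + 1)) (fun m => levelStab_succ_le (m + 1))
    (fun _ => inferInstance)).ker

/-- The branch kernel: the kernel of the map from the profinite completion to the branch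
completion, the inverse limit of `G / Rist_G(m)`, `m ≥ 1`. The map exists because the level rigid
stabilizers have finite index. -/
def branchKernel (hf : ∀ m, (levelRist G (m + 1)).FiniteIndex) : Subgroup (ProfCompletion ↥G) :=
  (toSeqCompletion (fun m => levelRist G (m + 1)) (fun m => levelRist_succ_le (m + 1)) hf).ker

end Kernels

/-! ### The generalized Hanoi towers groups -/

section Hanoi

/-- The cycle `(1, …, i - 1, i + 1, …, n)`, with the letters numbered from `0`. -/
def cyc (n : ℕ) (i : Fin n) : Equiv.Perm (Fin n) := ((List.finRange n).erase i).formPerm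

theorem cyc_self (n : ℕ) (i : Fin n) : cyc n i i = i :=
  List.formPerm_apply_of_notMem fun h => (List.Nodup.mem_erase_iff (List.nodup_finRange n)).1 h |>.1 rfl

/-- The map given by `[] ↦ []`, `i w ↦ (σ i) (f w)` and `x w ↦ (σ x) w` for `x ≠ i`. -/
def spineFun {n : ℕ} (σ : Equiv.Perm (Fin n)) (i : Fin n) : List (Fin n) → List (Fin n)
  | [] => []
  | x :: w => if x = i then σ x :: spineFun σ i w else σ x :: w

theorem spineFun_inv {n : ℕ} (σ : Equiv.Perm (Fin n)) (i : Fin n) (h : σ i = i)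
    (w : List (Fin n)) : spineFun σ⁻¹ i (spineFun σ i w) = w := by
  induction w with
  | nil => rfl
  | cons x w ih =>
    by_cases hx : x = i
    · subst hx
      have h' : σ⁻¹ x = x := by rw [Equiv.Perm.inv_eq_iff_eq, h]
      simp only [spineFun, if_true, h, h', ih]
    · have : σ x ≠ i := fun h' => hx (σ.injective (h'.trans h.symm))
      simp [spineFun, hx, this]

theorem spineFun_concat {n : ℕ} (σ : Equiv.Perm (Fin n)) (i : Fin n) (w : List (Fin n))
    (z : Fin n) : ∃ y, spineFun σ i (w ++ [z]) = spineFun σ i w ++ [y] := by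
  induction w with
  | nil => exact ⟨σ z, by simp [spineFun]⟩
  | cons x w ih =>
    obtain ⟨y, hy⟩ := ih
    by_cases hx : x = i
    · exact ⟨y, by simp [spineFun, hx, hy]⟩
    · exact ⟨z, by simp [spineFun, hx]⟩

/-- The generator `a_i = (1, …, 1, a_i, 1, …, 1) σ_i`, with `a_i` in the `i`-th coordinate:
`i w ↦ i (a_i w)` and `x w ↦ (σ_i x) w` for `x ≠ i`. -/
def gen (n : ℕ) (i : Fin n) : TreeAut (Fin n) :=
  ⟨{ toFun := spineFun (cyc n i) i
     invFun := spineFun (cyc n i)⁻¹ i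
     left_inv := spineFun_inv _ i (cyc_self n i)
     right_inv := by
      have h : (cyc n i)⁻¹ i = i := by rw [Equiv.Perm.inv_eq_iff_eq, cyc_self]
      simpa using! spineFun_inv (cyc n i)⁻¹ i h },
    mem_treeAut_of_concat _ rfl (spineFun_concat (cyc n i) i)⟩

/-- The group `G_n` generated by `a_1, …, a_n`; `G_3` is the Hanoi towers group. -/
def hanoi (n : ℕ) : Subgroup (TreeAut (Fin n)) := Subgroup.closure (Set.range (gen n))

/-- The elements of `G_n` that are represented by a word in the generators with even exponent
sum. -/
def evenPart (n : ℕ) : Subgroup (TreeAut (Fin n)) :=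
  (FreeGroup.lift fun _ : Fin n => Multiplicative.ofAdd (1 : ZMod 2)).ker.map
    (FreeGroup.lift (gen n))

/-- The subgroup `⟨a₁ a₃ a₄², a₂ a₁ a₃ a₁⁻¹, a₁ a₃⁻¹ a₄ a₃, G₄'⟩` of `G₄`. -/
def branch4 : Subgroup (TreeAut (Fin 4)) :=
  Subgroup.closure {gen 4 0 * gen 4 2 * gen 4 3 ^ 2, gen 4 1 * gen 4 0 * gen 4 2 * (gen 4 0)⁻¹,
    gen 4 0 * (gen 4 2)⁻¹ * gen 4 3 * gen 4 2} ⊔ ⁅hanoi 4, hanoi 4⁆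

/-- The branching subgroup `K_n` of `G_n`, for `n ≥ 4` (with `K_n = G_n` for even `n ≥ 6`). -/
def branching : (n : ℕ) → Subgroup (TreeAut (Fin n))
  | 4 => branch4
  | n => if Odd n then evenPart n else hanoi n

/-- The group `M_n = K_n / K_n'`. -/
abbrev M (n : ℕ) : Type := Abelianization ↥(branching n)

variable {n : ℕ}

/-- The endomorphism `M_n → M_n` induced by `k ↦ x * k`. -/
def plant (h : ∀ x : Fin n, (branching n).map (graft x) ≤ branching n) (x : Fin n) : M n →* M n :=
  Abelianization.map (((graft x).comp (branching n).subtype).codRestrict (branching n)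
    fun k => h x (Subgroup.mem_map_of_mem _ k.2))

/-- The map `M_n^(X^(m+1)) → M_n^(X^m)` induced by the inclusion of `X^(m+1) * K_n` in `X^m * K_n`.
Here an element `(k_v)` of the direct product `X^m * K_n` of copies of `K_n` over the words `v` of
length `m` has the class of `k_v` as its `v`-th coordinate, and `(u x) * k = u * (x * k)`. -/
def treeTransition (h : ∀ x : Fin n, (branching n).map (graft x) ≤ branching n) (m : ℕ) :
    (Level (Fin n) (m + 1) → M n) →* (Level (Fin n) m → M n) where
  toFun f u := ∏ x : Fin n, plant h x (f ⟨u.1 ++ [x], by simp [u.2]⟩)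
  map_one' := by
    funext u
    simp
  map_mul' f g := by
    funext u
    simp [Finset.prod_mul_distrib]

/-- The inverse limit over `m ≥ 1` of the groups `M_n^(X^m)`, along the maps induced by the
inclusions of `X^(m+1) * K_n` in `X^m * K_n`. -/
abbrev TreeLim (h : ∀ x : Fin n, (branching n).map (graft x) ≤ branching n) : Type :=
  InvLim (fun m => Level (Fin n) (m + 1) → M n) (fun m => treeTransition h (m + 1))

/-- The inverse limit over `m ≥ 1` of the powers `A^m`, along the maps that forget the last
coordinate. -/
abbrev PowerLim (A : Type) [CommGroup A] : Type :=
  InvLim (fun m => Fin (m + 1) → A)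
    (fun m => { toFun := fun f i => f i.castSucc, map_one' := rfl, map_mul' := fun _ _ => rfl })

end Hanoi

end HanoiCSP

end

set_option linter.unusedSectionVars false
set_option linter.unusedSimpArgs false

namespace HanoiCSP

/-! ### Sections, the action on the first level and the wreath recursion -/

section Sections

variable {X : Type}

/-! Write G for the group, G' for its commutator subgroup, K for the branching subgroup, M = K/K'.
The pivot is a uniform description of K (`mem_branching_iff`): it consists of the elements of G
whose action on the first level is that of some element of G'. For n ≥ 5 this is parity and the
perfectness of the alternating group; for n = 4 it is the kernel of the action on the three pairings
of the letters.

Short commutators of generators give elements of Stab(1) with few nontrivial coordinates, and from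
them x * G' ≤ G (`graft_mem_of_mem_commutator`). Hence only the classes modulo G' decide whether a
family is the coordinate family of an element of G. Every family whose product of classes is trivial
occurs. Conversely, the classes of the sections of an element multiply to its own class
(`prod_of_sec`). So x * k lies in G exactly when k lies in K (`graft_mem_hanoi_iff`), and for m ≥ 1
the rigid stabilizer of level m is X^m * K. Since an element of G acting trivially on the first
level is in K, one gets Stab(m+1) ≤ Rist(m) ≤ Stab(m): finite index, and equality of the two
kernels.

A nontrivial normal subgroup moves some vertex u, so it contains the commutators of the rigid
stabilizer of u; by level transitivity it contains X^m * K' for m = |u|. These subgroups are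
therefore cofinal among the normal subgroups of finite index, and the branch kernel is the inverse
limit of Rist(m) / (X^m * K') = M^(X^m).

The endomorphism of M induced by k ↦ x * k does not depend on x, is idempotent (`plant_eq`,
`plant_plant`), and its image R embeds in the abelianization of G. The latter is (ℤ/(n-1))^n,
because a contraction argument shows that exponents of words are well defined modulo n - 1. All
coordinates in the limit lie in R, where the only constraint is that a coordinate is the product of
those at its children. Prescribing freely all coordinates except those at the last child gives a
countable power of R. For n ≥ 5 one has R = M, and for even n ≥ 6 the countable power regroups into
cyclic factors; for n = 4, M is R times a quotient of a group of even permutations. -/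

theorem exists_smul_singleton (f : TreeAut X) (x : X) : ∃ y, f • [x] = [y] := by
  obtain ⟨y, hy⟩ := smul_concat f [] x
  rw [smul_nil] at hy
  exact ⟨y, hy⟩

/-- The letter to which a tree automorphism sends the vertex `x` of the first level. -/
noncomputable def permFun (f : TreeAut X) (x : X) : X := (exists_smul_singleton f x).choose

theorem permFun_spec (f : TreeAut X) (x : X) : f • [x] = [permFun f x] :=
  (exists_smul_singleton f x).choose_spec

theorem permFun_mul (f g : TreeAut X) (x : X) : permFun (f * g) x = permFun f (permFun g x) := by
  have h := permFun_spec (f * g) x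
  rw [mul_smul, permFun_spec, permFun_spec] at h
  exact (List.cons.inj h).1.symm

theorem permFun_one (x : X) : permFun (1 : TreeAut X) x = x := by
  have h := permFun_spec (1 : TreeAut X) x
  rw [one_smul] at h
  exact (List.cons.inj h).1.symm

/-- The permutation of the letters induced by a tree automorphism. -/
noncomputable def perm : TreeAut X →* Equiv.Perm X where
  toFun f :=
    { toFun := permFun f
      invFun := permFun f⁻¹
      left_inv x := by rw [← permFun_mul, inv_mul_cancel, permFun_one]
      right_inv x := by rw [← permFun_mul, mul_inv_cancel, permFun_one] }
  map_one' := Equiv.ext permFun_one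
  map_mul' f g := Equiv.ext (permFun_mul f g)

theorem smul_singleton (f : TreeAut X) (x : X) : f • [x] = [perm f x] :=
  permFun_spec f x

theorem exists_smul_cons (f : TreeAut X) (x : X) (w : List X) :
    ∃ w', f • (x :: w) = perm f x :: w' := by
  obtain ⟨w', h, -⟩ := smul_append f [x] w
  rw [smul_singleton] at h
  exact ⟨w', h⟩

theorem smul_cons_tail (f : TreeAut X) (x : X) (w : List X) :
    f • (x :: w) = perm f x :: (f • (x :: w)).tail := by
  obtain ⟨w', h⟩ := exists_smul_cons f x w
  rw [h, List.tail_cons]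

/-- The section of a tree automorphism at a letter. -/
noncomputable def sec (f : TreeAut X) (x : X) : TreeAut X :=
  ⟨{ toFun w := (f • (x :: w)).tail
     invFun w := (f⁻¹ • (perm f x :: w)).tail
     left_inv w := by
      dsimp only
      rw [← smul_cons_tail, inv_smul_smul, List.tail_cons]
     right_inv w := by
      dsimp only
      have h : perm f⁻¹ (perm f x) = x := by
        rw [← Equiv.Perm.mul_apply, ← map_mul, inv_mul_cancel, map_one, Equiv.Perm.one_apply]
      have h' := smul_cons_tail f⁻¹ (perm f x) w
      rw [h] at h'
      rw [← h', smul_inv_smul, List.tail_cons] },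
    mem_treeAut_of_concat _ (by
      change (f • [x]).tail = []
      rw [smul_singleton, List.tail_cons]) (by
      intro u z
      obtain ⟨y, hy⟩ := smul_concat f (x :: u) z
      refine ⟨y, ?_⟩
      change (f • (x :: u ++ [z])).tail = (f • (x :: u)).tail ++ [y]
      rw [hy, smul_cons_tail]
      rfl)⟩

theorem smul_cons (f : TreeAut X) (x : X) (w : List X) :
    f • (x :: w) = perm f x :: sec f x • w := smul_cons_tail f x w

theorem perm_sec_ext {f g : TreeAut X} (h : perm f = perm g) (h' : ∀ x, sec f x = sec g x) :
    f = g := by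
  apply Subtype.ext
  apply Equiv.ext
  intro w
  change f • w = g • w
  cases w with
  | nil => rw [smul_nil, smul_nil]
  | cons x w => rw [smul_cons, smul_cons, h, h']

theorem treeAut_ext {f g : TreeAut X} (h : ∀ w : List X, f • w = g • w) : f = g :=
  Subtype.ext (Equiv.ext h)

theorem perm_eq_of_smul {f : TreeAut X} {x y : X} {w w' : List X} (h : f • (x :: w) = y :: w') :
    perm f x = y := by
  rw [smul_cons] at h
  exact (List.cons.inj h).1

theorem sec_eq_of_smul {f k : TreeAut X} {x : X} (y : X)
    (h : ∀ w, f • (x :: w) = y :: k • w) : sec f x = k := by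
  refine treeAut_ext fun w => ?_
  have := h w
  rw [smul_cons] at this
  exact (List.cons.inj this).2

@[simp]
theorem sec_one (x : X) : sec (1 : TreeAut X) x = 1 :=
  sec_eq_of_smul x fun w => by rw [one_smul, one_smul]

@[simp]
theorem sec_mul (f g : TreeAut X) (x : X) : sec (f * g) x = sec f (perm g x) * sec g x :=
  sec_eq_of_smul (perm f (perm g x)) fun w => by
    rw [mul_smul, smul_cons, smul_cons, mul_smul]

@[simp]
theorem sec_inv (f : TreeAut X) (x : X) : sec f⁻¹ x = (sec f ((perm f)⁻¹ x))⁻¹ := by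
  have h := sec_mul f f⁻¹ x
  rw [mul_inv_cancel, sec_one, map_inv] at h
  exact eq_inv_of_mul_eq_one_right h.symm

/-- The automorphism that acts as `d x` below the letter `x`, for all letters `x`. -/
def spread : (X → TreeAut X) →* TreeAut X where
  toFun d := ⟨{
      toFun
        | [] => []
        | x :: w => x :: d x • w
      invFun
        | [] => []
        | x :: w => x :: (d x)⁻¹ • w
      left_inv := by
        rintro (_ | ⟨x, w⟩)
        · rfl
        · simp
      right_inv := by
        rintro (_ | ⟨x, w⟩)
        · rfl
        · simp }, mem_treeAut_of_concat _ rfl (by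
    rintro (_ | ⟨y, w⟩) z
    · exact ⟨z, by simp [smul_nil]⟩
    · obtain ⟨y', hy'⟩ := smul_concat (d y) w z
      exact ⟨y', by simp [hy']⟩)⟩
  map_one' := treeAut_ext fun w => by
    cases w with
    | nil => rfl
    | cons x w =>
      change x :: (1 : TreeAut X) • w = _
      rw [one_smul, one_smul]
  map_mul' d e := treeAut_ext fun w => by
    cases w with
    | nil => rfl
    | cons x w =>
      change x :: (d x * e x) • w = x :: d x • e x • w
      rw [mul_smul]

theorem spread_smul_cons (d : X → TreeAut X) (x : X) (w : List X) :
    spread d • (x :: w) = x :: d x • w := rfl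

@[simp]
theorem perm_spread (d : X → TreeAut X) : perm (spread d) = 1 :=
  Equiv.ext fun x => perm_eq_of_smul (spread_smul_cons d x [])

@[simp]
theorem sec_spread (d : X → TreeAut X) (x : X) : sec (spread d) x = d x :=
  sec_eq_of_smul x (spread_smul_cons d x)

theorem spread_sec {f : TreeAut X} (h : perm f = 1) : spread (sec f) = f :=
  perm_sec_ext (by rw [h, perm_spread]) fun x => sec_spread _ x

theorem eq_spread_iff {f : TreeAut X} {d : X → TreeAut X} :
    f = spread d ↔ perm f = 1 ∧ ∀ x, sec f x = d x :=
  ⟨by rintro rfl; simp, fun h => perm_sec_ext (by rw [h.1, perm_spread]) fun x => by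
    rw [h.2, sec_spread]⟩

/-- Conjugation permutes and conjugates the coordinates. -/
theorem conj_spread (f : TreeAut X) (d : X → TreeAut X) :
    f * spread d * f⁻¹ = spread fun x =>
      sec f ((perm f)⁻¹ x) * d ((perm f)⁻¹ x) * (sec f ((perm f)⁻¹ x))⁻¹ := by
  refine eq_spread_iff.2 ⟨by simp, fun x => ?_⟩
  simp

theorem graft_eq_spread [DecidableEq X] (x : X) (k : TreeAut X) :
    graft x k = spread (Pi.mulSingle x k) := by
  refine treeAut_ext fun w => ?_
  cases w with
  | nil => rw [smul_nil, smul_nil]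
  | cons y w =>
    rw [spread_smul_cons]
    change (if y = x then y :: k • w else y :: w) = _
    by_cases h : y = x
    · subst h
      rw [if_pos rfl, Pi.mulSingle_eq_same]
    · rw [if_neg h, Pi.mulSingle_eq_of_ne h, one_smul]

/-- The automorphism that permutes the first letter only. -/
def rooted : Equiv.Perm X →* TreeAut X where
  toFun σ := ⟨{
      toFun
        | [] => []
        | x :: w => σ x :: w
      invFun
        | [] => []
        | x :: w => σ⁻¹ x :: w
      left_inv := by
        rintro (_ | ⟨x, w⟩)
        · rfl
        · simp
      right_inv := by
        rintro (_ | ⟨x, w⟩)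
        · rfl
        · simp }, mem_treeAut_of_concat _ rfl (by
    rintro (_ | ⟨y, w⟩) z
    · exact ⟨σ z, rfl⟩
    · exact ⟨z, rfl⟩)⟩
  map_one' := treeAut_ext fun w => by cases w <;> rfl
  map_mul' σ τ := treeAut_ext fun w => by cases w <;> rfl

theorem rooted_smul_cons (σ : Equiv.Perm X) (x : X) (w : List X) :
    rooted σ • (x :: w) = σ x :: w := rfl

@[simp]
theorem perm_rooted (σ : Equiv.Perm X) : perm (rooted σ) = σ :=
  Equiv.ext fun x => perm_eq_of_smul (rooted_smul_cons σ x [])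

@[simp]
theorem sec_rooted (σ : Equiv.Perm X) (x : X) : sec (rooted σ) x = 1 :=
  sec_eq_of_smul (σ x) fun w => by rw [rooted_smul_cons, one_smul]

/-- The rooted factor acts first, so the section of f at x ends up as the coordinate at the image of
x; hence the inverse permutation in the family. -/
theorem eq_spread_mul_rooted (f : TreeAut X) :
    f = spread (fun x => sec f ((perm f)⁻¹ x)) * rooted (perm f) :=
  perm_sec_ext (by simp) fun x => by simp

end Sections

/-! ### The cycles σ_i in arithmetic form -/

theorem cyc_apply_of_ne {n : ℕ} [NeZero n] {i x : Fin n} (hx : x ≠ i) :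
    cyc n i x = if x + 1 = i then i + 1 else x + 1 := by
  have hi : i ∈ List.finRange n := List.mem_finRange i
  have hl : (List.finRange n).erase i = (List.finRange n).eraseIdx i.1 := by
    rw [← List.eraseIdx_idxOf_eq_erase, List.idxOf_finRange]
  have hnd : ((List.finRange n).eraseIdx i.1).Nodup := by
    rw [← hl]; exact (List.nodup_finRange n).erase i
  have hlen : ((List.finRange n).eraseIdx i.1).length = n - 1 := by
    rw [List.length_eraseIdx_of_lt (by simp), List.length_finRange]
  have hxi : x.1 ≠ i.1 := fun h => hx (Fin.ext h)
  have hx' := x.2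
  have hi' := i.2
  have key : ∀ j (hj : j < ((List.finRange n).eraseIdx i.1).length),
      (((List.finRange n).eraseIdx i.1)[j]).1 = if j < i.1 then j else j + 1 := by
    intro j hj
    rw [List.getElem_eraseIdx]
    split_ifs <;> simp
  set j := if x.1 < i.1 then x.1 else x.1 - 1 with hj
  have hj' : j < ((List.finRange n).eraseIdx i.1).length := by
    rw [hlen]; split_ifs at hj <;> omega
  have h1 : ((List.finRange n).eraseIdx i.1)[j] = x := by
    apply Fin.ext
    rw [key]
    split_ifs at hj ⊢ <;> omega
  have h2 := List.formPerm_apply_getElem _ hnd j hj'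
  rw [h1] at h2
  rw [cyc, hl, h2]
  apply Fin.ext
  rw [key]
  have h3 : (x + 1 = i) ↔ (x.1 + 1) % n = i.1 := by
    rw [Fin.ext_iff, Fin.val_add, Fin.val_one', Nat.add_mod_mod]
  have hv : ∀ y : Fin n, (y + 1).1 = if y.1 + 1 = n then 0 else y.1 + 1 := by
    intro y
    rw [Fin.val_add, Fin.val_one', Nat.add_mod_mod]
    have := y.2
    split_ifs with h
    · rw [h, Nat.mod_self]
    · exact Nat.mod_eq_of_lt (by omega)
  have h4 : (j + 1) % ((List.finRange n).eraseIdx i.1).length =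
      if j + 1 = n - 1 then 0 else j + 1 := by
    rw [hlen] at hj' ⊢
    split_ifs with h
    · rw [h, Nat.mod_self]
    · exact Nat.mod_eq_of_lt (by omega)
  rw [h4]
  simp only [Fin.ext_iff, hv]
  split_ifs at hj <;> split_ifs <;> simp only [hv] <;> (try split_ifs) <;> omega

/-! ### Powers and commutators computed coordinatewise -/

section Tables

variable {X : Type} [DecidableEq X]

/-- Cubing runs once round the 3-cycle, and each coordinate multiplies u and v in the order in which
they are met from that letter. -/
theorem cube_eq_spread {f u v : TreeAut X} {a b c : X} (hab : a ≠ b) (hac : a ≠ c) (hbc : b ≠ c)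
    (hp : ∀ x, perm f x = if x = a then b else if x = b then c else if x = c then a else x)
    (hs : ∀ x, sec f x = if x = a then u else if x = c then v else 1) :
    f ^ 3 = spread fun x =>
      if x = a then v * u else if x = b then u * v else if x = c then u * v else 1 := by
  rw [pow_three]
  refine eq_spread_iff.2 ⟨Equiv.ext fun x => ?_, fun x => ?_⟩
  · simp only [map_mul, Equiv.Perm.mul_apply, hp, Equiv.Perm.one_apply]
    grind
  · simp only [sec_mul, map_mul, Equiv.Perm.mul_apply, hp, hs]
    by_cases h1 : x = a
    · subst h1; simp [hab, hab.symm, hac, hac.symm, hbc, hbc.symm]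
    by_cases h2 : x = b
    · subst h2; simp [hab, hab.symm, hac, hac.symm, hbc, hbc.symm]
    by_cases h3 : x = c
    · subst h3; simp [hab, hab.symm, hac, hac.symm, hbc, hbc.symm]
    simp [h1, h2, h3]

theorem sq_eq_spread {f u v : TreeAut X} {a b c d : X} (hab : a ≠ b) (hac : a ≠ c) (had : a ≠ d)
    (hbc : b ≠ c) (hbd : b ≠ d) (hcd : c ≠ d)
    (hp : ∀ x, perm f x = if x = a then b else if x = b then a else if x = c then d else
      if x = d then c else x)
    (hs : ∀ x, sec f x = if x = a then u else if x = d then v else 1) :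
    f ^ 2 = spread fun x =>
      if x = a then u else if x = b then u else if x = c then v else if x = d then v else 1 := by
  rw [pow_two]
  refine eq_spread_iff.2 ⟨Equiv.ext fun x => ?_, fun x => ?_⟩
  · simp only [map_mul, Equiv.Perm.mul_apply, hp, Equiv.Perm.one_apply]
    grind
  · simp only [sec_mul, hp, hs]
    by_cases h1 : x = a
    · subst h1; simp [hab.symm, hbd]
    by_cases h2 : x = b
    · subst h2; simp [hab, hab.symm, hbc, hbd, had]
    by_cases h3 : x = c
    · subst h3; simp [hac.symm, hbc.symm, hcd, had.symm]
    by_cases h4 : x = d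
    · subst h4; simp [hcd.symm, had.symm, hbd.symm, hac.symm, hcd]
    simp [h1, h2, h3, h4]

/-- A double swap supported on four letters and a three-cycle that moves two of them to a fifth
letter. -/
theorem commutator_eq_spread_of_five {f u v w : TreeAut X} {a b c d e : X} (hac : a ≠ c)
    (had : a ≠ d) (hae : a ≠ e) (hbc : b ≠ c) (hbd : b ≠ d) (hbe : b ≠ e)
    (hcd : c ≠ d) (hce : c ≠ e) (hde : d ≠ e)
    (hp : ∀ x, perm f x = if x = c then d else if x = d then e else if x = e then c else x)
    (hs : ∀ x, sec f x = if x = c then v⁻¹ else if x = e then w else 1) :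
    f * (spread fun x =>
      if x = a then u else if x = b then u else if x = c then v else if x = d then v else 1) * f⁻¹ *
      (spread fun x => if x = a then u else if x = b then u else if x = c then v else
        if x = d then v else 1)⁻¹ =
      spread fun x => if x = c then v⁻¹ else if x = e then v else 1 := by
  rw [conj_spread, ← map_inv spread, ← map_mul spread]
  congr 1
  funext x
  obtain ⟨y, rfl⟩ := (perm f).surjective x
  have hy : (perm f)⁻¹ (perm f y) = y := by simp
  simp only [Pi.mul_apply, Pi.inv_apply, hy]
  simp only [hp, hs]
  by_cases h1 : y = c
  · subst h1; simp [hac.symm, hbc.symm, had.symm, hbd.symm, hcd.symm, hde]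
  by_cases h2 : y = d
  · subst h2; simp [had.symm, hbd.symm, hae.symm, hbe.symm, hce.symm, hcd.symm, hde.symm, hde]
  by_cases h3 : y = e
  · subst h3; simp [hae.symm, hbe.symm, hce.symm, hde.symm, hac.symm, hbc.symm]
  simp only [if_neg h1, if_neg h2, if_neg h3]
  by_cases h4 : y = a
  · simp [h4]
  by_cases h5 : y = b
  · simp [h5]
  simp [h4, h5]

/-- The variant with four letters: the three-cycle moves three of them. -/
theorem commutator_eq_spread_of_four {f u v w : TreeAut X} {a b c d : X} (hab : a ≠ b)
    (hac : a ≠ c) (had : a ≠ d) (hbc : b ≠ c) (hbd : b ≠ d) (hcd : c ≠ d)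
    (hp : ∀ x, perm f x = if x = c then d else if x = d then a else if x = a then c else x)
    (hs : ∀ x, sec f x = if x = c then v⁻¹ else if x = a then w else 1) :
    f * (spread fun x =>
      if x = a then u else if x = b then u else if x = c then v else if x = d then v else 1) * f⁻¹ *
      (spread fun x => if x = a then u else if x = b then u else if x = c then v else
        if x = d then v else 1)⁻¹ =
      spread fun x => if x = a then v * u⁻¹ else if x = c then w * u * w⁻¹ * v⁻¹ else 1 := by
  rw [conj_spread, ← map_inv spread, ← map_mul spread]
  congr 1
  funext x
  obtain ⟨y, rfl⟩ := (perm f).surjective x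
  have hy : (perm f)⁻¹ (perm f y) = y := by simp
  simp only [Pi.mul_apply, Pi.inv_apply, hy]
  simp only [hp, hs]
  by_cases h1 : y = c
  · subst h1; simp [hac.symm, hbc.symm, had.symm, hbd.symm, hcd.symm]
  by_cases h2 : y = d
  · subst h2; simp [had.symm, hbd.symm, hcd.symm]
  by_cases h3 : y = a
  · subst h3; simp [hac, hac.symm, hbc.symm, had]
  simp only [if_neg h1, if_neg h2, if_neg h3]
  by_cases h5 : y = b
  · simp [h5]
  simp [h5]

end Tables

/-! ### Explicit elements of the first level stabilizer -/

section Generators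

open Fin.CommRing

variable {n : ℕ}

@[simp]
theorem perm_gen (i : Fin n) : perm (gen n i) = cyc n i := by
  refine Equiv.ext fun x => perm_eq_of_smul (w := []) (w' := []) ?_
  change spineFun (cyc n i) i [x] = _
  simp [spineFun]

@[simp]
theorem sec_gen (i x : Fin n) : sec (gen n i) x = if x = i then gen n i else 1 := by
  refine sec_eq_of_smul (cyc n i x) fun w => ?_
  change spineFun (cyc n i) i (x :: w) = _
  by_cases h : x = i
  · rw [if_pos h, spineFun, if_pos h]
    rfl
  · rw [if_neg h, spineFun, if_neg h, one_smul]

theorem gen_mem (i : Fin n) : gen n i ∈ hanoi n := Subgroup.subset_closure ⟨i, rfl⟩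

variable [NeZero n]

theorem cyc_apply (i x : Fin n) :
    cyc n i x = if x = i then i else if x + 1 = i then i + 1 else x + 1 := by
  split_ifs with h h'
  · rw [h, cyc_self]
  · rw [cyc_apply_of_ne h, if_pos h']
  · rw [cyc_apply_of_ne h, if_neg h']


/-- The cyclic successor avoiding `i`, in a commutative ring. -/
def skipSucc {R : Type} [CommRing R] [DecidableEq R] (i x : R) : R :=
  if x = i then i else if x + 1 = i then i + 1 else x + 1

/-- This says that σ_{i+1}⁻¹ σ_{i+2} is the 3-cycle (i, i+1, i+2). Over a commutative ring in which
1, 2, 3 are nonzero it becomes a finite case split. -/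
theorem skipSucc_add_two {R : Type} [CommRing R] [DecidableEq R] (h1 : (1 : R) ≠ 0)
    (h2 : (2 : R) ≠ 0) (h3 : (3 : R) ≠ 0) (i x : R) :
    skipSucc (i + 2) x = skipSucc (i + 1)
      (if x = i then i + 1 else if x = i + 1 then i + 2 else if x = i + 2 then i else x) := by
  unfold skipSucc
  have e1 : i + 1 ≠ i := by simpa using h1
  have e2 : i + 2 ≠ i := by simpa using h2
  have e3 : i + 3 ≠ i := by simpa using h3
  grind

theorem skipSucc_add_three {R : Type} [CommRing R] [DecidableEq R] (h1 : (1 : R) ≠ 0)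
    (h2 : (2 : R) ≠ 0) (h3 : (3 : R) ≠ 0) (i x : R) :
    skipSucc (i + 3) x = skipSucc (i + 1)
      (if x = i then i + 1 else if x = i + 1 then i else if x = i + 2 then i + 3 else
        if x = i + 3 then i + 2 else x) := by
  unfold skipSucc
  have e1 : i + 1 ≠ i := by simpa using h1
  have e2 : i + 2 ≠ i := by simpa using h2
  have e3 : i + 3 ≠ i := by simpa using h3
  grind

theorem fin_ofNat_ne_zero {k : ℕ} (hk : 0 < k) (hn : k < n) : (k : Fin n) ≠ 0 := by
  rw [Ne, Fin.ext_iff, Fin.val_natCast, Nat.mod_eq_of_lt hn]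
  exact hk.ne'

theorem add_ne_add (i : Fin n) {j k : ℕ} (hjk : j < k) (hk : k < n) : i + (j : Fin n) ≠ i + k := by
  intro h
  have h' : ((k - j : ℕ) : Fin n) = 0 := by
    rw [Nat.cast_sub hjk.le, sub_eq_zero]
    exact (add_left_cancel h).symm
  exact fin_ofNat_ne_zero (n := n) (k := k - j) (by omega) (by omega) h'

theorem add_one_ne (hn : 4 ≤ n) (i : Fin n) : i + 1 ≠ i := by
  simpa using fin_ofNat_ne_zero (n := n) (k := 1) (by omega) (by omega)

theorem add_two_ne (hn : 4 ≤ n) (i : Fin n) : i + 2 ≠ i := by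
  simpa using fin_ofNat_ne_zero (n := n) (k := 2) (by omega) (by omega)

theorem add_three_ne (hn : 4 ≤ n) (i : Fin n) : i + 3 ≠ i := by
  simpa using fin_ofNat_ne_zero (n := n) (k := 3) (by omega) (by omega)

theorem perm_threeCycle (hn : 4 ≤ n) (i x : Fin n) :
    perm ((gen n (i + 1))⁻¹ * gen n (i + 2)) x =
      if x = i then i + 1 else if x = i + 1 then i + 2 else if x = i + 2 then i else x := by
  rw [map_mul, map_inv, perm_gen, perm_gen, Equiv.Perm.mul_apply, Equiv.Perm.inv_eq_iff_eq,
    cyc_apply, cyc_apply]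
  exact skipSucc_add_two (by simpa using add_one_ne hn 0) (by simpa using add_two_ne hn 0)
    (by simpa using add_three_ne hn 0) i x

theorem perm_doubleSwap (hn : 4 ≤ n) (i x : Fin n) :
    perm ((gen n (i + 1))⁻¹ * gen n (i + 3)) x =
      if x = i then i + 1 else if x = i + 1 then i else if x = i + 2 then i + 3 else
        if x = i + 3 then i + 2 else x := by
  rw [map_mul, map_inv, perm_gen, perm_gen, Equiv.Perm.mul_apply, Equiv.Perm.inv_eq_iff_eq,
    cyc_apply, cyc_apply]
  exact skipSucc_add_three (by simpa using add_one_ne hn 0) (by simpa using add_two_ne hn 0)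
    (by simpa using add_three_ne hn 0) i x

theorem sec_gen_inv_mul_gen (i j x : Fin n) : sec ((gen n i)⁻¹ * gen n j) x =
    (if perm ((gen n i)⁻¹ * gen n j) x = i then (gen n i)⁻¹ else 1) *
      (if x = j then gen n j else 1) := by
  rw [map_mul, map_inv, Equiv.Perm.mul_apply, sec_mul, sec_inv, sec_gen, sec_gen, apply_ite Inv.inv,
    inv_one]

theorem letters_ne (hn : 4 ≤ n) (i : Fin n) : i ≠ i + 1 ∧ i ≠ i + 2 ∧ i ≠ i + 3 ∧ i + 1 ≠ i + 2 ∧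
    i + 1 ≠ i + 3 ∧ i + 2 ≠ i + 3 := by
  refine ⟨?_, ?_, ?_, ?_, ?_, ?_⟩
  · simpa using add_ne_add i (j := 0) (k := 1) (by omega) (by omega)
  · simpa using add_ne_add i (j := 0) (k := 2) (by omega) (by omega)
  · simpa using add_ne_add i (j := 0) (k := 3) (by omega) (by omega)
  · simpa using add_ne_add i (j := 1) (k := 2) (by omega) (by omega)
  · simpa using add_ne_add i (j := 1) (k := 3) (by omega) (by omega)
  · simpa using add_ne_add i (j := 2) (k := 3) (by omega) (by omega)

theorem letters_ne_add_four (hn : 5 ≤ n) (i : Fin n) :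
    i ≠ i + 4 ∧ i + 1 ≠ i + 4 ∧ i + 2 ≠ i + 4 ∧ i + 3 ≠ i + 4 := by
  refine ⟨?_, ?_, ?_, ?_⟩
  · simpa using add_ne_add i (j := 0) (k := 4) (by omega) (by omega)
  · simpa using add_ne_add i (j := 1) (k := 4) (by omega) (by omega)
  · simpa using add_ne_add i (j := 2) (k := 4) (by omega) (by omega)
  · simpa using add_ne_add i (j := 3) (k := 4) (by omega) (by omega)

theorem sec_threeCycle (hn : 4 ≤ n) (i x : Fin n) :
    sec ((gen n (i + 1))⁻¹ * gen n (i + 2)) x =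
      if x = i then (gen n (i + 1))⁻¹ else if x = i + 2 then gen n (i + 2) else 1 := by
  rw [sec_gen_inv_mul_gen, perm_threeCycle hn]
  obtain ⟨h01, h02, h03, h12, h13, h23⟩ := letters_ne hn i
  by_cases h1 : x = i
  · simp [h1, h02]
  by_cases h2 : x = i + 1
  · simp [h2, h01.symm, h12, h12.symm]
  by_cases h3 : x = i + 2
  · simp [h3, h02.symm, h12.symm, h01]
  simp [h1, h2, h3]

theorem sec_doubleSwap (hn : 4 ≤ n) (i x : Fin n) :
    sec ((gen n (i + 1))⁻¹ * gen n (i + 3)) x =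
      if x = i then (gen n (i + 1))⁻¹ else if x = i + 3 then gen n (i + 3) else 1 := by
  rw [sec_gen_inv_mul_gen, perm_doubleSwap hn]
  obtain ⟨h01, h02, h03, h12, h13, h23⟩ := letters_ne hn i
  by_cases h1 : x = i
  · simp [h1, h03]
  by_cases h2 : x = i + 1
  · simp [h2, h01.symm, h13, h01]
  by_cases h3 : x = i + 2
  · simp [h3, h02.symm, h12.symm, h13.symm, h23]
  by_cases h4 : x = i + 3
  · simp [h4, h03.symm, h13.symm, h23.symm, h12.symm]
  simp [h1, h2, h3, h4]

theorem gen_inv_mul_gen_mem (i j : Fin n) : (gen n i)⁻¹ * gen n j ∈ hanoi n :=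
  mul_mem (inv_mem (gen_mem i)) (gen_mem j)

theorem spread_threeCycle_mem (hn : 4 ≤ n) (i : Fin n) :
    (spread fun x => if x = i then gen n (i + 2) * (gen n (i + 1))⁻¹ else
      if x = i + 1 then (gen n (i + 1))⁻¹ * gen n (i + 2) else
      if x = i + 2 then (gen n (i + 1))⁻¹ * gen n (i + 2) else 1) ∈ hanoi n := by
  obtain ⟨h01, h02, -, h12, -, -⟩ := letters_ne hn i
  rw [← cube_eq_spread h01 h02 h12 (perm_threeCycle hn i) (sec_threeCycle hn i)]
  exact pow_mem (gen_inv_mul_gen_mem _ _) 3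

theorem spread_doubleSwap_mem (hn : 4 ≤ n) (i : Fin n) :
    (spread fun x => if x = i then (gen n (i + 1))⁻¹ else if x = i + 1 then (gen n (i + 1))⁻¹ else
      if x = i + 2 then gen n (i + 3) else if x = i + 3 then gen n (i + 3) else 1) ∈ hanoi n := by
  obtain ⟨h01, h02, h03, h12, h13, h23⟩ := letters_ne hn i
  rw [← sq_eq_spread h01 h02 h03 h12 h13 h23 (perm_doubleSwap hn i) (sec_doubleSwap hn i)]
  exact pow_mem (gen_inv_mul_gen_mem _ _) 2

/-- The squared double swap has equal coordinates on each of the pairs i, i+1 and i+2, i+3.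
Commuting it with the 3-cycle on i+2, i+3 and a fifth letter i+4 cancels the first pair and leaves a
generator at one letter and its inverse at another. This is where five letters are needed. -/
theorem spread_pair_mem (hn : 5 ≤ n) (i : Fin n) :
    (spread fun x => if x = i + 2 then (gen n (i + 3))⁻¹ else
      if x = i + 4 then gen n (i + 3) else 1) ∈ hanoi n := by
  have hn' : 4 ≤ n := by omega
  obtain ⟨h01, h02, h03, h12, h13, h23⟩ := letters_ne hn' i
  obtain ⟨h04, h14, h24, h34⟩ := letters_ne_add_four hn i
  have e3 : i + 2 + 1 = i + 3 := by ring
  have e4 : i + 2 + 2 = i + 4 := by ring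
  have hp := perm_threeCycle hn' (i + 2)
  have hs := sec_threeCycle hn' (i + 2)
  rw [e3, e4] at hp hs
  rw [← commutator_eq_spread_of_five h02 h03 h04 h12 h13 h14 h23 h24 h34 hp hs]
  exact mul_mem (mul_mem (mul_mem (gen_inv_mul_gen_mem _ _) (spread_doubleSwap_mem hn' i))
    (inv_mem (gen_inv_mul_gen_mem _ _))) (inv_mem (spread_doubleSwap_mem hn' i))

/-- The same commutator without a fifth letter: the 3-cycle must run back to i, so products of two
generators survive instead of single ones. -/
theorem spread_pair_mem_four (i : Fin 4) :
    (spread fun x => if x = i then gen 4 (i + 3) * gen 4 (i + 1) else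
      if x = i + 2 then gen 4 i * (gen 4 (i + 1))⁻¹ * (gen 4 i)⁻¹ * (gen 4 (i + 3))⁻¹ else 1) ∈
      hanoi 4 := by
  have hn' : 4 ≤ 4 := le_rfl
  obtain ⟨h01, h02, h03, h12, h13, h23⟩ := letters_ne hn' i
  have e3 : i + 2 + 1 = i + 3 := by ring
  have e4 : i + 2 + 2 = i := by revert i; decide
  have hp := perm_threeCycle hn' (i + 2)
  have hs := sec_threeCycle hn' (i + 2)
  rw [e3, e4] at hp hs
  have := commutator_eq_spread_of_four (u := (gen 4 (i + 1))⁻¹) h01 h02 h03 h12 h13 h23 hp hs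
  rw [inv_inv] at this
  rw [← this]
  exact mul_mem (mul_mem (mul_mem (gen_inv_mul_gen_mem _ _) (spread_doubleSwap_mem hn' i))
    (inv_mem (gen_inv_mul_gen_mem _ _))) (inv_mem (spread_doubleSwap_mem hn' i))

end Generators


/-! ### Transitivity -/

section Transitivity

variable {n : ℕ}

theorem hanoi_induction {p : TreeAut (Fin n) → Prop} (hg : ∀ i, p (gen n i)) (h1 : p 1)
    (hm : ∀ f g, f ∈ hanoi n → g ∈ hanoi n → p f → p g → p (f * g))
    (hi : ∀ f, f ∈ hanoi n → p f → p f⁻¹) {f : TreeAut (Fin n)} (hf : f ∈ hanoi n) : p f := by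
  refine Subgroup.closure_induction (p := fun f _ => p f) ?_ h1 (fun f g hf hg => hm f g hf hg)
    (fun f hf => hi f hf) hf
  rintro _ ⟨i, rfl⟩
  exact hg i

theorem sec_mem {f : TreeAut (Fin n)} (hf : f ∈ hanoi n) (x : Fin n) : sec f x ∈ hanoi n := by
  revert x
  refine hanoi_induction (p := fun f => ∀ x, sec f x ∈ hanoi n) ?_ ?_ ?_ ?_ hf
  · intro i x
    rw [sec_gen]
    split_ifs
    exacts [gen_mem i, one_mem _]
  · intro x
    rw [sec_one]
    exact one_mem _
  · intro f g _ _ hf hg x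
    rw [sec_mul]
    exact mul_mem (hf _) (hg _)
  · intro f _ hf x
    rw [sec_inv]
    exact inv_mem (hf _)

theorem coord_mem {d : Fin n → TreeAut (Fin n)} (hd : spread d ∈ hanoi n) (x : Fin n) :
    d x ∈ hanoi n := by
  rw [← sec_spread d x]
  exact sec_mem hd x

theorem isCycle_cyc (hn : 3 ≤ n) (i : Fin n) : (cyc n i).IsCycle := by
  refine List.isCycle_formPerm ((List.nodup_finRange n).erase i) ?_
  rw [List.length_erase_of_mem (List.mem_finRange i), List.length_finRange]
  omega

theorem cyc_pow (i : Fin n) : cyc n i ^ (n - 1) = 1 := by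
  have := List.formPerm_pow_length_eq_one_of_nodup _ ((List.nodup_finRange n).erase i)
  rwa [List.length_erase_of_mem (List.mem_finRange i), List.length_finRange] at this

theorem cyc_pow_self (i : Fin n) (k : ℕ) : (cyc n i ^ k) i = i := by
  induction k with
  | zero => rfl
  | succ k ih => rw [pow_succ, Equiv.Perm.mul_apply, cyc_self, ih]

theorem cyc_ne {i x : Fin n} (hx : x ≠ i) : cyc n i x ≠ i := fun h =>
  hx ((cyc n i).injective (h.trans (cyc_self n i).symm))

theorem mem_support_cyc (hn : 3 ≤ n) {i x : Fin n} (hx : x ≠ i) : cyc n i x ≠ x := by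
  have h := List.support_formPerm_of_nodup _ ((List.nodup_finRange n).erase i) (by
    intro y hy
    have := congrArg List.length hy
    rw [List.length_erase_of_mem (List.mem_finRange i), List.length_finRange,
      List.length_singleton] at this
    omega)
  rw [← Equiv.Perm.mem_support]
  change x ∈ (List.formPerm _).support
  rw [h, List.mem_toFinset, List.Nodup.mem_erase_iff (List.nodup_finRange n)]
  exact ⟨hx, List.mem_finRange x⟩

theorem exists_cyc_pow_eq (hn : 3 ≤ n) {i x y : Fin n} (hx : x ≠ i) (hy : y ≠ i) :
    ∃ k : ℕ, (cyc n i ^ k) x = y :=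
  (isCycle_cyc hn i).exists_pow_eq (mem_support_cyc hn hx) (mem_support_cyc hn hy)

theorem sec_gen_pow_of_ne {i x : Fin n} (hx : x ≠ i) (k : ℕ) : sec (gen n i ^ k) x = 1 := by
  induction k generalizing x with
  | zero => rw [pow_zero, sec_one]
  | succ k ih => rw [pow_succ, sec_mul, perm_gen, ih (cyc_ne hx), sec_gen, if_neg hx, one_mul]

theorem sec_gen_pow_self (i : Fin n) (k : ℕ) : sec (gen n i ^ k) i = gen n i ^ k := by
  induction k with
  | zero => rw [pow_zero, sec_one]
  | succ k ih => rw [pow_succ, sec_mul, perm_gen, cyc_self, ih, sec_gen, if_pos rfl]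

/-- The power acts trivially on the first level and its only possibly nontrivial section is itself
at i, so induction on words applies. -/
theorem gen_pow (i : Fin n) : gen n i ^ (n - 1) = 1 := by
  refine treeAut_ext fun w => ?_
  rw [one_smul]
  induction w with
  | nil => rw [smul_nil]
  | cons x w ih =>
    rw [smul_cons, map_pow, perm_gen, cyc_pow, Equiv.Perm.one_apply]
    by_cases hx : x = i
    · rw [hx, sec_gen_pow_self, ih]
    · rw [sec_gen_pow_of_ne hx, one_smul]

theorem exists_ne_ne (hn : 3 ≤ n) (x y : Fin n) : ∃ z, z ≠ x ∧ z ≠ y := by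
  obtain ⟨z, hz⟩ : ∃ z, z ∉ ({x, y} : Finset (Fin n)) := by
    refine not_forall.1 fun h => ?_
    have h1 : ({x, y} : Finset (Fin n)) = Finset.univ := Finset.eq_univ_iff_forall.2 h
    have h2 := Finset.card_le_two (a := x) (b := y)
    rw [h1, Finset.card_univ, Fintype.card_fin] at h2
    omega
  rw [Finset.mem_insert, Finset.mem_singleton, not_or] at hz
  exact ⟨z, hz⟩

/-- Every letter can be moved to every other letter with a trivial section. -/
theorem exists_perm_eq_sec_eq_one (hn : 3 ≤ n) (x y : Fin n) :
    ∃ g ∈ hanoi n, perm g x = y ∧ sec g x = 1 := by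
  obtain ⟨i, hx, hy⟩ := exists_ne_ne hn x y
  obtain ⟨k, hk⟩ := exists_cyc_pow_eq hn hx.symm hy.symm
  exact ⟨gen n i ^ k, pow_mem (gen_mem i) k, by rw [map_pow, perm_gen, hk],
    sec_gen_pow_of_ne hx.symm k⟩

theorem exists_perm_eq_perm_eq (hn : 3 ≤ n) {x y x' y' : Fin n} (h : x ≠ y) (h' : x' ≠ y') :
    ∃ g ∈ hanoi n, perm g x = x' ∧ perm g y = y' := by
  obtain ⟨g, hg, hgx, -⟩ := exists_perm_eq_sec_eq_one hn x x'
  have hy : perm g y ≠ x' := fun h'' => h ((perm g).injective (hgx.trans h''.symm))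
  obtain ⟨k, hk⟩ := exists_cyc_pow_eq hn hy h'.symm
  -- Once x is at x', powers of the generator at x' keep it there and rotate all other letters.
  refine ⟨gen n x' ^ k * g, mul_mem (pow_mem (gen_mem _) k) hg, ?_, ?_⟩
  · rw [map_mul, Equiv.Perm.mul_apply, hgx, map_pow, perm_gen, cyc_pow_self]
  · rw [map_mul, Equiv.Perm.mul_apply, map_pow, perm_gen, hk]

end Transitivity

/-! ### Coordinates of the elements of the stabilizer of the first level -/

section Avoid

open Fin.CommRing commutatorElement

variable {n : ℕ}

/-- The `x`-th coordinates of the elements of `Stab(1)` with trivial coordinates in `Z`. -/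
def avoid (Z : Set (Fin n)) (x : Fin n) : Subgroup (TreeAut (Fin n)) :=
  ((hanoi n).comap spread ⊓ Subgroup.pi Z fun _ => ⊥).map (Pi.evalMonoidHom _ x)

theorem mem_avoid {Z : Set (Fin n)} {x : Fin n} {g : TreeAut (Fin n)} :
    g ∈ avoid Z x ↔ ∃ d, spread d ∈ hanoi n ∧ (∀ z ∈ Z, d z = 1) ∧ d x = g := by
  simp only [avoid, Subgroup.mem_map, Subgroup.mem_inf, Subgroup.mem_comap, Subgroup.mem_pi,
    Subgroup.mem_bot, Pi.evalMonoidHom_apply, and_assoc]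

theorem graft_mem_iff {x : Fin n} {g : TreeAut (Fin n)} :
    graft x g ∈ hanoi n ↔ g ∈ avoid {x}ᶜ x := by
  rw [mem_avoid, graft_eq_spread]
  constructor
  · exact fun h => ⟨_, h, fun z hz => Pi.mulSingle_eq_of_ne hz _, Pi.mulSingle_eq_same _ _⟩
  · rintro ⟨d, hd, hd', rfl⟩
    convert hd using 2
    funext y
    by_cases h : y = x
    · rw [h, Pi.mulSingle_eq_same]
    · rw [Pi.mulSingle_eq_of_ne h, hd' y h]

/-- A commutator is trivial wherever one of its entries is, so the sets of vanishing coordinates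
unite. This is the mechanism that concentrates elements at one letter. -/
theorem commutator_mem_avoid {Z Z' : Set (Fin n)} {x : Fin n} {u v : TreeAut (Fin n)}
    (hu : u ∈ avoid Z x) (hv : v ∈ avoid Z' x) : ⁅u, v⁆ ∈ avoid (Z ∪ Z') x := by
  obtain ⟨d, hd, hd', rfl⟩ := mem_avoid.1 hu
  obtain ⟨e, he, he', rfl⟩ := mem_avoid.1 hv
  refine mem_avoid.2 ⟨⁅d, e⁆, ?_, ?_, rfl⟩
  · rw [map_commutatorElement]
    exact mul_mem (mul_mem (mul_mem hd he) (inv_mem hd)) (inv_mem he)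
  · rintro z (hz | hz)
    · change ⁅d z, e z⁆ = 1
      rw [hd' z hz, commutatorElement_one_left]
    · change ⁅d z, e z⁆ = 1
      rw [he' z hz, commutatorElement_one_right]

theorem avoid_mono {Z Z' : Set (Fin n)} (h : Z ⊆ Z') (x : Fin n) : avoid Z' x ≤ avoid Z x := by
  intro g hg
  obtain ⟨d, hd, hd', rfl⟩ := mem_avoid.1 hg
  exact mem_avoid.2 ⟨d, hd, fun z hz => hd' z (h hz), rfl⟩

variable [NeZero n]

/-- `Stab(1)` is a subdirect product of copies of the group. -/
theorem exists_coord_eq (hn : 4 ≤ n) (x : Fin n) {g : TreeAut (Fin n)} (hg : g ∈ hanoi n) :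
    ∃ d, spread d ∈ hanoi n ∧ d x = g := by
  suffices hanoi n ≤ avoid ∅ x by
    obtain ⟨d, hd, -, rfl⟩ := mem_avoid.1 (this hg)
    exact ⟨d, hd, rfl⟩
  refine (Subgroup.closure_le _).2 ?_
  rintro _ ⟨j, rfl⟩
  -- The shift by 1 is chosen because the squared double swap based at j - 1 has the inverse of the
  -- j-th generator as its first coordinate; the trivial section of f carries it unchanged to x.
  obtain ⟨f, hf, hfx, hfs⟩ := exists_perm_eq_sec_eq_one (by omega) (j - 1) x
  rw [SetLike.mem_coe, ← inv_mem_iff (H := avoid ∅ x)]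
  have h := mul_mem (mul_mem hf (spread_doubleSwap_mem hn (j - 1))) (inv_mem hf)
  rw [conj_spread] at h
  refine mem_avoid.2 ⟨_, h, fun z hz => hz.elim, ?_⟩
  have : (perm f)⁻¹ x = j - 1 := by rw [Equiv.Perm.inv_eq_iff_eq, hfx]
  simp only [this, hfs, if_true]
  simp

/-- Any g in G is the x-coordinate of some element of Stab(1), and conjugating by that element keeps
trivial coordinates trivial. -/
theorem conj_mem_avoid (hn : 4 ≤ n) {Z : Set (Fin n)} {x : Fin n} {u g : TreeAut (Fin n)}
    (hu : u ∈ avoid Z x) (hg : g ∈ hanoi n) : g * u * g⁻¹ ∈ avoid Z x := by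
  obtain ⟨d, hd, hd', rfl⟩ := mem_avoid.1 hu
  obtain ⟨e, he, rfl⟩ := exists_coord_eq hn x hg
  refine mem_avoid.2 ⟨e * d * e⁻¹, ?_, fun z hz => ?_, rfl⟩
  · rw [map_mul, map_mul, map_inv]
    exact mul_mem (mul_mem he hd) (inv_mem he)
  · rw [Pi.mul_apply, Pi.mul_apply, Pi.inv_apply, hd' z hz, mul_one, mul_inv_cancel]

theorem mem_avoid_of_perm (hn : 4 ≤ n) {Z Z' : Set (Fin n)} {x : Fin n} {u f : TreeAut (Fin n)}
    (hu : u ∈ avoid Z x) (hf : f ∈ hanoi n) (h : ∀ z, perm f z ∈ Z' → z ∈ Z) :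
    u ∈ avoid Z' (perm f x) := by
  obtain ⟨d, hd, hd', rfl⟩ := mem_avoid.1 hu
  have h1 := mul_mem (mul_mem hf hd) (inv_mem hf)
  rw [conj_spread] at h1
  have h2 : sec f x * d x * (sec f x)⁻¹ ∈ avoid Z' (perm f x) := by
    refine mem_avoid.2 ⟨_, h1, fun z hz => ?_, by simp⟩
    rw [hd' _ (h _ (by simpa using hz)), mul_one, mul_inv_cancel]
  simpa [mul_assoc] using conj_mem_avoid hn h2 (inv_mem (sec_mem hf x))

theorem le_avoid_compl_pair (hn : 5 ≤ n) {x y : Fin n} (h : x ≠ y) :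
    hanoi n ≤ avoid {x, y}ᶜ x := by
  refine (Subgroup.closure_le _).2 ?_
  rintro _ ⟨j, rfl⟩
  obtain ⟨i, rfl⟩ : ∃ i : Fin n, j = i + 3 := ⟨j - 3, (sub_add_cancel j _).symm⟩
  have h24 := (letters_ne_add_four hn i).2.2.1
  obtain ⟨f, hf, rfl, rfl⟩ := exists_perm_eq_perm_eq (by omega) h24.symm h
  refine mem_avoid_of_perm (Z := {i + 4, i + 2}ᶜ) (by omega)
    (mem_avoid.2 ⟨_, spread_pair_mem hn i, ?_, ?_⟩) hf ?_
  · intro z hz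
    simp only [Set.mem_compl_iff, Set.mem_insert_iff, Set.mem_singleton_iff, not_or] at hz
    rw [if_neg hz.2, if_neg hz.1]
  · rw [if_neg h24.symm, if_pos rfl]
  · intro z hz
    simpa using hz

/-- Two consecutive quotients give c (i+2) (c i)⁻¹; comparison with c (i+2) c i gives (c i)², and (c
i)⁴ = c i. This extracts single generators from the products available for n = 4, where generators
have cube 1. -/
theorem mem_of_mul_inv_mem_of_mul_mem {A : Type*} [Group A] {U : Subgroup A} {c : Fin 4 → A}
    (h3 : ∀ i, c i ^ 3 = 1) (h : ∀ i, c (i + 1) * (c i)⁻¹ ∈ U) (h' : ∀ i, c (i + 2) * c i ∈ U)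
    (i : Fin 4) : c i ∈ U := by
  have h2 : c (i + 2) * (c i)⁻¹ ∈ U := by
    have := mul_mem (h (i + 1)) (h i)
    rw [show i + 1 + 1 = i + 2 by ring] at this
    simpa [mul_assoc] using this
  have h4 : c i ^ 2 ∈ U := by
    have := mul_mem (inv_mem h2) (h' i)
    simpa [mul_assoc, pow_two] using this
  have h5 := pow_mem h4 2
  rwa [← pow_mul, pow_succ, h3, one_mul] at h5

/-- With four letters only one unwanted coordinate is killed at a time: the cube of the 3-cycle
supplies quotients of generators, `spread_pair_mem_four` supplies products. -/
theorem le_avoid_singleton {x y : Fin 4} (h : x ≠ y) : hanoi 4 ≤ avoid {y} x := by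
  refine (Subgroup.closure_le _).2 ?_
  rintro _ ⟨j, rfl⟩
  refine mem_of_mul_inv_mem_of_mul_mem (c := gen 4) gen_pow ?_ ?_ j
  · intro i
    obtain ⟨i, rfl⟩ : ∃ j : Fin 4, i = j + 1 := ⟨i - 1, (sub_add_cancel i _).symm⟩
    obtain ⟨h01, h02, h03, h12, h13, h23⟩ := letters_ne le_rfl i
    obtain ⟨f, hf, rfl, rfl⟩ := exists_perm_eq_perm_eq (by omega) h03 h
    rw [show i + 1 + 1 = i + 2 by ring]
    refine mem_avoid_of_perm (Z := {i + 3}) le_rfl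
      (mem_avoid.2 ⟨_, spread_threeCycle_mem le_rfl i, ?_, ?_⟩) hf ?_
    · rintro z rfl
      rw [if_neg h03.symm, if_neg h13.symm, if_neg h23.symm]
    · rw [if_pos rfl]
    · intro z hz
      simpa using hz
  · intro i
    obtain ⟨i, rfl⟩ : ∃ j : Fin 4, i = j + 1 := ⟨i - 1, (sub_add_cancel i _).symm⟩
    obtain ⟨h01, h02, h03, h12, h13, h23⟩ := letters_ne le_rfl i
    obtain ⟨f, hf, rfl, rfl⟩ := exists_perm_eq_perm_eq (by omega) h01 h
    rw [show i + 1 + 2 = i + 3 by ring]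
    refine mem_avoid_of_perm (Z := {i + 1}) le_rfl
      (mem_avoid.2 ⟨_, spread_pair_mem_four i, ?_, ?_⟩) hf ?_
    · rintro z rfl
      rw [if_neg h01.symm, if_neg h12]
    · rw [if_pos rfl]
    · intro z hz
      simpa using hz

/-- Realize one entry on the letters x, y and the other on x, z: the commutator lives at x alone. -/
theorem graft_commutator_mem_of_five (hn : 5 ≤ n) (x : Fin n) :
    ⁅hanoi n, hanoi n⁆ ≤ avoid {x}ᶜ x := by
  obtain ⟨y, hy, -⟩ := exists_ne_ne (by omega) x x
  obtain ⟨z, hz, hzy⟩ := exists_ne_ne (by omega) x y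
  refine Subgroup.commutator_le.2 fun g hg g' hg' => ?_
  refine avoid_mono ?_ _ (commutator_mem_avoid (le_avoid_compl_pair hn hy.symm hg)
    (le_avoid_compl_pair hn hz.symm hg'))
  intro w hw
  by_cases h : w = y
  · right
    simp only [Set.mem_compl_iff, Set.mem_insert_iff, Set.mem_singleton_iff, not_or]
    exact ⟨hw, fun h' => hzy (h'.symm.trans h)⟩
  · left
    simp only [Set.mem_compl_iff, Set.mem_insert_iff, Set.mem_singleton_iff, not_or]
    exact ⟨hw, h⟩

/-- Three other letters have to be killed, one per entry, so a priori only triple commutators can be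
planted. `graft_commutator_mem_four` improves this. -/
theorem lowerCentral_le_avoid_four (x : Fin 4) :
    ⁅⁅hanoi 4, hanoi 4⁆, hanoi 4⁆ ≤ avoid {x}ᶜ x := by
  obtain ⟨y, z, w, hy, hz, hw, h⟩ : ∃ y z w : Fin 4, x ≠ y ∧ x ≠ z ∧ x ≠ w ∧
      ∀ v, v ≠ x → (v = y ∨ v = z) ∨ v = w := by
    revert x; decide
  have h1 : ⁅hanoi 4, hanoi 4⁆ ≤ avoid ({y} ∪ {z}) x := Subgroup.commutator_le.2 fun g hg g' hg' =>
    commutator_mem_avoid (le_avoid_singleton hy hg) (le_avoid_singleton hz hg')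
  refine Subgroup.commutator_le.2 fun g hg g' hg' => ?_
  exact avoid_mono (fun v hv => h v hv) _
    (commutator_mem_avoid (h1 hg) (le_avoid_singleton hw hg'))

end Avoid


/-! ### Coordinates modulo the commutator subgroup -/

section Abelian

open Fin.CommRing commutatorElement

variable {n : ℕ}

theorem of_eq_one_iff {g : TreeAut (Fin n)} (hg : g ∈ hanoi n) :
    Abelianization.of (⟨g, hg⟩ : ↥(hanoi n)) = 1 ↔ g ∈ ⁅hanoi n, hanoi n⁆ := by
  rw [← MonoidHom.mem_ker, Abelianization.ker_of, ← Subgroup.map_subtype_commutator]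
  constructor
  · exact fun h => ⟨_, h, rfl⟩
  · rintro ⟨g', h, rfl⟩
    exact h

/-- The class of a generator in the abelianization. -/
def genAb (i : Fin n) : Abelianization ↥(hanoi n) := Abelianization.of ⟨gen n i, gen_mem i⟩

theorem genAb_pow (i : Fin n) : genAb i ^ (n - 1) = 1 := by
  rw [genAb, ← map_pow, ← map_one Abelianization.of]
  exact congrArg _ (Subtype.ext (gen_pow i))

theorem eq_top_of_genAb_mem {U : Subgroup (Abelianization ↥(hanoi n))}
    (h : ∀ i, genAb i ∈ U) : U = ⊤ := by
  refine (Subgroup.eq_top_iff' U).2 fun v => ?_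
  obtain ⟨⟨g, hg⟩, rfl⟩ := QuotientGroup.mk_surjective v
  change Abelianization.of _ ∈ U
  have h' : hanoi n ≤ (U.comap Abelianization.of).map (hanoi n).subtype := by
    refine (Subgroup.closure_le _).2 ?_
    rintro _ ⟨i, rfl⟩
    exact ⟨⟨_, gen_mem i⟩, h i, rfl⟩
  obtain ⟨g', hg', rfl⟩ := h' hg
  exact hg'

variable (n) in
/-- The families of group elements that are the coordinates of an element of `Stab(1)`. -/
def firstStab : Subgroup (Fin n → ↥(hanoi n)) :=
  (hanoi n).comap (spread.comp ((hanoi n).subtype.compLeft (Fin n)))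

theorem mem_firstStab {d : Fin n → ↥(hanoi n)} :
    d ∈ firstStab n ↔ (spread fun x => (d x : TreeAut (Fin n))) ∈ hanoi n := Iff.rfl

variable (n) in
/-- The image of `Stab(1)` in the power of the abelianization. -/
def firstStabAb : Subgroup (Fin n → Abelianization ↥(hanoi n)) :=
  (firstStab n).map (Abelianization.of.compLeft (Fin n))

theorem mem_firstStabAb {v : Fin n → Abelianization ↥(hanoi n)} :
    v ∈ firstStabAb n ↔ ∃ d ∈ firstStab n, ∀ x, Abelianization.of (d x) = v x := by
  simp only [firstStabAb, Subgroup.mem_map, funext_iff]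
  rfl

theorem mem_firstStabAb_of_spread {d : Fin n → TreeAut (Fin n)} (hd : spread d ∈ hanoi n)
    {v : Fin n → Abelianization ↥(hanoi n)}
    (h : ∀ x, Abelianization.of ⟨d x, coord_mem hd x⟩ = v x) : v ∈ firstStabAb n :=
  mem_firstStabAb.2 ⟨fun x => ⟨d x, coord_mem hd x⟩, hd, h⟩

/-- Conjugation by f permutes the coordinates and conjugates each of them, and the latter is
invisible modulo commutators. -/
theorem perm_mem_firstStabAb {v v' : Fin n → Abelianization ↥(hanoi n)} (hv : v ∈ firstStabAb n)
    {f : TreeAut (Fin n)} (hf : f ∈ hanoi n) (h : ∀ x, v' (perm f x) = v x) :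
    v' ∈ firstStabAb n := by
  obtain ⟨d, hd, hd'⟩ := mem_firstStabAb.1 hv
  have h1 := mul_mem (mul_mem hf (mem_firstStab.1 hd)) (inv_mem hf)
  rw [conj_spread] at h1
  refine mem_firstStabAb_of_spread h1 fun x => ?_
  obtain ⟨y, rfl⟩ := (perm f).surjective x
  have hy : (perm f)⁻¹ (perm f y) = y := by simp
  rw [h, ← hd']
  have : (⟨_, coord_mem h1 (perm f y)⟩ : ↥(hanoi n)) =
      ⟨sec f y, sec_mem hf y⟩ * d y * ⟨sec f y, sec_mem hf y⟩⁻¹ := by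
    apply Subtype.ext
    simp only [hy]
    rfl
  rw [this, map_mul, map_mul, map_inv, mul_inv_cancel_comm]

/-- The family with the entry `v` at `x`, its inverse at `y` and trivial entries elsewhere. -/
def delta {A : Type*} [CommGroup A] (x y : Fin n) : A →* (Fin n → A) :=
  MonoidHom.mulSingle (fun _ => A) x / MonoidHom.mulSingle (fun _ => A) y

theorem delta_apply {A : Type*} [CommGroup A] {x y : Fin n} (hxy : x ≠ y) (v : A) (z : Fin n) :
    delta x y v z = if z = x then v else if z = y then v⁻¹ else 1 := by
  change (Pi.mulSingle x v : Fin n → A) z / (Pi.mulSingle y v : Fin n → A) z = _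
  rw [Pi.mulSingle_apply, Pi.mulSingle_apply]
  split_ifs with h1 h2
  · exact absurd (h1.symm.trans h2) hxy
  · rw [div_one]
  · rw [one_div]
  · rw [div_one]

theorem delta_mem_of_delta_mem (hn : 3 ≤ n) {x y x' y' : Fin n} (hxy : x ≠ y) (hxy' : x' ≠ y')
    {v : Abelianization ↥(hanoi n)} (h : delta x y v ∈ firstStabAb n) :
    delta x' y' v ∈ firstStabAb n := by
  obtain ⟨f, hf, rfl, rfl⟩ := exists_perm_eq_perm_eq hn hxy hxy'
  refine perm_mem_firstStabAb h hf fun z => ?_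
  simp only [delta_apply hxy, delta_apply hxy', (perm f).apply_eq_iff_eq]

variable [NeZero n]

theorem delta_mem_of_five (hn : 5 ≤ n) {x y : Fin n} (hxy : x ≠ y)
    (v : Abelianization ↥(hanoi n)) : delta x y v ∈ firstStabAb n := by
  suffices (firstStabAb n).comap (delta x y) = ⊤ from
    (Subgroup.eq_top_iff' _).1 this v
  refine eq_top_of_genAb_mem fun j => ?_
  obtain ⟨i, rfl⟩ : ∃ i : Fin n, j = i + 3 := ⟨j - 3, (sub_add_cancel j _).symm⟩
  have h24 := (letters_ne_add_four hn i).2.2.1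
  refine delta_mem_of_delta_mem (x := i + 4) (y := i + 2) (by omega) h24.symm hxy ?_
  refine mem_firstStabAb_of_spread (spread_pair_mem hn i) fun z => ?_
  rw [delta_apply h24.symm]
  by_cases h1 : z = i + 4
  · subst h1
    simp only [if_neg h24.symm, if_true]
    rfl
  by_cases h2 : z = i + 2
  · subst h2
    simp only [if_neg h24, if_true]
    rw [genAb, ← map_inv]
    rfl
  simp only [if_neg h1, if_neg h2]
  exact map_one _

theorem delta_mem_four {x y : Fin 4} (hxy : x ≠ y)
    (v : Abelianization ↥(hanoi 4)) : delta x y v ∈ firstStabAb 4 := by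
  suffices (firstStabAb 4).comap (delta x y) = ⊤ from
    (Subgroup.eq_top_iff' _).1 this v
  refine eq_top_of_genAb_mem fun j => ?_
  refine mem_of_mul_inv_mem_of_mul_mem (c := genAb) genAb_pow ?_ ?_ j
  · intro i
    obtain ⟨i, rfl⟩ : ∃ j : Fin 4, i = j + 1 := ⟨i - 1, (sub_add_cancel i _).symm⟩
    rw [show i + 1 + 1 = i + 2 by ring]
    obtain ⟨h01, h02, h03, h12, h13, h23⟩ := letters_ne le_rfl i
    have hi : ∀ i z : Fin 4, z = i ∨ z = i + 1 ∨ z = i + 2 ∨ z = i + 3 := by decide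
    have key : ∀ w : Fin 4, (fun z => if z = w then 1 else genAb (i + 2) * (genAb (i + 1))⁻¹) ∈
        firstStabAb 4 := by
      intro w
      obtain ⟨f, hf, hfw, -⟩ := exists_perm_eq_sec_eq_one (by omega) (i + 3) w
      refine perm_mem_firstStabAb (mem_firstStabAb_of_spread
        (v := fun z => if z = i + 3 then 1 else genAb (i + 2) * (genAb (i + 1))⁻¹)
        (spread_threeCycle_mem le_rfl i) fun z => ?_) hf fun z => ?_
      · rcases hi i z with rfl | rfl | rfl | rfl
        · simp only [if_true, if_neg h03]
          rw [genAb, genAb, ← map_inv, ← map_mul]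
          rfl
        · simp only [if_true, if_neg h01.symm, if_neg h13]
          rw [genAb, genAb, ← map_inv, mul_comm, ← map_mul]
          rfl
        · simp only [if_true, if_neg h02.symm, if_neg h12.symm, if_neg h23]
          rw [genAb, genAb, ← map_inv, mul_comm, ← map_mul]
          rfl
        · simp only [if_true, if_neg h03.symm, if_neg h13.symm, if_neg h23.symm]
          exact map_one _
      · simp only [← hfw, (perm f).apply_eq_iff_eq]
    -- Modulo commutators the cube is constant on three letters and trivial on the fourth; two such
    -- families with different missing letters differ exactly by a `delta`.
    have h := div_mem (key y) (key x)
    rw [Subgroup.mem_comap]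
    convert h using 1
    funext z
    rw [delta_apply hxy, Pi.div_apply]
    by_cases h1 : z = x
    · subst h1
      simp [hxy]
    by_cases h2 : z = y
    · subst h2
      simp [hxy.symm]
    simp [h1, h2]
  · intro i
    obtain ⟨i, rfl⟩ : ∃ j : Fin 4, i = j + 1 := ⟨i - 1, (sub_add_cancel i _).symm⟩
    obtain ⟨h01, h02, h03, h12, h13, h23⟩ := letters_ne le_rfl i
    rw [show i + 1 + 2 = i + 3 by ring]
    refine delta_mem_of_delta_mem (x := i) (y := i + 2) (by omega) h02 hxy ?_
    refine mem_firstStabAb_of_spread (spread_pair_mem_four i) fun z => ?_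
    rw [delta_apply h02]
    by_cases h1 : z = i
    · subst h1
      simp only [if_true]
      rw [genAb, genAb, ← map_mul]
      rfl
    by_cases h2 : z = i + 2
    · subst h2
      simp only [if_neg h02.symm, if_true]
      have : (genAb (i + 3) * genAb (i + 1))⁻¹ =
          genAb i * (genAb (i + 1))⁻¹ * (genAb i)⁻¹ * (genAb (i + 3))⁻¹ := by
        rw [mul_inv_cancel_comm, mul_inv]
        exact mul_comm _ _
      rw [this]
      simp only [genAb, ← map_inv, ← map_mul]
      rfl
    simp only [if_neg h1, if_neg h2]
    exact map_one _

theorem delta_mem (hn : 4 ≤ n) {x y : Fin n} (hxy : x ≠ y) (v : Abelianization ↥(hanoi n)) :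
    delta x y v ∈ firstStabAb n := by
  rcases hn.eq_or_lt with rfl | hn
  · exact delta_mem_four hxy v
  · exact delta_mem_of_five hn hxy v

/-- Families with trivial product are coordinates of elements of `Stab(1)`, up to commutators. -/
theorem mem_firstStabAb_of_prod_eq_one (hn : 4 ≤ n) {v : Fin n → Abelianization ↥(hanoi n)}
    (h : ∏ x, v x = 1) : v ∈ firstStabAb n := by
  -- Every entry is moved to the letter 0, where the compensating inverses multiply to the inverse
  -- of the total product, which is 1.
  have h' : v = ∏ x, delta x 0 (v x) := by
    have h1 : ∀ x, delta x 0 (v x) = Pi.mulSingle x (v x) / Pi.mulSingle 0 (v x) := fun x => rfl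
    have h2 : ∏ x, (Pi.mulSingle 0 (v x) : Fin n → Abelianization ↥(hanoi n)) =
        (Pi.mulSingle 0 (∏ x, v x) : Fin n → Abelianization ↥(hanoi n)) :=
      (map_prod (MonoidHom.mulSingle (fun _ : Fin n => Abelianization ↥(hanoi n)) 0) v _).symm
    simp only [h1]
    rw [Finset.prod_div_distrib, Finset.univ_prod_mulSingle, h2, h, Pi.mulSingle_one, div_one]
  rw [h']
  refine Subgroup.prod_mem _ fun x _ => ?_
  by_cases hx : x = 0
  · have : delta x 0 (v x) = 1 := by
      subst hx
      exact div_self' (Pi.mulSingle 0 (v 0) : Fin n → Abelianization ↥(hanoi n))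
    rw [this]
    exact one_mem _
  · exact delta_mem hn hx _

theorem commutatorElement_mul_central {A : Type*} [Group A] {a b k l : A} (hk : ∀ c, Commute k c)
    (hl : ∀ c, Commute l c) : ⁅a * k, b * l⁆ = ⁅a, b⁆ := by
  have h1 : ⁅a * k, b * l⁆ = a * (k * (b * l) * k⁻¹) * a⁻¹ * (b * l)⁻¹ := by
    rw [commutatorElement_def]; group
  rw [h1, (hk _).eq, mul_inv_cancel_right]
  have h2 : a * (b * l) * a⁻¹ * (b * l)⁻¹ = a * b * (l * a⁻¹ * l⁻¹) * b⁻¹ := by group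
  rw [h2, (hl _).eq, mul_inv_cancel_right, commutatorElement_def]

theorem firstStab_of_commutator_four {d : Fin 4 → ↥(hanoi 4)}
    (h : ∀ x, (d x : TreeAut (Fin 4)) ∈ ⁅⁅hanoi 4, hanoi 4⁆, hanoi 4⁆) : d ∈ firstStab 4 := by
  have h1 : Subgroup.pi Set.univ (fun _ : Fin 4 => ⁅⁅hanoi 4, hanoi 4⁆, hanoi 4⁆) ≤
      (hanoi 4).comap spread := by
    refine Subgroup.pi_le_iff.2 fun x => Subgroup.map_le_iff_le_comap.2 fun g hg => ?_
    have := graft_mem_iff.2 (lowerCentral_le_avoid_four x hg)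
    rwa [graft_eq_spread] at this
  exact h1 (x := fun x => (d x : TreeAut (Fin 4))) fun x _ => h x

/-- The argument for five letters works modulo triple commutators, since `delta_mem_four` realizes
two-letter supports modulo G'; the errors are triple commutators, which can already be planted. -/
theorem graft_commutator_mem_four (x : Fin 4) : ⁅hanoi 4, hanoi 4⁆ ≤ avoid {x}ᶜ x := by
  obtain ⟨y, hy, -⟩ := exists_ne_ne (by omega) x x
  obtain ⟨z, hz, hzy⟩ := exists_ne_ne (by omega) x y
  refine Subgroup.commutator_le.2 fun g hg g' hg' => ?_
  obtain ⟨d, hd, hd'⟩ := mem_firstStabAb.1 (delta_mem_four hy.symm (Abelianization.of ⟨g, hg⟩))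
  obtain ⟨e, he, he'⟩ := mem_firstStabAb.1 (delta_mem_four hz.symm (Abelianization.of ⟨g', hg'⟩))
  simp only [delta_apply hy.symm] at hd'
  simp only [delta_apply hz.symm] at he'
  set R : Subgroup ↥(hanoi 4) := (avoid {x}ᶜ x).subgroupOf (hanoi 4) with hR
  have hRn : R.Normal := ⟨fun a ha b => conj_mem_avoid le_rfl (u := a.1) ha b.2⟩
  have hcomm : ⁅d, e⁆ ∈ firstStab 4 :=
    mul_mem (mul_mem (mul_mem hd he) (inv_mem hd)) (inv_mem he)
  have hker : ∀ a : ↥(hanoi 4), Abelianization.of a = 1 → ∀ b : ↥(hanoi 4),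
      ((⁅a, b⁆ : ↥(hanoi 4)) : TreeAut (Fin 4)) ∈ ⁅⁅hanoi 4, hanoi 4⁆, hanoi 4⁆ := by
    intro a ha b
    exact Subgroup.commutator_mem_commutator ((of_eq_one_iff a.2).1 ha) b.2
  have hker' : ∀ a : ↥(hanoi 4), Abelianization.of a = 1 → ∀ b : ↥(hanoi 4),
      ((⁅b, a⁆ : ↥(hanoi 4)) : TreeAut (Fin 4)) ∈ ⁅⁅hanoi 4, hanoi 4⁆, hanoi 4⁆ := by
    intro a ha b
    rw [← commutatorElement_inv]
    exact inv_mem (hker a ha b)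
  -- At each w ≠ x at least one of d w, e w lies in G', so the commutator there is a triple
  -- commutator and may be divided out.
  have hrest : (fun w => if w = x then 1 else ⁅d w, e w⁆) ∈ firstStab 4 := by
    refine firstStab_of_commutator_four fun w => ?_
    split_ifs with hw
    · exact one_mem _
    · by_cases hwy : w = y
      · refine hker' _ ?_ _
        rw [he', if_neg hw, if_neg fun h => hzy (h.symm.trans hwy)]
      · refine hker _ ?_ _
        rw [hd', if_neg hw, if_neg hwy]
  have h1 : ⁅d x, e x⁆ ∈ R := by
    refine Subgroup.mem_subgroupOf.2 (mem_avoid.2 ⟨_, mul_mem hcomm (inv_mem hrest), ?_, ?_⟩)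
    · intro w hw
      change ((⁅d w, e w⁆ * (if w = x then 1 else ⁅d w, e w⁆)⁻¹ : ↥(hanoi 4)) : TreeAut (Fin 4)) = 1
      rw [if_neg (show w ≠ x from hw), mul_inv_cancel]
      rfl
    · change ((⁅d x, e x⁆ * (if x = x then 1 else ⁅d x, e x⁆)⁻¹ : ↥(hanoi 4)) : TreeAut (Fin 4)) = _
      rw [if_pos rfl, inv_one, mul_one]
  -- G' is central modulo R, so a commutator modulo R depends only on the classes of its entries
  -- modulo G'; thus d x and e x may be replaced by g and g'.
  have hcentral : ∀ a : ↥(hanoi 4), Abelianization.of a = 1 → ∀ c : ↥(hanoi 4) ⧸ R,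
      Commute (a : ↥(hanoi 4) ⧸ R) c := by
    intro a ha c
    obtain ⟨b, rfl⟩ := QuotientGroup.mk_surjective c
    rw [← commutatorElement_eq_one_iff_commute]
    have : (⁅a, b⁆ : ↥(hanoi 4)) ∈ R :=
      Subgroup.mem_subgroupOf.2 (lowerCentral_le_avoid_four x (hker a ha b))
    have h3 := (QuotientGroup.eq_one_iff _).2 this
    rw [← h3]
    rfl
  have h2 : ⁅(⟨g, hg⟩ : ↥(hanoi 4)), ⟨g', hg'⟩⁆ ∈ R := by
    have hk := hcentral ((⟨g, hg⟩ : ↥(hanoi 4))⁻¹ * d x) (by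
      rw [map_mul, hd', if_pos rfl, map_inv, inv_mul_cancel])
    have hl := hcentral ((⟨g', hg'⟩ : ↥(hanoi 4))⁻¹ * e x) (by
      rw [map_mul, he', if_pos rfl, map_inv, inv_mul_cancel])
    have h4 := commutatorElement_mul_central (a := ((⟨g, hg⟩ : ↥(hanoi 4)) : ↥(hanoi 4) ⧸ R))
      (b := ((⟨g', hg'⟩ : ↥(hanoi 4)) : ↥(hanoi 4) ⧸ R)) hk hl
    rw [← QuotientGroup.mk_mul, ← QuotientGroup.mk_mul, mul_inv_cancel_left,
      mul_inv_cancel_left] at h4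
    refine (QuotientGroup.eq_one_iff _).1 (Eq.trans ?_ ((QuotientGroup.eq_one_iff _).2 h1))
    exact h4.symm
  exact Subgroup.mem_subgroupOf.1 h2

theorem graft_mem_of_mem_commutator (hn : 4 ≤ n) (x : Fin n) {g : TreeAut (Fin n)}
    (hg : g ∈ ⁅hanoi n, hanoi n⁆) : graft x g ∈ hanoi n := by
  rw [graft_mem_iff]
  rcases hn.eq_or_lt with rfl | hn
  · exact graft_commutator_mem_four x hg
  · exact graft_commutator_mem_of_five hn x hg

/-- A product over all letters of subgroups lies in `J` as soon as the factors do. -/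
theorem spread_mem_of_graft_mem {H J : Subgroup (TreeAut (Fin n))}
    (h : ∀ x, ∀ k ∈ H, graft x k ∈ J) {d : Fin n → TreeAut (Fin n)} (hd : ∀ x, d x ∈ H) :
    spread d ∈ J := by
  have h1 : Subgroup.pi Set.univ (fun _ : Fin n => H) ≤ J.comap spread := by
    refine Subgroup.pi_le_iff.2 fun x => Subgroup.map_le_iff_le_comap.2 fun g hg => ?_
    have := h x g hg
    rwa [graft_eq_spread] at this
  exact h1 (x := d) fun x _ => hd x

/-- Because x * G' ≤ G, changing coordinates by elements of G' does not affect membership. -/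
theorem mem_firstStab_iff (hn : 4 ≤ n) {d : Fin n → ↥(hanoi n)} :
    d ∈ firstStab n ↔ (fun x => Abelianization.of (d x)) ∈ firstStabAb n := by
  refine ⟨fun h => ⟨d, h, rfl⟩, fun h => ?_⟩
  obtain ⟨e, he, he'⟩ := mem_firstStabAb.1 h
  have h1 : d * e⁻¹ ∈ firstStab n := by
    refine mem_firstStab.2 (spread_mem_of_graft_mem
      (fun x k hk => graft_mem_of_mem_commutator hn x hk) fun x => ?_)
    refine (of_eq_one_iff (d x * (e x)⁻¹).2).1 ?_
    change Abelianization.of (d x * (e x)⁻¹) = 1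
    rw [map_mul, map_inv, he', mul_inv_cancel]
  simpa using mul_mem h1 he

end Abelian


/-! ### The branching subgroup -/

section Branching

open Fin.CommRing commutatorElement

variable {n : ℕ}

theorem sign_cyc (hn : 3 ≤ n) (i : Fin n) : Equiv.Perm.sign (cyc n i) = (-1) ^ n := by
  have hlen : ((List.finRange n).erase i).length = n - 1 := by
    rw [List.length_erase_of_mem (List.mem_finRange i), List.length_finRange]
  have hs : (cyc n i).support.card = n - 1 := by
    rw [← hlen, ← List.toFinset_card_of_nodup ((List.nodup_finRange n).erase i), cyc]
    congr 1
    refine List.support_formPerm_of_nodup _ ((List.nodup_finRange n).erase i) fun y hy => ?_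
    rw [hy, List.length_singleton] at hlen
    omega
  obtain ⟨k, rfl⟩ : ∃ k, n = k + 1 := ⟨n - 1, by omega⟩
  rw [(isCycle_cyc hn i).sign, hs, Nat.add_sub_cancel, pow_succ, mul_neg_one]

theorem map_perm_commutator :
    ⁅hanoi n, hanoi n⁆.map perm = ⁅(hanoi n).map perm, (hanoi n).map perm⁆ :=
  Subgroup.map_commutator _ _ _

/-- Jordan's theorem: the action is 2-transitive, hence primitive, and contains a 3-cycle. -/
theorem alternatingGroup_le_map_perm (hn : 4 ≤ n) :
    alternatingGroup (Fin n) ≤ (hanoi n).map perm := by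
  have : NeZero n := ⟨by omega⟩
  have h2 : MulAction.IsMultiplyPretransitive ↥((hanoi n).map perm) (Fin n) 2 := by
    refine MulAction.is_two_pretransitive_iff.2 fun {a b c d} hab hcd => ?_
    obtain ⟨g, hg, hgc, hgd⟩ := exists_perm_eq_perm_eq (by omega) hab hcd
    exact ⟨⟨perm g, g, hg, rfl⟩, hgc, hgd⟩
  obtain ⟨h01, h02, -, h12, -, -⟩ := letters_ne hn 0
  refine Equiv.Perm.alternatingGroup_le_of_isPreprimitive_of_isThreeCycle_mem
    (MulAction.isPreprimitive_of_is_two_pretransitive h2)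
    (Equiv.Perm.isThreeCycle_swap_mul_swap_same h02 h01 h12.symm)
    ⟨(gen n (0 + 1))⁻¹ * gen n (0 + 2), gen_inv_mul_gen_mem _ _, Equiv.ext fun x => ?_⟩
  rw [perm_threeCycle hn, Equiv.Perm.mul_apply]
  by_cases h1 : x = 0
  · rw [if_pos h1, h1, Equiv.swap_apply_left, Equiv.swap_apply_of_ne_of_ne h01.symm h12]
  by_cases h2 : x = 0 + 1
  · rw [if_neg h1, if_pos h2, h2, Equiv.swap_apply_right, Equiv.swap_apply_left]
  by_cases h3 : x = 0 + 2
  · rw [if_neg h1, if_neg h2, if_pos h3, h3, Equiv.swap_apply_of_ne_of_ne h02.symm h12.symm,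
      Equiv.swap_apply_right]
  rw [if_neg h1, if_neg h2, if_neg h3, Equiv.swap_apply_of_ne_of_ne h1 h2,
    Equiv.swap_apply_of_ne_of_ne h1 h3]

theorem map_perm_commutator_of_five (hn : 5 ≤ n) :
    ⁅hanoi n, hanoi n⁆.map perm = alternatingGroup (Fin n) := by
  rw [map_perm_commutator]
  refine le_antisymm ((Subgroup.commutator_mono le_top le_top).trans
    alternatingGroup.commutator_perm_le) ?_
  rw [← commutator_alternatingGroup_eq_self (α := Fin n) (by simpa using hn)]
  exact Subgroup.commutator_mono (alternatingGroup_le_map_perm (by omega))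
    (alternatingGroup_le_map_perm (by omega))

theorem sign_perm_eq_one (hn : 3 ≤ n) (he : Even n) {g : TreeAut (Fin n)} (hg : g ∈ hanoi n) :
    Equiv.Perm.sign (perm g) = 1 := by
  have h : hanoi n ≤ (Equiv.Perm.sign.comp perm).ker := by
    refine (Subgroup.closure_le _).2 ?_
    rintro _ ⟨i, rfl⟩
    change Equiv.Perm.sign (perm (gen n i)) = 1
    rw [perm_gen, sign_cyc hn, he.neg_one_pow]
  exact h hg

/-- The isomorphism of `{±1}` with `ℤ/2ℤ`. -/
def signHom : ℤˣ →* Multiplicative (ZMod 2) where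
  toFun u := if u = 1 then 1 else Multiplicative.ofAdd 1
  map_one' := rfl
  map_mul' := by decide

theorem signHom_eq_one_iff : ∀ u, signHom u = 1 ↔ u = 1 := by decide

theorem range_lift_gen : (FreeGroup.lift (gen n)).range = hanoi n :=
  FreeGroup.range_lift_eq_closure

/-- For odd n each generator acts as a cycle of even length n - 1, an odd permutation, so the sign
records the parity of the exponent sum. -/
theorem mem_evenPart_iff (hn : 3 ≤ n) (ho : Odd n) {g : TreeAut (Fin n)} (hg : g ∈ hanoi n) :
    g ∈ evenPart n ↔ Equiv.Perm.sign (perm g) = 1 := by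
  have h : (FreeGroup.lift fun _ : Fin n => Multiplicative.ofAdd (1 : ZMod 2)) =
      ((signHom.comp Equiv.Perm.sign).comp perm).comp (FreeGroup.lift (gen n)) := by
    ext i
    simp only [FreeGroup.lift_apply_of, MonoidHom.comp_apply, perm_gen, sign_cyc hn,
      ho.neg_one_pow]
    rfl
  constructor
  · rintro ⟨w, hw, rfl⟩
    rw [SetLike.mem_coe, MonoidHom.mem_ker, h] at hw
    exact (signHom_eq_one_iff _).1 hw
  · intro hs
    rw [← range_lift_gen] at hg
    obtain ⟨w, rfl⟩ := hg
    refine ⟨w, ?_, rfl⟩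
    rw [SetLike.mem_coe, MonoidHom.mem_ker, h]
    exact (signHom_eq_one_iff _).2 hs

theorem evenPart_le : evenPart n ≤ hanoi n := by
  rw [← range_lift_gen]
  rintro _ ⟨w, -, rfl⟩
  exact ⟨w, rfl⟩

theorem branching_of_five (hn : 5 ≤ n) :
    branching n = if Odd n then evenPart n else hanoi n := by
  unfold branching
  split
  · omega
  · rfl

theorem branching_of_even (hn : 5 ≤ n) (he : Even n) : branching n = hanoi n := by
  rw [branching_of_five hn, if_neg (Nat.not_odd_iff_even.2 he)]

theorem branch4_le : branch4 ≤ hanoi 4 := by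
  refine sup_le ((Subgroup.closure_le _).2 ?_) (Subgroup.commutator_le_self _)
  have hg := gen_mem (n := 4)
  rintro g (rfl | rfl | rfl)
  · exact mul_mem (mul_mem (hg 0) (hg 2)) (pow_mem (hg 3) 2)
  · exact mul_mem (mul_mem (mul_mem (hg 1) (hg 0)) (hg 2)) (inv_mem (hg 0))
  · exact mul_mem (mul_mem (mul_mem (hg 0) (inv_mem (hg 2))) (hg 3)) (hg 2)

theorem branching_le (hn : 4 ≤ n) : branching n ≤ hanoi n := by
  rcases hn.eq_or_lt with rfl | hn
  · exact branch4_le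
  · rw [branching_of_five hn]
    split_ifs
    exacts [evenPart_le, le_rfl]

/-- The index of the partition of the four letters into two pairs, one of which is `{x, y}`. -/
def pairing (x y : Fin 4) : ZMod 3 :=
  ![![0, 0, 2, 1], ![0, 0, 1, 2], ![2, 1, 0, 0], ![1, 2, 0, 0]] x y

/-- Each σ_i rotates the three pairings; neighbouring indices rotate them in opposite directions. -/
theorem pairing_cyc : ∀ i x y : Fin 4, x ≠ y →
    pairing (cyc 4 i x) (cyc 4 i y) = pairing x y + ![-1, 1, -1, 1] i := by decide

theorem exists_pairing_perm {g : TreeAut (Fin 4)} (hg : g ∈ hanoi 4) :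
    ∃ c, ∀ x y, x ≠ y → pairing (perm g x) (perm g y) = pairing x y + c := by
  refine hanoi_induction (p := fun g => ∃ c, ∀ x y, x ≠ y →
    pairing (perm g x) (perm g y) = pairing x y + c) ?_ ⟨0, by simp⟩ ?_ ?_ hg
  · exact fun i => ⟨_, fun x y h => by rw [perm_gen, pairing_cyc i x y h]⟩
  · rintro f g - - ⟨c, hc⟩ ⟨c', hc'⟩
    refine ⟨c' + c, fun x y h => ?_⟩
    rw [map_mul, Equiv.Perm.mul_apply, Equiv.Perm.mul_apply,
      hc _ _ fun h' => h ((perm g).injective h'), hc' x y h, add_assoc]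
  · rintro f - ⟨c, hc⟩
    refine ⟨-c, fun x y h => ?_⟩
    have := hc ((perm f)⁻¹ x) ((perm f)⁻¹ y) fun h' => h ((perm f)⁻¹.injective h')
    rw [map_inv, eq_add_neg_iff_add_eq, ← this]
    simp

/-- The homomorphism of `G_4` to `ℤ/3ℤ` given by the action on the three partitions of the letters
into pairs. -/
noncomputable def pairingHom : ↥(hanoi 4) →* Multiplicative (ZMod 3) where
  toFun g := Multiplicative.ofAdd (pairing (perm g.1 0) (perm g.1 1) - pairing 0 1)
  map_one' := by simp
  map_mul' f g := by
    obtain ⟨c, hc⟩ := exists_pairing_perm f.2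
    rw [← ofAdd_add]
    congr 1
    rw [Subgroup.coe_mul, map_mul, Equiv.Perm.mul_apply, Equiv.Perm.mul_apply,
      hc _ _ fun h' => absurd ((perm g.1).injective h') (by decide), hc _ _ (by decide)]
    ring

theorem pairingHom_gen (i : Fin 4) :
    pairingHom ⟨gen 4 i, gen_mem i⟩ = Multiplicative.ofAdd (![-1, 1, -1, 1] i) := by
  change Multiplicative.ofAdd (pairing (perm (gen 4 i) 0) (perm (gen 4 i) 1) - pairing 0 1) = _
  rw [perm_gen, pairing_cyc _ _ _ (by decide), add_sub_cancel_left]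

theorem perm_branch4 {g : TreeAut (Fin 4)} (hg : g ∈ branch4) :
    perm g ∈ ⁅hanoi 4, hanoi 4⁆.map perm := by
  have h1 : perm ⁅gen 4 0, gen 4 2⁆ ∈ ⁅hanoi 4, hanoi 4⁆.map perm :=
    ⟨_, Subgroup.commutator_mem_commutator (gen_mem 0) (gen_mem 2), rfl⟩
  rw [map_commutatorElement, perm_gen, perm_gen] at h1
  have h : branch4 ≤ (⁅hanoi 4, hanoi 4⁆.map perm).comap perm := by
    refine sup_le ((Subgroup.closure_le _).2 ?_) (Subgroup.le_comap_map _ _)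
    rintro g (rfl | rfl | rfl)
    -- All three listed generators act on the letters as the commutator of the first and third
    -- cycles.
    all_goals
      simp only [SetLike.mem_coe, Subgroup.mem_comap, map_mul, map_pow, map_inv, perm_gen]
      convert h1 using 1
      refine Equiv.ext ?_
      decide
  exact h hg

theorem pairingHom_eq_one_of_perm {g : TreeAut (Fin 4)} (hg : g ∈ hanoi 4)
    (h : perm g ∈ ⁅hanoi 4, hanoi 4⁆.map perm) : pairingHom ⟨g, hg⟩ = 1 := by
  obtain ⟨g', hg', h'⟩ := h
  have h1 : pairingHom ⟨g, hg⟩ = pairingHom ⟨g', Subgroup.commutator_le_self _ hg'⟩ := by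
    change Multiplicative.ofAdd (pairing (perm g 0) (perm g 1) - pairing 0 1) =
      Multiplicative.ofAdd (pairing (perm g' 0) (perm g' 1) - pairing 0 1)
    rw [h']
  rw [h1, ← Abelianization.lift_apply_of pairingHom, (of_eq_one_iff _).2 hg', map_one]

theorem branch4_generators_mem {g : TreeAut (Fin 4)}
    (hg : g ∈ ({gen 4 0 * gen 4 2 * gen 4 3 ^ 2, gen 4 1 * gen 4 0 * gen 4 2 * (gen 4 0)⁻¹,
    gen 4 0 * (gen 4 2)⁻¹ * gen 4 3 * gen 4 2} : Set (TreeAut (Fin 4)))) : g ∈ branch4 :=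
  (le_sup_left : _ ≤ branch4) (Subgroup.subset_closure hg)

/-- Modulo `branch4` every generator is a power of the last one, so g is b times its j-th power,
with b in `branch4`. `pairingHom` kills g and b but not the last generator, so 3 divides j; the cube
of a generator is trivial. -/
theorem mem_branch4_of_perm {g : TreeAut (Fin 4)} (hg : g ∈ hanoi 4)
    (h : perm g ∈ ⁅hanoi 4, hanoi 4⁆.map perm) : g ∈ branch4 := by
  set L : Subgroup (Abelianization ↥(hanoi 4)) :=
    (branch4.subgroupOf (hanoi 4)).map Abelianization.of with hL
  have hmem : ∀ g (hg : g ∈ branch4), Abelianization.of ⟨g, branch4_le hg⟩ ∈ L :=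
    fun g hg => ⟨⟨g, branch4_le hg⟩, hg, rfl⟩
  have hB1 : genAb 0 * genAb 2 * genAb 3 ^ 2 ∈ L := by
    convert hmem _ (branch4_generators_mem (Or.inl rfl)) using 1
    rfl
  have hB2 : genAb 1 * genAb 2 ∈ L := by
    convert hmem _ (branch4_generators_mem (Or.inr (Or.inl rfl))) using 1
    change _ = genAb 1 * genAb 0 * genAb 2 * (genAb 0)⁻¹
    rw [mul_right_comm, mul_inv_cancel_right]
  have hB3 : genAb 0 * genAb 3 ∈ L := by
    convert hmem _ (branch4_generators_mem (Or.inr (Or.inr rfl))) using 1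
    change _ = genAb 0 * (genAb 2)⁻¹ * genAb 3 * genAb 2
    rw [mul_right_comm, inv_mul_cancel_right]
  have htop : L ⊔ Subgroup.zpowers (genAb 3) = ⊤ := by
    have h3 : genAb 3 ∈ L ⊔ Subgroup.zpowers (genAb 3) :=
      (le_sup_right : _ ≤ L ⊔ Subgroup.zpowers (genAb 3)) (Subgroup.mem_zpowers _)
    have hle : L ≤ L ⊔ Subgroup.zpowers (genAb 3) := le_sup_left
    have h0 : genAb 0 ∈ L ⊔ Subgroup.zpowers (genAb 3) := by
      have := mul_mem (hle hB3) (inv_mem h3)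
      rwa [mul_inv_cancel_right] at this
    have h2 : genAb 2 ∈ L ⊔ Subgroup.zpowers (genAb 3) := by
      have := mul_mem (mul_mem (inv_mem h0) (hle hB1)) (inv_mem (pow_mem h3 2))
      rwa [mul_assoc, mul_assoc, mul_assoc, mul_inv_cancel, mul_one, inv_mul_cancel_left] at this
    have h1 : genAb 1 ∈ L ⊔ Subgroup.zpowers (genAb 3) := by
      have := mul_mem (hle hB2) (inv_mem h2)
      rwa [mul_inv_cancel_right] at this
    refine eq_top_of_genAb_mem fun i => ?_
    fin_cases i
    exacts [h0, h1, h2, h3]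
  obtain ⟨l, ⟨b, hb, rfl⟩, _, ⟨j, rfl⟩, hv⟩ := Subgroup.mem_sup.1
    ((Subgroup.eq_top_iff' _).1 htop (Abelianization.of ⟨g, hg⟩))
  have hχ := congrArg (Abelianization.lift pairingHom) hv
  have hb' : b.1 ∈ branch4 := Subgroup.mem_subgroupOf.1 hb
  simp only [map_mul, map_zpow, Abelianization.lift_apply_of, genAb, pairingHom_gen] at hχ
  rw [pairingHom_eq_one_of_perm hg h,
    show pairingHom b = 1 from pairingHom_eq_one_of_perm b.2 (perm_branch4 hb'), one_mul] at hχ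
  have hj : (3 : ℤ) ∣ j := by
    rw [← ofAdd_zsmul, ofAdd_eq_one, zsmul_eq_mul] at hχ
    refine (ZMod.intCast_zmod_eq_zero_iff_dvd j 3).1 ?_
    simpa using hχ
  obtain ⟨k, rfl⟩ := hj
  simp only [zpow_mul] at hv
  have h3 : genAb (3 : Fin 4) ^ (3 : ℤ) = 1 := by exact_mod_cast genAb_pow (3 : Fin 4)
  rw [h3, one_zpow, mul_one] at hv
  have h4 : (b⁻¹ * ⟨g, hg⟩ : ↥(hanoi 4)).1 ∈ branch4 := by
    refine (le_sup_right : _ ≤ branch4) ((of_eq_one_iff (b⁻¹ * ⟨g, hg⟩ : ↥(hanoi 4)).2).1 ?_)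
    change Abelianization.of (b⁻¹ * ⟨g, hg⟩) = 1
    rw [map_mul, ← hv, map_inv, inv_mul_cancel]
  simpa using mul_mem hb' h4

/-- The branching subgroup consists of the elements whose action on the first level is that of an
element of the commutator subgroup. -/
theorem mem_branching_iff (hn : 4 ≤ n) {g : TreeAut (Fin n)} (hg : g ∈ hanoi n) :
    g ∈ branching n ↔ perm g ∈ ⁅hanoi n, hanoi n⁆.map perm := by
  rcases hn.eq_or_lt with rfl | hn
  · exact ⟨perm_branch4, mem_branch4_of_perm hg⟩
  · rw [branching_of_five hn, map_perm_commutator_of_five hn, Equiv.Perm.mem_alternatingGroup]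
    split_ifs with ho
    · exact mem_evenPart_iff (by omega) ho hg
    · exact ⟨fun h => sign_perm_eq_one (by omega) (Nat.not_odd_iff_even.1 ho) hg, fun _ => hg⟩

theorem commutator_le_branching (hn : 4 ≤ n) : ⁅hanoi n, hanoi n⁆ ≤ branching n := fun _ hg =>
  (mem_branching_iff hn (Subgroup.commutator_le_self _ hg)).2 ⟨_, hg, rfl⟩

theorem spread_mem_branching (hn : 4 ≤ n) {d : Fin n → TreeAut (Fin n)} (hd : spread d ∈ hanoi n) :
    spread d ∈ branching n := by
  rw [mem_branching_iff hn hd, perm_spread]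
  exact one_mem _

theorem conj_mem_branching (hn : 4 ≤ n) {g k : TreeAut (Fin n)} (hg : g ∈ hanoi n)
    (hk : k ∈ branching n) : g * k * g⁻¹ ∈ branching n := by
  have h := commutator_le_branching hn
    (Subgroup.commutator_mem_commutator hg (branching_le hn hk))
  have := mul_mem h hk
  rwa [commutatorElement_def, inv_mul_cancel_right] at this

end Branching


/-! ### The wreath recursion describes the group -/

section Recursion

open Fin.CommRing commutatorElement

variable {n : ℕ}

theorem hanoi_hom_ext {A : Type*} [Group A] {f g : ↥(hanoi n) →* A}
    (h : ∀ i, f ⟨gen n i, gen_mem i⟩ = g ⟨gen n i, gen_mem i⟩) : f = g := by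
  have h' : hanoi n ≤ (f.eqLocus g).map (hanoi n).subtype := by
    refine (Subgroup.closure_le _).2 ?_
    rintro _ ⟨i, rfl⟩
    exact ⟨⟨_, gen_mem i⟩, h i, rfl⟩
  refine MonoidHom.ext fun x => ?_
  obtain ⟨y, hy, hy'⟩ := h' x.2
  rw [← Subtype.ext hy']
  exact hy

/-- The product of the classes of the sections. -/
noncomputable def secProd : ↥(hanoi n) →* Abelianization ↥(hanoi n) where
  toFun g := ∏ x, Abelianization.of ⟨sec g.1 x, sec_mem g.2 x⟩
  map_one' := Finset.prod_eq_one fun x _ => by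
    rw [← map_one Abelianization.of]
    exact congrArg _ (Subtype.ext (sec_one x))
  map_mul' f g := by
    rw [← Equiv.prod_comp (perm g.1) fun x => Abelianization.of (⟨sec f.1 x, sec_mem f.2 x⟩ :
      ↥(hanoi n)), ← Finset.prod_mul_distrib]
    refine Finset.prod_congr rfl fun x _ => ?_
    rw [← map_mul]
    exact congrArg _ (Subtype.ext (sec_mul _ _ _))

/-- Both homomorphisms agree on a generator, whose only nontrivial section is itself. -/
theorem secProd_eq : secProd (n := n) = Abelianization.of := by
  refine hanoi_hom_ext fun i => ?_
  change ∏ x, Abelianization.of (⟨sec (gen n i) x, sec_mem (gen_mem i) x⟩ : ↥(hanoi n)) = _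
  rw [Finset.prod_eq_single i]
  · refine congrArg _ (Subtype.ext ?_)
    simp
  · intro x _ hx
    rw [← map_one Abelianization.of]
    refine congrArg _ (Subtype.ext ?_)
    simp [hx]
  · exact fun h => absurd (Finset.mem_univ i) h

/-- The sections of an element sum up to the element, modulo commutators. -/
theorem prod_of_sec {g : TreeAut (Fin n)} (hg : g ∈ hanoi n) :
    ∏ x, Abelianization.of (⟨sec g x, sec_mem hg x⟩ : ↥(hanoi n)) =
      Abelianization.of ⟨g, hg⟩ := DFunLike.congr_fun secProd_eq (⟨g, hg⟩ : ↥(hanoi n))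

theorem prod_of_coord {d : Fin n → TreeAut (Fin n)} (hd : spread d ∈ hanoi n) :
    ∏ x, Abelianization.of (⟨d x, coord_mem hd x⟩ : ↥(hanoi n)) =
      Abelianization.of ⟨spread d, hd⟩ := by
  rw [← prod_of_sec hd]
  simp only [sec_spread]

theorem mem_branching_of_of_eq (hn : 4 ≤ n) {g k : TreeAut (Fin n)} (hg : g ∈ hanoi n)
    (hk : k ∈ branching n)
    (h : Abelianization.of (⟨g, hg⟩ : ↥(hanoi n)) =
      Abelianization.of (⟨k, branching_le hn hk⟩ : ↥(hanoi n))) :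
    g ∈ branching n := by
  have h1 : ((⟨g, hg⟩ : ↥(hanoi n)) * (⟨k, branching_le hn hk⟩ : ↥(hanoi n))⁻¹).1 ∈ ⁅hanoi n, hanoi n⁆ := by
    refine (of_eq_one_iff (g := g * k⁻¹) (mul_mem hg (inv_mem (branching_le hn hk)))).1 ?_
    change Abelianization.of ((⟨g, hg⟩ : ↥(hanoi n)) * (⟨k, branching_le hn hk⟩ : ↥(hanoi n))⁻¹) = 1
    rw [map_mul, map_inv, h, mul_inv_cancel]
  have := mul_mem (commutator_le_branching hn h1) hk
  simpa using this

/-- A family of group elements whose product lies in the branching subgroup, modulo commutators,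
is the family of coordinates of a group element. -/
theorem mem_firstStab_of_prod (hn : 4 ≤ n) {d : Fin n → ↥(hanoi n)} {k : TreeAut (Fin n)}
    (hk : k ∈ branching n)
    (h : ∏ x, Abelianization.of (d x) = Abelianization.of ⟨k, branching_le hn hk⟩) :
    d ∈ firstStab n := by
  have : NeZero n := ⟨by omega⟩
  -- Correcting k by c in G' with the same first level action yields an element of Stab(1) with the
  -- class of k. Its coordinates form a reference family e, and d * e⁻¹ has product of classes 1.
  obtain ⟨c, hc, hck⟩ := (mem_branching_iff hn (branching_le hn hk)).1 hk
  have hcG := Subgroup.commutator_le_self _ hc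
  have hs : k * c⁻¹ ∈ hanoi n := mul_mem (branching_le hn hk) (inv_mem hcG)
  have hp : perm (k * c⁻¹) = 1 := by rw [map_mul, map_inv, hck, mul_inv_cancel]
  set e : Fin n → ↥(hanoi n) := fun x => ⟨sec (k * c⁻¹) x, sec_mem hs x⟩ with he
  have he1 : e ∈ firstStab n := by
    rw [mem_firstStab]
    change spread (sec (k * c⁻¹)) ∈ hanoi n
    rwa [spread_sec hp]
  have he2 : ∏ x, Abelianization.of (e x) = Abelianization.of ⟨k, branching_le hn hk⟩ := by
    rw [he, prod_of_sec hs]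
    have : (⟨k * c⁻¹, hs⟩ : ↥(hanoi n)) = ⟨k, branching_le hn hk⟩ * ⟨c, hcG⟩⁻¹ := rfl
    rw [this, map_mul, map_inv, (of_eq_one_iff hcG).2 hc, inv_one, mul_one]
  have h1 : d * e⁻¹ ∈ firstStab n := by
    rw [mem_firstStab_iff hn]
    refine mem_firstStabAb_of_prod_eq_one hn ?_
    simp only [Pi.mul_apply, Pi.inv_apply, map_mul, map_inv]
    rw [Finset.prod_mul_distrib, Finset.prod_inv_distrib, h, he2, mul_inv_cancel]
  simpa using mul_mem h1 he1

/-- If x * k is in G, it lies in K since it fixes the first level, and it has the class of k, so k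
is in K ≥ G'. The converse is `mem_firstStab_of_prod` for a family with one nontrivial member. -/
theorem graft_mem_hanoi_iff (hn : 4 ≤ n) (x : Fin n) {k : TreeAut (Fin n)} (hk : k ∈ hanoi n) :
    graft x k ∈ hanoi n ↔ k ∈ branching n := by
  have hprod : ∏ y, Abelianization.of ((Pi.mulSingle x ⟨k, hk⟩ : Fin n → ↥(hanoi n)) y) =
      Abelianization.of ⟨k, hk⟩ := by
    rw [Finset.prod_eq_single x]
    · rw [Pi.mulSingle_eq_same]
    · intro y _ hy
      rw [Pi.mulSingle_eq_of_ne hy, map_one]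
    · exact fun h => absurd (Finset.mem_univ x) h
  have hcoe : ∀ y, ((Pi.mulSingle x ⟨k, hk⟩ : Fin n → ↥(hanoi n)) y : TreeAut (Fin n)) =
      (Pi.mulSingle x k : Fin n → TreeAut (Fin n)) y := by
    intro y
    rw [Pi.mulSingle_apply, Pi.mulSingle_apply]
    split_ifs <;> rfl
  rw [graft_eq_spread]
  constructor
  · intro h
    refine mem_branching_of_of_eq hn hk (spread_mem_branching hn h) ?_
    rw [← prod_of_coord h, ← hprod]
    refine Finset.prod_congr rfl fun y _ => congrArg _ (Subtype.ext (hcoe y))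
  · intro h
    have := mem_firstStab_of_prod hn h hprod
    rw [mem_firstStab] at this
    simpa only [hcoe] using this

theorem graft_mem_branching (hn : 4 ≤ n) (x : Fin n) {k : TreeAut (Fin n)}
    (hk : k ∈ branching n) : graft x k ∈ branching n := by
  have h := (graft_mem_hanoi_iff hn x (branching_le hn hk)).2 hk
  rw [graft_eq_spread] at h ⊢
  exact spread_mem_branching hn h

theorem map_graft_branching_le (hn : 4 ≤ n) (x : Fin n) :
    (branching n).map (graft x) ≤ branching n :=
  Subgroup.map_le_iff_le_comap.2 fun _ hk => graft_mem_branching hn x hk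

theorem spread_branching_mem (hn : 4 ≤ n) {d : Fin n → TreeAut (Fin n)}
    (hd : ∀ x, d x ∈ branching n) : spread d ∈ branching n := by
  have : NeZero n := ⟨by omega⟩
  exact spread_mem_of_graft_mem (fun x k hk => graft_mem_branching hn x hk) hd

/-- For c in G' acting as σ the section classes multiply to 1, so the sections can be stripped off
inside G. Conjugation by these rooted elements is what identifies classes in M below. -/
theorem rooted_mem_branching (hn : 4 ≤ n) {σ : Equiv.Perm (Fin n)}
    (hσ : σ ∈ ⁅hanoi n, hanoi n⁆.map perm) : rooted σ ∈ branching n := by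
  obtain ⟨c, hc, hcσ⟩ := hσ
  have hcG := Subgroup.commutator_le_self _ hc
  have h1 : (fun x => ⟨sec c ((perm c)⁻¹ x), sec_mem hcG _⟩ : Fin n → ↥(hanoi n)) ∈
      firstStab n := by
    refine mem_firstStab_of_prod hn (one_mem (branching n)) ?_
    rw [Equiv.prod_comp (perm c)⁻¹ fun x => Abelianization.of
      (⟨sec c x, sec_mem hcG _⟩ : ↥(hanoi n)), prod_of_sec hcG, (of_eq_one_iff hcG).2 hc]
    exact (map_one _).symm
  have h2 := mul_mem (inv_mem (mem_firstStab.1 h1)) hcG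
  have h3 := eq_spread_mul_rooted c
  rw [hcσ] at h3
  have h4 : rooted σ = (spread fun x => sec c ((perm c)⁻¹ x))⁻¹ * c := by
    rw [hcσ, eq_inv_mul_iff_mul_eq]
    exact h3.symm
  rw [mem_branching_iff hn (h4 ▸ h2), perm_rooted]
  exact ⟨c, hc, hcσ⟩

end Recursion

/-! ### Products over the vertices of a level -/

section LevelProd

variable {n : ℕ}

/-- The product of copies of `H` over the vertices of the level `m`. -/
def levelProd (H : Subgroup (TreeAut (Fin n))) : ℕ → Subgroup (TreeAut (Fin n))
  | 0 => H
  | m + 1 => (Subgroup.pi Set.univ fun _ => levelProd H m).map spread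

theorem mem_levelProd_succ {H : Subgroup (TreeAut (Fin n))} {m : ℕ} {g : TreeAut (Fin n)} :
    g ∈ levelProd H (m + 1) ↔ perm g = 1 ∧ ∀ x, sec g x ∈ levelProd H m := by
  constructor
  · rintro ⟨d, hd, rfl⟩
    exact ⟨perm_spread d, fun x => by rw [sec_spread]; exact hd x trivial⟩
  · rintro ⟨h, h'⟩
    exact ⟨sec g, fun x _ => h' x, spread_sec h⟩

/-- For a word `u` and a tree automorphism `k`, the automorphism `u * k`. -/
def graftWord : List (Fin n) → TreeAut (Fin n) →* TreeAut (Fin n)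
  | [] => MonoidHom.id _
  | x :: u => (graft x).comp (graftWord u)

theorem graftWord_cons (x : Fin n) (u : List (Fin n)) (k : TreeAut (Fin n)) :
    graftWord (x :: u) k = graft x (graftWord u k) := rfl

theorem levelProd_le_iff {H J : Subgroup (TreeAut (Fin n))} {m : ℕ} :
    levelProd H m ≤ J ↔ ∀ u : List (Fin n), u.length = m → ∀ k ∈ H, graftWord u k ∈ J := by
  induction m generalizing J with
  | zero =>
    refine ⟨fun h u hu k hk => ?_, fun h k hk => h [] rfl k hk⟩
    rw [List.length_eq_zero_iff.1 hu]
    exact h hk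
  | succ m ih =>
    rw [levelProd, Subgroup.map_le_iff_le_comap, Subgroup.pi_le_iff]
    have h1 : ∀ x, (levelProd H m).map (MonoidHom.mulSingle (fun _ : Fin n => TreeAut (Fin n)) x) ≤
        J.comap spread ↔ levelProd H m ≤ J.comap (graft x) := by
      intro x
      rw [Subgroup.map_le_iff_le_comap]
      refine forall₂_congr fun k _ => ?_
      rw [Subgroup.mem_comap, Subgroup.mem_comap, Subgroup.mem_comap, graft_eq_spread]
      rfl
    simp only [h1, ih]
    constructor
    · rintro h (_ | ⟨x, u⟩) hu k hk
      · simp at hu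
      · exact h x u (by simpa using hu) k hk
    · exact fun h x u hu k hk => h (x :: u) (by simp [hu]) k hk

theorem graftWord_mem_levelProd {H : Subgroup (TreeAut (Fin n))} (u : List (Fin n))
    {k : TreeAut (Fin n)} (hk : k ∈ H) : graftWord u k ∈ levelProd H u.length :=
  levelProd_le_iff.1 le_rfl u rfl k hk

theorem levelProd_mono {H J : Subgroup (TreeAut (Fin n))} (h : H ≤ J) (m : ℕ) :
    levelProd H m ≤ levelProd J m :=
  levelProd_le_iff.2 fun u hu _ hk => hu ▸ graftWord_mem_levelProd u (h hk)

theorem conj_mem_levelProd {H : Subgroup (TreeAut (Fin n))}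
    (hH : ∀ g ∈ hanoi n, ∀ k ∈ H, g * k * g⁻¹ ∈ H) {m : ℕ} {g k : TreeAut (Fin n)}
    (hg : g ∈ hanoi n) (hk : k ∈ levelProd H m) : g * k * g⁻¹ ∈ levelProd H m := by
  induction m generalizing g k with
  | zero => exact hH g hg k hk
  | succ m ih =>
    obtain ⟨h, h'⟩ := mem_levelProd_succ.1 hk
    rw [← spread_sec h, conj_spread]
    refine mem_levelProd_succ.2 ⟨perm_spread _, fun x => ?_⟩
    rw [sec_spread]
    exact ih (sec_mem hg _) (h' _)

theorem graft_smul_of_ne {x y : Fin n} (h : y ≠ x) (k : TreeAut (Fin n)) (w : List (Fin n)) :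
    graft x k • (y :: w) = y :: w := by
  rw [graft_eq_spread, spread_smul_cons, Pi.mulSingle_eq_of_ne h, one_smul]

theorem graft_smul_self (x : Fin n) (k : TreeAut (Fin n)) (w : List (Fin n)) :
    graft x k • (x :: w) = x :: k • w := by
  rw [graft_eq_spread, spread_smul_cons, Pi.mulSingle_eq_same]

theorem graftWord_smul_of_not_prefix {u w : List (Fin n)} (h : ¬ u <+: w) (k : TreeAut (Fin n)) :
    graftWord u k • w = w := by
  induction u generalizing w with
  | nil => exact absurd List.nil_prefix h
  | cons x u ih =>
    cases w with
    | nil => exact smul_nil _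
    | cons y w =>
      rw [graftWord_cons]
      by_cases hy : y = x
      · subst hy
        rw [graft_smul_self, ih fun h' => h (List.cons_prefix_cons.2 ⟨rfl, h'⟩)]
      · exact graft_smul_of_ne hy _ _

theorem graftWord_mem_branching (hn : 4 ≤ n) (u : List (Fin n)) {k : TreeAut (Fin n)}
    (hk : k ∈ branching n) : graftWord u k ∈ branching n := by
  induction u with
  | nil => exact hk
  | cons x u ih => exact graft_mem_branching hn x ih

theorem graftWord_mem_rist (hn : 4 ≤ n) (u : List (Fin n)) {k : TreeAut (Fin n)}
    (hk : k ∈ branching n) :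
    (⟨graftWord u k, branching_le hn (graftWord_mem_branching hn u hk)⟩ : ↥(hanoi n)) ∈
      rist (hanoi n) u :=
  fun _ hw => graftWord_smul_of_not_prefix hw k

/-- Peeling one letter forces the section into K by `graft_mem_hanoi_iff`. The root is excluded: its
rigid stabilizer is all of G, which may exceed K; hence the levels m + 1 below. -/
theorem exists_eq_graftWord (hn : 4 ≤ n) {u : List (Fin n)} (hu : u ≠ []) {g : TreeAut (Fin n)}
    (hg : g ∈ hanoi n) (h : ∀ w, ¬ u <+: w → g • w = w) :
    ∃ k ∈ branching n, g = graftWord u k := by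
  induction u generalizing g with
  | nil => exact absurd rfl hu
  | cons x u ih =>
    have h1 : ∀ y, y ≠ x → ∀ w, g • (y :: w) = y :: w := fun y hy w =>
      h _ fun h' => hy (List.cons_prefix_cons.1 h').1.symm
    have hp : perm g = 1 := by
      have h2 : ∀ y, y ≠ x → perm g y = y := fun y hy => perm_eq_of_smul (h1 y hy [])
      refine Equiv.ext fun y => ?_
      by_cases hy : y = x
      · by_contra hne
        rw [hy, Equiv.Perm.one_apply] at hne
        exact hne ((perm g).injective (h2 _ hne))
      · exact h2 y hy
    have hs : ∀ y, y ≠ x → sec g y = 1 := fun y hy =>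
      sec_eq_of_smul y fun w => by rw [h1 y hy, one_smul]
    have hgraft : g = graft x (sec g x) := by
      rw [graft_eq_spread]
      refine eq_spread_iff.2 ⟨hp, fun y => ?_⟩
      by_cases hy : y = x
      · rw [hy, Pi.mulSingle_eq_same]
      · rw [Pi.mulSingle_eq_of_ne hy, hs y hy]
    have hK : sec g x ∈ branching n :=
      (graft_mem_hanoi_iff hn x (sec_mem hg x)).1 (hgraft ▸ hg)
    by_cases hu' : u = []
    · exact ⟨sec g x, hK, by rw [hu']; exact hgraft⟩
    · obtain ⟨k, hk, hk'⟩ := ih hu' (sec_mem hg x) fun w hw => by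
        have h3 := h (x :: w) fun h' => hw (List.cons_prefix_cons.1 h').2
        rw [smul_cons] at h3
        exact (List.cons.inj h3).2
      exact ⟨k, hk, by rw [graftWord_cons, ← hk']; exact hgraft⟩

theorem mem_levelRist_iff (hn : 4 ≤ n) {m : ℕ} {g : ↥(hanoi n)} :
    g ∈ levelRist (hanoi n) (m + 1) ↔ g.1 ∈ levelProd (branching n) (m + 1) := by
  constructor
  · suffices levelRist (hanoi n) (m + 1) ≤ (levelProd (branching n) (m + 1)).subgroupOf (hanoi n)
      from fun h => this h
    refine iSup_le fun u g hg => ?_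
    have hne : u.1 ≠ [] := fun h => by simpa [h] using u.2
    obtain ⟨k, hk, h⟩ := exists_eq_graftWord hn hne g.2 hg
    rw [Subgroup.mem_subgroupOf, h]
    exact levelProd_le_iff.1 le_rfl u.1 u.2 k hk
  · suffices levelProd (branching n) (m + 1) ≤
        (levelRist (hanoi n) (m + 1)).map (hanoi n).subtype by
      intro h
      obtain ⟨g', hg', h'⟩ := this h
      rwa [← Subtype.ext h']
    refine levelProd_le_iff.2 fun u hu k hk => ?_
    exact ⟨_, (le_iSup (fun v : Level (Fin n) (m + 1) => rist (hanoi n) v.1) ⟨u, hu⟩)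
      (graftWord_mem_rist hn u hk), rfl⟩

/-- Sections at level m fix the first level, and such elements of G lie in K. The extra level m + 1
is what puts the sections in K and not merely in G. -/
theorem mem_levelProd_of_smul_eq (hn : 4 ≤ n) {m : ℕ} {g : TreeAut (Fin n)} (hg : g ∈ hanoi n)
    (h : ∀ u : List (Fin n), u.length = m + 1 → g • u = u) : g ∈ levelProd (branching n) m := by
  have h0 : Nonempty (Fin n) := ⟨⟨0, by omega⟩⟩
  have hp : perm g = 1 := by
    refine Equiv.ext fun x => ?_
    exact perm_eq_of_smul (h (x :: List.replicate m x) (by simp))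
  induction m generalizing g with
  | zero =>
    change g ∈ branching n
    rw [mem_branching_iff hn hg, hp]
    exact one_mem _
  | succ m ih =>
    have hs : ∀ x (u : List (Fin n)), u.length = m + 1 → sec g x • u = u := by
      intro x u hu
      have h1 := h (x :: u) (by simp [hu])
      rw [smul_cons] at h1
      exact (List.cons.inj h1).2
    refine mem_levelProd_succ.2 ⟨hp, fun x => ih (sec_mem hg x) (hs x) ?_⟩
    refine Equiv.ext fun y => ?_
    exact perm_eq_of_smul (hs x (y :: List.replicate m y) (by simp))

theorem levelStab_le_levelRist (hn : 4 ≤ n) (m : ℕ) :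
    levelStab (hanoi n) (m + 2) ≤ levelRist (hanoi n) (m + 1) := fun g hg =>
  (mem_levelRist_iff hn).2 (mem_levelProd_of_smul_eq hn g.2 (mem_levelStab.1 hg))

theorem smul_eq_of_mem_levelProd {H : Subgroup (TreeAut (Fin n))} {m : ℕ} {g : TreeAut (Fin n)}
    (hg : g ∈ levelProd H m) {u : List (Fin n)} (hu : u.length = m) : g • u = u := by
  induction m generalizing g u with
  | zero => rw [List.length_eq_zero_iff.1 hu, smul_nil]
  | succ m ih =>
    cases u with
    | nil => exact smul_nil _
    | cons x u =>
      obtain ⟨h, h'⟩ := mem_levelProd_succ.1 hg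
      rw [smul_cons, h, ih (h' x) (by simpa using hu)]
      rfl

theorem levelRist_le_levelStab (hn : 4 ≤ n) (m : ℕ) :
    levelRist (hanoi n) (m + 1) ≤ levelStab (hanoi n) (m + 1) := fun _ hg =>
  mem_levelStab.2 fun _ hu => smul_eq_of_mem_levelProd ((mem_levelRist_iff hn).1 hg) hu

theorem levelRist_finiteIndex (hn : 4 ≤ n) (m : ℕ) :
    (levelRist (hanoi n) (m + 1)).FiniteIndex :=
  Subgroup.finiteIndex_of_le (levelStab_le_levelRist hn m)

end LevelProd

/-! ### Normal subgroups of finite index -/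

section Normal

open commutatorElement

variable {n : ℕ}

theorem exists_smul_eq (hn : 4 ≤ n) {u v : List (Fin n)} (h : u.length = v.length) :
    ∃ g ∈ hanoi n, g • u = v := by
  have : NeZero n := ⟨by omega⟩
  induction u generalizing v with
  | nil => exact ⟨1, one_mem _, by rw [one_smul, List.length_eq_zero_iff.1 h.symm]⟩
  | cons x u ih =>
    cases v with
    | nil => simp at h
    | cons y v =>
      obtain ⟨f, hf, hfx, hfs⟩ := exists_perm_eq_sec_eq_one (by omega) x y
      obtain ⟨g, hg, hgu⟩ := ih (v := v) (by simpa using h)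
      obtain ⟨d, hd, hdy⟩ := exists_coord_eq hn y hg
      refine ⟨spread d * f, mul_mem hd hf, ?_⟩
      rw [mul_smul, smul_cons, hfx, hfs, one_smul, spread_smul_cons, hdy, hgu]

/-- A finite group of order m could not act transitively on the n^m > m vertices of level m. -/
theorem infinite_hanoi (hn : 4 ≤ n) : Infinite ↥(hanoi n) := by
  refine not_finite_iff_infinite.1 fun hfin => ?_
  have hpos : 0 < n := by omega
  set m := Nat.card ↥(hanoi n) with hm
  have hv : Finite (Level (Fin n) m) := inferInstanceAs (Finite (List.Vector (Fin n) m))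
  have hsurj : Function.Surjective fun g : ↥(hanoi n) =>
      (⟨g • List.replicate m ⟨0, hpos⟩, by rw [length_smul']; simp⟩ : Level (Fin n) m) := by
    intro v
    obtain ⟨g, hg, hgv⟩ := exists_smul_eq hn (u := List.replicate m ⟨0, hpos⟩) (v := v.1)
      (by simp [v.2])
    exact ⟨⟨g, hg⟩, Subtype.ext hgv⟩
  have h1 := Nat.card_le_card_of_surjective _ hsurj
  have h2 : Nat.card (Level (Fin n) m) = n ^ m := by
    change Nat.card (List.Vector (Fin n) m) = n ^ m
    rw [Nat.card_eq_fintype_card, card_vector, Fintype.card_fin]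
  rw [h2, ← hm] at h1
  exact absurd (Nat.lt_pow_self (a := n) (n := m) (by omega)) (not_lt.2 h1)

theorem commute_of_mem_rist {X : Type} {G : Subgroup (TreeAut X)} {u v : List X}
    (hl : u.length = v.length) (huv : u ≠ v) {a b : ↥G} (ha : a ∈ rist G u) (hb : b ∈ rist G v) :
    Commute a b := by
  have key : ∀ {u v : List X}, u.length = v.length → u ≠ v → ∀ {a b : ↥G}, a ∈ rist G u →
      b ∈ rist G v → ∀ w, u <+: w → (a * b) • w = (b * a) • w := by
    intro u v hl huv a b ha hb w hw
    have h1 : ¬ v <+: w := fun h => huv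
      ((List.prefix_of_prefix_length_le hw h hl.le).eq_of_length hl)
    have h2 : ¬ v <+: a • w := by
      intro h
      have h3 := (smul_prefix_iff (a⁻¹).1 v (a • w)).2 h
      have h4 : (a⁻¹).1 • v = v := (inv_mem ha) v fun h => huv (h.eq_of_length hl)
      rw [h4] at h3
      have h5 : (a⁻¹).1 • (a • w) = w := inv_smul_smul a w
      rw [h5] at h3
      exact h1 h3
    rw [mul_smul, mul_smul, hb w h1, hb _ h2]
  refine Subtype.ext (treeAut_ext fun w => ?_)
  by_cases hu : u <+: w
  · exact key hl huv ha hb w hu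
  by_cases hv : v <+: w
  · exact (key hl.symm huv.symm hb ha w hv).symm
  have h1 : (a * b) • w = w := by rw [mul_smul, hb w hv, ha w hu]
  have h2 : (b * a) • w = w := by rw [mul_smul, ha w hu, hb w hv]
  exact h1.trans h2.symm

/-- A normal subgroup that moves the vertex `u` contains the commutators of `rist u`. -/
theorem commutator_mem_of_smul_ne {X : Type} {G : Subgroup (TreeAut X)} {N : Subgroup ↥G}
    [N.Normal] {u : List X} {g : ↥G} (hg : g ∈ N) (hu : g • u ≠ u) {a b : ↥G}
    (ha : a ∈ rist G u) (hb : b ∈ rist G u) : ⁅a, b⁆ ∈ N := by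
  have ha' := conj_mem_rist (inv_mem ha) g
  -- As c lives at the vertex g • u ≠ u, it commutes with a and b. So c * a, which lies in N, has
  -- the same commutator with b as a has.
  set c := g * a⁻¹ * g⁻¹ with hc
  have hl : (g • u).length = u.length := length_smul' g u
  have hca : Commute c a := commute_of_mem_rist hl hu ha' ha
  have hcb : Commute c b := commute_of_mem_rist hl hu ha' hb
  have h1 : c * a ∈ N := by
    have := mul_mem hg (Subgroup.Normal.conj_mem ‹_› _ (inv_mem hg) a⁻¹)
    simpa [hc, mul_assoc] using this
  have h2 : (c * a) * (b * (c * a)⁻¹ * b⁻¹) ∈ N :=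
    mul_mem h1 (Subgroup.Normal.conj_mem ‹_› _ (inv_mem h1) b)
  have h3 : (c * a) * (b * (c * a)⁻¹ * b⁻¹) = ⁅a, b⁆ := by
    have h4 : (c * a) * (b * (c * a)⁻¹ * b⁻¹) = (c * a) * b * (a⁻¹ * c⁻¹) * b⁻¹ := by group
    have h5 : c * a * b = a * b * c := by
      rw [hca.eq, mul_assoc, hcb.eq, mul_assoc]
    have h6 : c * (a⁻¹ * c⁻¹) = a⁻¹ := by
      rw [← mul_assoc, hca.inv_right.eq, mul_inv_cancel_right]
    rw [h4, h5, mul_assoc (a * b), h6, commutatorElement_def]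
  rwa [h3] at h2

/-- Every normal subgroup of finite index contains the product of the commutator subgroups of the
copies of the branching subgroup over some level. -/
theorem exists_levelProd_commutator_le (hn : 4 ≤ n) (N : Subgroup ↥(hanoi n)) [N.Normal]
    [N.FiniteIndex] : ∃ m, (levelProd ⁅branching n, branching n⁆ (m + 1)).subgroupOf (hanoi n) ≤ N := by
  have hinf := infinite_hanoi hn
  have hne : N ≠ ⊥ := by
    rintro rfl
    have : Finite (↥(hanoi n) ⧸ (⊥ : Subgroup ↥(hanoi n))) := inferInstance
    exact hinf.not_finite (Finite.of_equiv _ QuotientGroup.quotientBot.toEquiv)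
  obtain ⟨⟨g, hg⟩, hg'⟩ : ∃ a : ↥N, a ≠ 1 := Subgroup.ne_bot_iff_exists_ne_one.1 hne
  have hg1 : g ≠ 1 := fun h => hg' (Subtype.ext h)
  obtain ⟨u, hu⟩ : ∃ u : List (Fin n), g.1 • u ≠ u := by
    by_contra h
    push Not at h
    refine hg1 (Subtype.ext (treeAut_ext fun w => ?_))
    exact (h w).trans (one_smul _ w).symm
  have hu0 : u ≠ [] := by
    rintro rfl
    exact hu (smul_nil _)
  refine ⟨u.length - 1, ?_⟩
  have hlen : u.length - 1 + 1 = u.length := Nat.sub_add_cancel (List.length_pos_iff.2 hu0)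
  rw [hlen]
  suffices levelProd ⁅branching n, branching n⁆ u.length ≤ N.map (hanoi n).subtype by
    intro k hk
    obtain ⟨k', hk', h⟩ := this hk
    rwa [← Subtype.ext h]
  refine levelProd_le_iff.2 fun v hv => ?_
  -- Conjugates of g move every vertex of the level of u, so the commutators are obtained at all of
  -- them.
  obtain ⟨h, hh, rfl⟩ := exists_smul_eq hn hv.symm
  set h' : ↥(hanoi n) := ⟨h, hh⟩
  have hmove : (h' * g * h'⁻¹) • (h' • u) ≠ h' • u := by
    rw [mul_smul, mul_smul, inv_smul_smul]
    exact fun h'' => hu (MulAction.injective h' h'')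
  change ⁅branching n, branching n⁆ ≤ (N.map (hanoi n).subtype).comap (graftWord (h • u))
  refine Subgroup.commutator_le.2 fun a ha b hb => ?_
  refine ⟨_, commutator_mem_of_smul_ne (Subgroup.Normal.conj_mem ‹_› _ hg h') hmove
    (graftWord_mem_rist hn _ ha) (graftWord_mem_rist hn _ hb), ?_⟩
  rw [map_commutatorElement, map_commutatorElement]
  rfl

end Normal


/-! ### The abelianization of the branching subgroup -/

section Classes

open commutatorElement

variable {n : ℕ}

/-- The class in `M n` of an element of the branching subgroup. -/
def cls {k : TreeAut (Fin n)} (hk : k ∈ branching n) : M n := Abelianization.of ⟨k, hk⟩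

theorem cls_mul {k l : TreeAut (Fin n)} (hk : k ∈ branching n) (hl : l ∈ branching n) :
    cls (mul_mem hk hl) = cls hk * cls hl :=
  map_mul Abelianization.of (⟨k, hk⟩ : ↥(branching n)) ⟨l, hl⟩

theorem cls_inv {k : TreeAut (Fin n)} (hk : k ∈ branching n) :
    cls (inv_mem hk) = (cls hk)⁻¹ :=
  map_inv Abelianization.of (⟨k, hk⟩ : ↥(branching n))

theorem cls_pow {k : TreeAut (Fin n)} (hk : k ∈ branching n) (r : ℕ) :
    cls (pow_mem hk r) = cls hk ^ r :=
  map_pow Abelianization.of (⟨k, hk⟩ : ↥(branching n)) r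

theorem cls_congr {k l : TreeAut (Fin n)} (hk : k ∈ branching n) (h : k = l) :
    cls hk = cls (h ▸ hk : l ∈ branching n) := by
  subst h
  rfl

theorem exists_cls_eq (m : M n) : ∃ (k : TreeAut (Fin n)) (hk : k ∈ branching n), m = cls hk := by
  obtain ⟨⟨k, hk⟩, rfl⟩ := QuotientGroup.mk_surjective m
  exact ⟨k, hk, rfl⟩

theorem cls_eq_one_iff {k : TreeAut (Fin n)} (hk : k ∈ branching n) :
    cls hk = 1 ↔ k ∈ ⁅branching n, branching n⁆ := by
  rw [cls, ← MonoidHom.mem_ker, Abelianization.ker_of, ← Subgroup.map_subtype_commutator]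
  constructor
  · exact fun h => ⟨_, h, rfl⟩
  · rintro ⟨k', h, rfl⟩
    exact h

theorem cls_conj {g k : TreeAut (Fin n)} (hg : g ∈ branching n) (hk : k ∈ branching n)
    (h : g * k * g⁻¹ ∈ branching n) : cls h = cls hk := by
  have : cls h = cls hg * cls hk * (cls hg)⁻¹ := by
    rw [← cls_inv, ← cls_mul, ← cls_mul]
  rw [this, mul_inv_cancel_comm]

theorem plant_cls (h : ∀ x : Fin n, (branching n).map (graft x) ≤ branching n) (x : Fin n)
    {k : TreeAut (Fin n)} (hk : k ∈ branching n) :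
    plant h x (cls hk) = cls (h x (Subgroup.mem_map_of_mem _ hk)) := rfl

/-- Double transpositions are commutators of 3-cycles. -/
theorem swap_mul_swap_mem (hn : 4 ≤ n) {x y z w : Fin n} (hxy : x ≠ y) (hxz : x ≠ z)
    (hxw : x ≠ w) (hyz : y ≠ z) (hyw : y ≠ w) (hzw : z ≠ w) :
    Equiv.swap x y * Equiv.swap z w ∈ ⁅hanoi n, hanoi n⁆.map perm := by
  have h1 : Equiv.swap x y * Equiv.swap z w =
      ⁅Equiv.swap x y * Equiv.swap y z, Equiv.swap x y * Equiv.swap y w⁆ := by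
    refine Equiv.ext fun t => ?_
    simp only [commutatorElement_def, mul_inv_rev, Equiv.swap_inv, Equiv.Perm.mul_apply]
    grind
  rw [h1, map_perm_commutator]
  refine Subgroup.commutator_mem_commutator ?_ ?_ <;>
  · refine alternatingGroup_le_map_perm hn ?_
    rw [Equiv.Perm.mem_alternatingGroup, map_mul, Equiv.Perm.sign_swap (by assumption),
      Equiv.Perm.sign_swap (by assumption)]
    rfl

theorem rooted_mul_spread (σ : Equiv.Perm (Fin n)) (d : Fin n → TreeAut (Fin n)) :
    rooted σ * spread d * (rooted σ)⁻¹ = spread fun x => d (σ⁻¹ x) := by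
  rw [conj_spread]
  simp

theorem cls_spread_perm (hn : 4 ≤ n) {σ : Equiv.Perm (Fin n)}
    (hσ : σ ∈ ⁅hanoi n, hanoi n⁆.map perm) {d e : Fin n → TreeAut (Fin n)}
    (h : ∀ x, e (σ x) = d x) (hd : spread d ∈ branching n) (he : spread e ∈ branching n) :
    cls he = cls hd := by
  have h1 := rooted_mul_spread σ d
  have h2 : e = fun x => d (σ⁻¹ x) := by
    funext x
    rw [← h]
    exact congrArg e ((Equiv.apply_symm_apply σ x).symm)
  rw [← h2] at h1
  rw [← cls_conj (rooted_mem_branching hn hσ) hd (h1 ▸ he)]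
  exact cls_congr _ h1.symm

theorem exists_ne_ne_ne (hn : 4 ≤ n) {x y : Fin n} (hxy : x ≠ y) :
    ∃ z w : Fin n, x ≠ z ∧ x ≠ w ∧ y ≠ z ∧ y ≠ w ∧ z ≠ w := by
  have h1 : 2 ≤ ({x, y}ᶜ : Finset (Fin n)).card := by
    rw [Finset.card_compl, Fintype.card_fin, Finset.card_pair hxy]
    omega
  obtain ⟨z, hz, w, hw, hzw⟩ := Finset.one_lt_card.1 h1
  simp only [Finset.mem_compl, Finset.mem_insert, Finset.mem_singleton, not_or] at hz hw
  exact ⟨z, w, Ne.symm hz.1, Ne.symm hw.1, Ne.symm hz.2, Ne.symm hw.2, hzw⟩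

/-- The class of `x * k` does not depend on the letter `x`. -/
theorem plant_eq (hn : 4 ≤ n) (h : ∀ x : Fin n, (branching n).map (graft x) ≤ branching n)
    (x y : Fin n) : plant h x = plant h y := by
  rcases eq_or_ne x y with rfl | hxy
  · rfl
  obtain ⟨z, w, hxz, hxw, hyz, hyw, hzw⟩ := exists_ne_ne_ne hn hxy
  -- The rooted double transposition exchanging x and y lies in K for every n ≥ 4, and conjugation
  -- by it is trivial on M.
  have hσ := swap_mul_swap_mem hn hxy hxz hxw hyz hyw hzw
  have hσx : (Equiv.swap x y * Equiv.swap z w) y = x := by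
    rw [Equiv.Perm.mul_apply, Equiv.swap_apply_of_ne_of_ne hyz hyw, Equiv.swap_apply_right]
  refine MonoidHom.ext fun m => ?_
  obtain ⟨k, hk, rfl⟩ := exists_cls_eq m
  rw [plant_cls, plant_cls]
  have hx := h x (Subgroup.mem_map_of_mem _ hk)
  have hy := h y (Subgroup.mem_map_of_mem _ hk)
  rw [graft_eq_spread] at hx hy
  rw [cls_congr _ (graft_eq_spread x k), cls_congr _ (graft_eq_spread y k)]
  refine cls_spread_perm hn hσ (fun t => ?_) hy hx
  rw [Pi.mulSingle_apply, Pi.mulSingle_apply]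
  refine if_congr ?_ rfl rfl
  nth_rewrite 2 [← hσx]
  exact (Equiv.injective _).eq_iff

/-- The family with `g` at `x`, `g⁻¹` at `y` and trivial other members. -/
def dipole (x y : Fin n) (g : TreeAut (Fin n)) : Fin n → TreeAut (Fin n) :=
  Pi.mulSingle x g * Pi.mulSingle y g⁻¹

theorem dipole_apply {x y : Fin n} (hxy : x ≠ y) (g : TreeAut (Fin n)) (z : Fin n) :
    dipole x y g z = if z = x then g else if z = y then g⁻¹ else 1 := by
  rw [dipole, Pi.mul_apply, Pi.mulSingle_apply, Pi.mulSingle_apply]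
  split_ifs with h1 h2
  · exact absurd (h1.symm.trans h2) hxy
  · rw [mul_one]
  · rw [one_mul]
  · rw [one_mul]

theorem spread_dipole_mem (hn : 4 ≤ n) (x y : Fin n) {g : TreeAut (Fin n)}
    (hg : g ∈ hanoi n) : spread (dipole x y g) ∈ branching n := by
  have h1 : (Pi.mulSingle x ⟨g, hg⟩ * Pi.mulSingle y ⟨g, hg⟩⁻¹ : Fin n → ↥(hanoi n)) ∈
      firstStab n := by
    refine mem_firstStab_of_prod hn (one_mem (branching n)) ?_
    simp only [Pi.mul_apply, map_mul]
    rw [Finset.prod_mul_distrib, Finset.prod_eq_single x, Finset.prod_eq_single y]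
    · rw [Pi.mulSingle_eq_same, Pi.mulSingle_eq_same, map_inv, mul_inv_cancel]
      exact (map_one _).symm
    · intro z _ hz
      rw [Pi.mulSingle_eq_of_ne hz, map_one]
    · exact fun h => absurd (Finset.mem_univ y) h
    · intro z _ hz
      rw [Pi.mulSingle_eq_of_ne hz, map_one]
    · exact fun h => absurd (Finset.mem_univ x) h
  rw [mem_firstStab] at h1
  refine spread_mem_branching hn ?_
  convert h1 using 2
  funext z
  rw [dipole, Pi.mul_apply, Pi.mul_apply, Pi.mulSingle_apply, Pi.mulSingle_apply,
    Pi.mulSingle_apply, Pi.mulSingle_apply]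
  split_ifs <;> rfl

/-- Dipoles lie in K for arbitrary members of G, and two dipoles sharing only the letter x have
their commutator at x. So planting sends G', not just K', into K'. -/
theorem graft_mem_commutator_branching (hn : 4 ≤ n) (x : Fin n) {g : TreeAut (Fin n)}
    (hg : g ∈ ⁅hanoi n, hanoi n⁆) : graft x g ∈ ⁅branching n, branching n⁆ := by
  suffices ⁅hanoi n, hanoi n⁆ ≤ ⁅branching n, branching n⁆.comap (graft x) from this hg
  obtain ⟨y, z, hxy, hxz, hyz⟩ : ∃ y z : Fin n, x ≠ y ∧ x ≠ z ∧ y ≠ z := by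
    obtain ⟨y, hy, -⟩ := exists_ne_ne (by omega : 3 ≤ n) x x
    obtain ⟨z, hz1, hz2⟩ := exists_ne_ne (by omega : 3 ≤ n) x y
    exact ⟨y, z, hy.symm, hz1.symm, hz2.symm⟩
  refine Subgroup.commutator_le.2 fun a ha b hb => ?_
  have h1 : graft x ⁅a, b⁆ = ⁅spread (dipole x y a), spread (dipole x z b)⁆ := by
    rw [graft_eq_spread, ← map_commutatorElement]
    congr 1
    funext t
    simp only [commutatorElement_def, Pi.mul_apply, Pi.inv_apply, dipole_apply hxy,
      dipole_apply hxz, Pi.mulSingle_apply]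
    by_cases h1 : t = x
    · simp [h1]
    · by_cases h2 : t = y
      · simp [h2, hyz, hxy.symm]
      · simp [h1, h2]
  rw [Subgroup.mem_comap, h1]
  exact Subgroup.commutator_mem_commutator (spread_dipole_mem hn x y ha)
    (spread_dipole_mem hn x z hb)

/-- The map of abelianizations induced by the inclusion of the branching subgroup. -/
noncomputable def inclAb (hn : 4 ≤ n) : M n →* Abelianization ↥(hanoi n) :=
  Abelianization.map (Subgroup.inclusion (branching_le hn))

theorem inclAb_cls (hn : 4 ≤ n) {k : TreeAut (Fin n)} (hk : k ∈ branching n) :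
    inclAb hn (cls hk) = Abelianization.of ⟨k, branching_le hn hk⟩ := rfl

/-- The only nontrivial section of x * k is k, and section classes multiply to the class of the
element. -/
theorem inclAb_plant (hn : 4 ≤ n) (h : ∀ x : Fin n, (branching n).map (graft x) ≤ branching n)
    (x : Fin n) (m : M n) : inclAb hn (plant h x m) = inclAb hn m := by
  obtain ⟨k, hk, rfl⟩ := exists_cls_eq m
  rw [plant_cls, inclAb_cls, inclAb_cls]
  have h1 := branching_le hn (h x (Subgroup.mem_map_of_mem _ hk))
  have h2 := h1
  rw [graft_eq_spread] at h2
  have h3 : (⟨graft x k, h1⟩ : ↥(hanoi n)) = ⟨spread (Pi.mulSingle x k), h2⟩ :=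
    Subtype.ext (graft_eq_spread x k)
  rw [h3, ← prod_of_coord h2, Finset.prod_eq_single x]
  · exact congrArg _ (Subtype.ext (Pi.mulSingle_eq_same _ _))
  · intro y _ hy
    rw [← map_one Abelianization.of]
    exact congrArg _ (Subtype.ext (Pi.mulSingle_eq_of_ne hy _))
  · exact fun h => absurd (Finset.mem_univ x) h

theorem plant_eq_one_of_inclAb (hn : 4 ≤ n)
    (h : ∀ x : Fin n, (branching n).map (graft x) ≤ branching n) (x : Fin n) {m : M n}
    (hm : inclAb hn m = 1) : plant h x m = 1 := by
  obtain ⟨k, hk, rfl⟩ := exists_cls_eq m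
  rw [inclAb_cls, of_eq_one_iff] at hm
  rw [plant_cls, cls_eq_one_iff]
  exact graft_mem_commutator_branching hn x hm

/-- Planting does not change the class in the abelianization of G, and it kills whatever is trivial
there. -/
theorem plant_plant (hn : 4 ≤ n) (h : ∀ x : Fin n, (branching n).map (graft x) ≤ branching n)
    (x : Fin n) (m : M n) : plant h x (plant h x m) = plant h x m := by
  rw [← div_eq_one, ← map_div]
  refine plant_eq_one_of_inclAb hn h x ?_
  rw [map_div, inclAb_plant, div_self']

theorem inclAb_injOn_range (hn : 4 ≤ n)
    (h : ∀ x : Fin n, (branching n).map (graft x) ≤ branching n) (x : Fin n) :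
    Function.Injective ((inclAb hn).comp (plant h x).range.subtype) := by
  rw [injective_iff_map_eq_one]
  rintro ⟨_, m, rfl⟩ hm
  apply Subtype.ext
  change plant h x m = 1
  rw [← plant_plant hn]
  exact plant_eq_one_of_inclAb hn h x hm


theorem dipole_swap (x y : Fin n) (g : TreeAut (Fin n)) : dipole y x g = (dipole x y g)⁻¹ := by
  rw [dipole, dipole, mul_inv_rev, Pi.mulSingle_inv, Pi.mulSingle_inv, inv_inv]

theorem dipole_pow {x y : Fin n} (hxy : x ≠ y) (g : TreeAut (Fin n)) (r : ℕ) :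
    dipole x y g ^ r = dipole x y (g ^ r) := by
  funext z
  rw [Pi.pow_apply, dipole_apply hxy, dipole_apply hxy]
  split_ifs
  · rfl
  · rw [inv_pow]
  · rw [one_pow]

/-- With five letters a spare letter w gives an even 3-cycle that takes z to x and fixes y. -/
theorem cls_dipole_eq (hn : 5 ≤ n) {x z y : Fin n} (hx : x ≠ y) (hz : z ≠ y) (hxz : x ≠ z)
    {g : TreeAut (Fin n)} (h : spread (dipole x y g) ∈ branching n)
    (h' : spread (dipole z y g) ∈ branching n) : cls h = cls h' := by
  obtain ⟨w, hw⟩ : ∃ w, w ∉ ({x, z, y} : Finset (Fin n)) := by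
    refine not_forall.1 fun h1 => ?_
    have h2 : ({x, z, y} : Finset (Fin n)) = Finset.univ := Finset.eq_univ_iff_forall.2 h1
    have h3 := Finset.card_le_three (a := x) (b := z) (c := y)
    rw [h2, Finset.card_univ, Fintype.card_fin] at h3
    omega
  simp only [Finset.mem_insert, Finset.mem_singleton, not_or] at hw
  obtain ⟨hwx, hwz, hwy⟩ := hw
  have hσ : Equiv.swap z x * Equiv.swap x w ∈ ⁅hanoi n, hanoi n⁆.map perm := by
    rw [map_perm_commutator_of_five hn, Equiv.Perm.mem_alternatingGroup, map_mul,
      Equiv.Perm.sign_swap hxz.symm, Equiv.Perm.sign_swap (Ne.symm hwx)]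
    rfl
  refine cls_spread_perm (by omega) hσ (fun t => ?_) _ _
  rw [dipole_apply hx, dipole_apply hz]
  have h1 : (Equiv.swap z x * Equiv.swap x w) t = x ↔ t = z := by
    clear * - hwz hwx hxz
    grind [Equiv.Perm.mul_apply]
  have h2 : (Equiv.swap z x * Equiv.swap x w) t = y ↔ t = y := by
    clear * - hwz hwx hxz hwy hx hz
    grind [Equiv.Perm.mul_apply]
  simp only [h1, h2]

/-- Modulo commutators of the branching subgroup, coordinates may be moved to another letter. -/
theorem cls_dipole (hn : 4 ≤ n) {x z : Fin n} (hxz : x ≠ z) {g : TreeAut (Fin n)}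
    (hg : g ∈ hanoi n) : cls (spread_dipole_mem hn x z hg) = 1 := by
  obtain ⟨y, w, hxy, hxw, hzy, hzw, hyw⟩ := exists_ne_ne_ne hn hxz
  rcases hn.eq_or_lt with rfl | hn5
  · have h2 : cls (spread_dipole_mem hn x z hg) ^ 2 = 1 := by
      have h3 : cls (spread_dipole_mem hn z x hg) = cls (spread_dipole_mem hn x z hg) := by
        refine cls_spread_perm hn (swap_mul_swap_mem hn hxz hxy hxw hzy hzw hyw) (fun t => ?_) _ _
        rw [dipole_apply hxz, dipole_apply hxz.symm]
        have h1 : (Equiv.swap x z * Equiv.swap y w) t = x ↔ t = z := by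
          clear * - hxy hxw hzy hzw
          grind [Equiv.Perm.mul_apply]
        have h2 : (Equiv.swap x z * Equiv.swap y w) t = z ↔ t = x := by
          clear * - hxy hxw hzy hzw
          grind [Equiv.Perm.mul_apply]
        simp only [h1, h2]
      have h4 : cls (spread_dipole_mem hn z x hg) =
          (cls (spread_dipole_mem hn x z hg))⁻¹ := by
        rw [← cls_inv]
        exact cls_congr _ (by rw [dipole_swap, map_inv])
      rw [pow_two]
      nth_rewrite 1 [← h3]
      rw [h4, inv_mul_cancel]
    have h3 : cls (spread_dipole_mem hn x z hg) ^ 3 = 1 := by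
      have hg3 : g ^ 3 ∈ ⁅hanoi 4, hanoi 4⁆ := by
        rw [← of_eq_one_iff (pow_mem hg 3)]
        have h5 : (powMonoidHom 3 : Abelianization ↥(hanoi 4) →* _).ker = ⊤ :=
          eq_top_of_genAb_mem fun i => genAb_pow i
        have h6 : Abelianization.of (⟨g, hg⟩ : ↥(hanoi 4)) ∈
          (powMonoidHom 3 : Abelianization ↥(hanoi 4) →* _).ker := h5 ▸ Subgroup.mem_top _
        exact h6
      rw [← cls_pow, cls_eq_one_iff, ← map_pow, dipole_pow hxz, dipole, map_mul,
        ← graft_eq_spread, ← graft_eq_spread]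
      exact mul_mem (graft_mem_commutator_branching hn _ hg3)
        (graft_mem_commutator_branching hn _ (inv_mem hg3))
    calc _ = cls (spread_dipole_mem hn x z hg) ^ 3 * (cls (spread_dipole_mem hn x z hg) ^ 2)⁻¹ := by
          rw [pow_succ, mul_inv_cancel_comm]
      _ = 1 := by rw [h2, h3, inv_one, mul_one]
  · have h1 := cls_dipole_eq hn5 hxy hzy hxz (spread_dipole_mem hn x y hg)
      (spread_dipole_mem hn z y hg)
    rw [← mul_inv_eq_one, ← cls_inv, ← cls_mul] at h1
    rw [← h1]
    refine cls_congr _ ?_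
    rw [← map_inv, ← map_mul, dipole, dipole, dipole, mul_inv_rev, mul_assoc,
      mul_inv_cancel_left, ← Pi.mulSingle_inv]

/-- Multiplying by dipoles, whose classes are trivial, collects all coordinates at x, letter by
letter. -/
theorem cls_spread_mem_range (hn : 4 ≤ n)
    (h : ∀ x : Fin n, (branching n).map (graft x) ≤ branching n) (x : Fin n)
    {d : Fin n → TreeAut (Fin n)} (hd : spread d ∈ branching n) :
    cls hd ∈ (plant h x).range := by
  have key : ∀ s : Finset (Fin n), ∀ d : Fin n → TreeAut (Fin n), ∀ hd : spread d ∈ branching n,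
      (∀ y ∉ s, y ≠ x → d y = 1) → cls hd ∈ (plant h x).range := by
    intro s
    induction s using Finset.induction with
    | empty =>
      intro d hd h1
      have h2 : spread d = graft x (d x) := by
        rw [graft_eq_spread]
        congr 1
        funext y
        by_cases hy : y = x
        · rw [hy, Pi.mulSingle_eq_same]
        · rw [Pi.mulSingle_eq_of_ne hy, h1 y (Finset.notMem_empty y) hy]
      have h3 := branching_le hn hd
      have h4 : d x ∈ branching n :=
        (graft_mem_hanoi_iff hn x (coord_mem h3 x)).1 (h2 ▸ h3)
      exact ⟨cls h4, cls_congr _ h2.symm⟩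
    | insert y s hy ih =>
      intro d hd h1
      by_cases hyx : y = x
      · exact ih d hd fun z hz hzx => h1 z (by simp [hz, hzx, hyx]) hzx
      · have hdy : d y ∈ hanoi n := coord_mem (branching_le hn hd) y
        have h2 := spread_dipole_mem hn x y hdy
        have h3 : spread (dipole x y (d y) * d) ∈ branching n := by
          rw [map_mul]
          exact mul_mem h2 hd
        have h4 : cls h3 = cls hd := by
          rw [← one_mul (cls hd), ← cls_dipole hn (Ne.symm hyx) hdy, ← cls_mul]
          exact cls_congr _ (map_mul _ _ _)
        rw [← h4]
        refine ih _ h3 fun z hz hzx => ?_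
        rw [Pi.mul_apply, dipole_apply (Ne.symm hyx), if_neg hzx]
        split_ifs with h5
        · rw [h5, inv_mul_cancel]
        · rw [one_mul]
          exact h1 z (by simp [hz, h5]) hzx
  exact key Finset.univ d hd fun y hy => absurd (Finset.mem_univ y) hy

/-- The class of the rooted automorphism of a permutation. -/
noncomputable def rootedCls (hn : 4 ≤ n) : ↥(⁅hanoi n, hanoi n⁆.map perm) →* M n :=
  Abelianization.of.comp ((rooted.comp (Subgroup.subtype _)).codRestrict (branching n)
    fun σ => rooted_mem_branching hn σ.2)

/-- Every class is the class of some `x * k`, times that of a rooted automorphism. -/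
theorem exists_eq_mul_rootedCls (hn : 4 ≤ n)
    (h : ∀ x : Fin n, (branching n).map (graft x) ≤ branching n) (x : Fin n) (m : M n) :
    ∃ l ∈ (plant h x).range, ∃ σ, m = l * rootedCls hn σ := by
  obtain ⟨k, hk, rfl⟩ := exists_cls_eq m
  have hσ := (mem_branching_iff hn (branching_le hn hk)).1 hk
  have h1 := eq_spread_mul_rooted k
  have h2 : spread (fun x => sec k ((perm k)⁻¹ x)) ∈ branching n := by
    rw [eq_mul_inv_of_mul_eq h1.symm]
    exact mul_mem hk (inv_mem (rooted_mem_branching hn hσ))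
  refine ⟨cls h2, cls_spread_mem_range hn h x h2, ⟨perm k, hσ⟩, ?_⟩
  change _ = cls h2 * cls (rooted_mem_branching hn hσ)
  rw [← cls_mul]
  exact cls_congr _ h1

/-- The alternating group is perfect, so it has no image in an abelian group. For n = 4 this fails
and M may be larger than the image of planting. -/
theorem rootedCls_of_five (hn : 5 ≤ n) (σ : ↥(⁅hanoi n, hanoi n⁆.map perm)) :
    rootedCls (by omega) σ = 1 := by
  obtain ⟨σ, hσ⟩ := σ
  refine (cls_eq_one_iff (rooted_mem_branching (by omega) hσ)).2 ?_
  suffices ⁅alternatingGroup (Fin n), alternatingGroup (Fin n)⁆ ≤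
      ⁅branching n, branching n⁆.comap rooted by
    rw [map_perm_commutator_of_five hn] at hσ
    rw [commutator_alternatingGroup_eq_self (by simpa using hn)] at this
    exact this hσ
  refine Subgroup.commutator_le.2 fun a ha b hb => ?_
  rw [← map_perm_commutator_of_five hn] at ha hb
  rw [Subgroup.mem_comap, map_commutatorElement]
  exact Subgroup.commutator_mem_commutator (rooted_mem_branching (by omega) ha)
    (rooted_mem_branching (by omega) hb)

theorem plant_range_of_five (hn : 5 ≤ n)
    (h : ∀ x : Fin n, (branching n).map (graft x) ≤ branching n) (x : Fin n) :
    (plant h x).range = ⊤ := by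
  refine (Subgroup.eq_top_iff' _).2 fun m => ?_
  obtain ⟨l, hl, σ, rfl⟩ := exists_eq_mul_rootedCls (by omega) h x m
  rwa [rootedCls_of_five hn, mul_one]

theorem finite_M (hn : 4 ≤ n) (h : ∀ x : Fin n, (branching n).map (graft x) ≤ branching n)
    (x : Fin n) [Finite ↥(plant h x).range] : Finite (M n) := by
  refine Finite.of_surjective
    (fun p : ↥(plant h x).range × ↥(⁅hanoi n, hanoi n⁆.map perm) => p.1.1 * rootedCls hn p.2)
    fun m => ?_
  obtain ⟨l, hl, σ, rfl⟩ := exists_eq_mul_rootedCls hn h x m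
  exact ⟨(⟨l, hl⟩, σ), rfl⟩

/-- M is generated by the image of planting, of exponent dividing 3, and classes of rooted even
permutations of four letters, all of whose sixth powers are trivial. -/
theorem pow_eq_one_of_four (h : ∀ x : Fin 4, (branching 4).map (graft x) ≤ branching 4)
    (hr : ∀ l ∈ (plant h 0).range, l ^ 3 = 1) (m : M 4) : m ^ 6 = 1 := by
  obtain ⟨l, hl, σ, rfl⟩ := exists_eq_mul_rootedCls le_rfl h 0 m
  have h1 : σ ^ 6 = 1 := by
    obtain ⟨σ, hσ⟩ := σ
    apply Subtype.ext
    change σ ^ 6 = 1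
    have h2 : Equiv.Perm.sign σ = 1 := by
      rw [map_perm_commutator] at hσ
      exact alternatingGroup.commutator_perm_le (Subgroup.commutator_mono le_top le_top hσ)
    revert h2
    clear hσ
    revert σ
    decide +kernel
  rw [mul_pow, ← map_pow, h1, map_one, mul_one, show 6 = 3 * 2 from rfl, pow_mul, hr l hl, one_pow]

end Classes


/-! ### Exponents of words in the generators -/

section Exponents

variable {n : ℕ}

/-- The value of a positive word in the generators. -/
def wordVal (w : List (Fin n)) : TreeAut (Fin n) := (w.map (gen n)).prod

theorem wordVal_cons (a : Fin n) (w : List (Fin n)) : wordVal (a :: w) = gen n a * wordVal w :=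
  List.prod_cons

theorem wordVal_append (w w' : List (Fin n)) : wordVal (w ++ w') = wordVal w * wordVal w' := by
  rw [wordVal, List.map_append, List.prod_append]
  rfl

theorem wordVal_mem (w : List (Fin n)) : wordVal w ∈ hanoi n :=
  Subgroup.list_prod_mem _ fun _ h => by
    obtain ⟨i, -, rfl⟩ := List.mem_map.1 h
    exact gen_mem i

theorem exists_wordVal_inv (hn : 2 ≤ n) (w : List (Fin n)) : ∃ w', wordVal w' = (wordVal w)⁻¹ := by
  induction w with
  | nil => exact ⟨[], by simp [wordVal]⟩
  | cons a w ih =>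
    obtain ⟨w', h⟩ := ih
    -- Generators have (n-1)-st power 1, so the inverse of one is its (n-2)-nd power; positive words
    -- suffice.
    refine ⟨w' ++ List.replicate (n - 2) a, ?_⟩
    rw [wordVal_append, h, wordVal_cons, mul_inv_rev]
    congr 1
    rw [wordVal, List.map_replicate, List.prod_replicate, eq_inv_iff_mul_eq_one, ← pow_succ,
      show n - 2 + 1 = n - 1 by omega, gen_pow]

theorem exists_eq_wordVal (hn : 2 ≤ n) {g : TreeAut (Fin n)} (hg : g ∈ hanoi n) :
    ∃ w, g = wordVal w := by
  refine hanoi_induction (p := fun g => ∃ w, g = wordVal w) ?_ ?_ ?_ ?_ hg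
  · exact fun i => ⟨[i], by simp [wordVal]⟩
  · exact ⟨[], rfl⟩
  · rintro _ _ - - ⟨w, rfl⟩ ⟨w', rfl⟩
    exact ⟨w ++ w', (wordVal_append w w').symm⟩
  · rintro _ - ⟨w, rfl⟩
    obtain ⟨w', h⟩ := exists_wordVal_inv hn w
    exact ⟨w', h.symm⟩

/-- The word for the section at a letter of the value of a word. -/
noncomputable def secWord : List (Fin n) → Fin n → List (Fin n)
  | [], _ => []
  | a :: w, x => if perm (wordVal w) x = a then a :: secWord w x else secWord w x

theorem sec_wordVal (w : List (Fin n)) (x : Fin n) : sec (wordVal w) x = wordVal (secWord w x) := by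
  induction w with
  | nil => simp [wordVal, secWord]
  | cons a w ih =>
    rw [wordVal_cons, sec_mul, ih, secWord, sec_gen]
    split_ifs with h
    · rw [wordVal_cons]
    · rw [one_mul]

theorem length_secWord_le (w : List (Fin n)) (x : Fin n) : (secWord w x).length ≤ w.length := by
  induction w with
  | nil => exact le_rfl
  | cons a w ih =>
    rw [secWord]
    split_ifs
    · simpa using ih
    · exact ih.trans (by simp)

/-- Each occurrence of a letter in w survives in the section word of exactly one x, since the suffix
after it permutes the letters. -/
theorem sum_count_secWord (w : List (Fin n)) (i : Fin n) :
    ∑ x, (secWord w x).count i = w.count i := by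
  induction w with
  | nil => simp [secWord]
  | cons a w ih =>
    have h : ∀ x, (secWord (a :: w) x).count i =
        (secWord w x).count i + if x = (perm (wordVal w))⁻¹ a then (if a = i then 1 else 0)
          else 0 := by
      intro x
      simp only [secWord, Equiv.Perm.eq_inv_iff_eq]
      split_ifs with h1 h2
      · rw [h2, List.count_cons_self]
      · rw [List.count_cons_of_ne h2, add_zero]
      · rw [add_zero]
    simp only [h]
    rw [Finset.sum_add_distrib, ih, Finset.sum_ite_eq' Finset.univ, if_pos (Finset.mem_univ _),
      List.count_cons]
    simp

/-- Nothing is dropped only if, reading from the right, each letter is the current image of x;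
generators fix their own letter, so that image stays x. -/
theorem eq_replicate_of_length_secWord {w : List (Fin n)} {x : Fin n}
    (h : (secWord w x).length = w.length) : w = List.replicate w.length x := by
  suffices w = List.replicate w.length x ∧ perm (wordVal w) x = x from this.1
  induction w with
  | nil => simp [wordVal]
  | cons a w ih =>
    rw [secWord] at h
    split_ifs at h with h1
    · obtain ⟨h2, h3⟩ := ih (by simpa using h)
      have h4 : a = x := h1.symm.trans h3
      subst h4
      refine ⟨?_, ?_⟩
      · rw [List.length_cons, List.replicate_succ, ← h2]
      · rw [wordVal_cons, map_mul, Equiv.Perm.mul_apply, h3, perm_gen, cyc_self]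
    · have := length_secWord_le w x
      rw [h, List.length_cons] at this
      omega

theorem dvd_of_gen_pow_eq_one (hn : 3 ≤ n) {i : Fin n} {k : ℕ} (h : gen n i ^ k = 1) :
    n - 1 ∣ k := by
  have h1 : cyc n i ^ k = 1 := by rw [← perm_gen, ← map_pow, h, map_one]
  have h2 : orderOf (cyc n i) = n - 1 := by
    rw [(isCycle_cyc hn i).orderOf]
    have h3 : (cyc n i).support = {i}ᶜ := by
      ext x
      rw [Equiv.Perm.mem_support, Finset.mem_compl, Finset.mem_singleton]
      refine ⟨fun h' hx => h' ?_, mem_support_cyc hn⟩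
      rw [hx, cyc_self]
    rw [h3, Finset.card_compl, Finset.card_singleton, Fintype.card_fin]
  rw [← h2]
  exact orderOf_dvd_of_pow_eq_one h1

/-- The exponents of a trivial positive word are divisible by `n - 1`. -/
theorem dvd_count_of_wordVal_eq_one (hn : 3 ≤ n) {w : List (Fin n)} (h : wordVal w = 1)
    (i : Fin n) : n - 1 ∣ w.count i := by
  induction hl : w.length using Nat.strong_induction_on generalizing w with
  | _ l ih =>
    -- Contraction: either w is a power of one generator, or all section words are strictly shorter
    -- trivial words and the counts add up.
    by_cases hx : ∃ x, (secWord w x).length = w.length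
    · obtain ⟨x, hx⟩ := hx
      have h1 := eq_replicate_of_length_secWord hx
      rw [h1, wordVal, List.map_replicate, List.prod_replicate] at h
      rw [h1, List.count_replicate]
      split_ifs
      · exact dvd_of_gen_pow_eq_one hn h
      · exact dvd_zero _
    · push Not at hx
      rw [← sum_count_secWord]
      refine Finset.dvd_sum fun x _ => ih _ ?_ ?_ rfl
      · rw [← hl]
        exact lt_of_le_of_ne (length_secWord_le w x) (hx x)
      · rw [← sec_wordVal, h, sec_one]

theorem count_eq_of_wordVal_eq (hn : 3 ≤ n) {w w' : List (Fin n)} (h : wordVal w = wordVal w')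
    (i : Fin n) : (w.count i : ZMod (n - 1)) = w'.count i := by
  obtain ⟨u, hu⟩ := exists_wordVal_inv (by omega) w
  have h1 := dvd_count_of_wordVal_eq_one hn (w := u ++ w)
    (by rw [wordVal_append, hu, inv_mul_cancel]) i
  have h2 := dvd_count_of_wordVal_eq_one hn (w := u ++ w')
    (by rw [wordVal_append, hu, h, inv_mul_cancel]) i
  rw [← ZMod.natCast_eq_zero_iff, List.count_append, Nat.cast_add] at h1 h2
  exact add_left_cancel (h1.trans h2.symm)

/-- The exponents, modulo `n - 1`, of an element of the group. -/
noncomputable def exponents (hn : 3 ≤ n) : ↥(hanoi n) →* (Fin n → Multiplicative (ZMod (n - 1))) :=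
  MonoidHom.mk'
    (fun g i => Multiplicative.ofAdd
      (((exists_eq_wordVal (by omega) g.2).choose.count i : ℕ) : ZMod (n - 1)))
    fun f g => funext fun i => by
      rw [Pi.mul_apply, ← ofAdd_add, ← Nat.cast_add, ← List.count_append]
      refine congrArg _ (count_eq_of_wordVal_eq hn ?_ i)
      rw [wordVal_append, ← (exists_eq_wordVal (by omega) f.2).choose_spec,
        ← (exists_eq_wordVal (by omega) g.2).choose_spec,
        ← (exists_eq_wordVal (by omega) (f * g).2).choose_spec]
      rfl

theorem exponents_wordVal (hn : 3 ≤ n) (w : List (Fin n)) (i : Fin n) :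
    exponents hn ⟨wordVal w, wordVal_mem w⟩ i =
      Multiplicative.ofAdd ((w.count i : ℕ) : ZMod (n - 1)) :=
  congrArg Multiplicative.ofAdd (count_eq_of_wordVal_eq hn
    (exists_eq_wordVal (by omega) (wordVal_mem w)).choose_spec.symm i)

theorem exponents_gen (hn : 3 ≤ n) (i j : Fin n) :
    exponents hn ⟨gen n i, gen_mem i⟩ j = Multiplicative.ofAdd (if i = j then 1 else 0) := by
  have h : (⟨gen n i, gen_mem i⟩ : ↥(hanoi n)) = ⟨wordVal [i], wordVal_mem _⟩ :=
    Subtype.ext (by simp [wordVal])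
  rw [h, exponents_wordVal, List.count_cons]
  simp

theorem of_wordVal (w : List (Fin n)) :
    Abelianization.of (⟨wordVal w, wordVal_mem w⟩ : ↥(hanoi n)) = ∏ i, genAb i ^ w.count i := by
  induction w with
  | nil =>
    simp only [List.count_nil, pow_zero, Finset.prod_const_one]
    exact map_one Abelianization.of
  | cons a w ih =>
    have h : (⟨wordVal (a :: w), wordVal_mem _⟩ : ↥(hanoi n)) =
      ⟨gen n a, gen_mem a⟩ * ⟨wordVal w, wordVal_mem w⟩ := Subtype.ext (wordVal_cons a w)
    rw [h, map_mul, ih]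
    simp only [List.count_cons, pow_add, Finset.prod_mul_distrib, mul_comm]
    congr 1
    rw [Finset.prod_eq_single a]
    · simp [genAb]
    · intro b _ hb
      simp [hb.symm]
    · exact fun h => absurd (Finset.mem_univ a) h

theorem exponents_surjective (hn : 3 ≤ n) : Function.Surjective (exponents hn) := by
  rw [← MonoidHom.range_eq_top, Subgroup.eq_top_iff']
  intro v
  have : NeZero (n - 1) := ⟨by omega⟩
  have h1 : v = ∏ i, exponents hn ⟨gen n i, gen_mem i⟩ ^ (v i).toAdd.val := by
    funext j
    rw [Finset.prod_apply, Finset.prod_eq_single j]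
    · rw [Pi.pow_apply, exponents_gen, if_pos rfl, ← ofAdd_nsmul]
      simp
    · intro i _ hi
      rw [Pi.pow_apply, exponents_gen, if_neg hi]
      simp
    · exact fun h => absurd (Finset.mem_univ j) h
  rw [h1]
  exact prod_mem (S := (exponents hn).range) fun i _ => pow_mem (MonoidHom.mem_range.2 ⟨_, rfl⟩) _

/-- The abelianization is a power of the cyclic group of order `n - 1`. -/
noncomputable def abEquiv (hn : 3 ≤ n) :
    Abelianization ↥(hanoi n) ≃* (Fin n → Multiplicative (ZMod (n - 1))) :=
  MulEquiv.ofBijective (Abelianization.lift (exponents hn)) <| by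
    refine ⟨(injective_iff_map_eq_one _).2 fun v hv => ?_, fun v => ?_⟩
    · obtain ⟨⟨g, hg⟩, rfl⟩ := QuotientGroup.mk_surjective v
      obtain ⟨w, rfl⟩ := exists_eq_wordVal (by omega) hg
      change Abelianization.lift (exponents hn) (Abelianization.of ⟨wordVal w, hg⟩) = 1 at hv
      rw [Abelianization.lift_apply_of] at hv
      refine (of_wordVal w).trans (Finset.prod_eq_one fun i _ => ?_)
      have h1 := congrFun hv i
      rw [exponents_wordVal, Pi.one_apply, ofAdd_eq_one, ZMod.natCast_eq_zero_iff] at h1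
      exact orderOf_dvd_iff_pow_eq_one.1 ((orderOf_dvd_of_pow_eq_one (genAb_pow i)).trans h1)
    · obtain ⟨g, rfl⟩ := exponents_surjective hn v
      exact ⟨Abelianization.of g, Abelianization.lift_apply_of _ _⟩

theorem finite_abelianization (hn : 3 ≤ n) : Finite (Abelianization ↥(hanoi n)) := by
  have : NeZero (n - 1) := ⟨by omega⟩
  have : Finite (Multiplicative (ZMod (n - 1))) := inferInstanceAs (Finite (ZMod (n - 1)))
  exact Finite.of_equiv _ (abEquiv hn).symm.toEquiv

theorem abelianization_pow (v : Abelianization ↥(hanoi n)) : v ^ (n - 1) = 1 := by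
  have h : (powMonoidHom (n - 1) : Abelianization ↥(hanoi n) →* _).ker = ⊤ :=
    eq_top_of_genAb_mem fun i => genAb_pow i
  exact MonoidHom.mem_ker.1 (h ▸ Subgroup.mem_top v : v ∈ (powMonoidHom (n - 1)).ker)

/-- An element of K whose class in the abelianization of G has order n - 1; it yields the lower
bounds on exponents. -/
theorem exists_exponents_eq (hn : 4 ≤ n) : ∃ (k : TreeAut (Fin n)) (hk : k ∈ branching n)
    (i : Fin n), exponents (by omega) ⟨k, branching_le hn hk⟩ i = Multiplicative.ofAdd 1 := by
  rcases hn.eq_or_lt with rfl | hn5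
  · have h1 : gen 4 0 * (gen 4 2)⁻¹ * gen 4 3 * gen 4 2 ∈ branching 4 :=
      branch4_generators_mem (by simp)
    refine ⟨_, h1, 0, ?_⟩
    have h2 : (⟨_, branching_le hn h1⟩ : ↥(hanoi 4)) = ⟨gen 4 0, gen_mem 0⟩ *
      ⟨gen 4 2, gen_mem 2⟩⁻¹ * ⟨gen 4 3, gen_mem 3⟩ * ⟨gen 4 2, gen_mem 2⟩ := rfl
    rw [h2]
    simp [exponents_gen]
  · set i : Fin n := ⟨0, by omega⟩ with hi
    set j : Fin n := ⟨1, by omega⟩ with hj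
    have hij : j ≠ i := by simp [hi, hj]
    have h0 : gen n i * (gen n j)⁻¹ ∈ hanoi n := mul_mem (gen_mem i) (inv_mem (gen_mem j))
    have h1 : gen n i * (gen n j)⁻¹ ∈ branching n := by
      rw [mem_branching_iff hn h0, map_perm_commutator_of_five hn5,
        Equiv.Perm.mem_alternatingGroup, map_mul, map_mul, map_inv, map_inv, perm_gen, perm_gen,
        sign_cyc (by omega), sign_cyc (by omega), mul_inv_cancel]
    refine ⟨_, h1, i, ?_⟩
    have h2 : (⟨_, branching_le hn h1⟩ : ↥(hanoi n)) = ⟨gen n i, gen_mem i⟩ *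
      ⟨gen n j, gen_mem j⟩⁻¹ := rfl
    rw [h2, map_mul, map_inv, Pi.mul_apply, Pi.inv_apply, exponents_gen, exponents_gen, if_pos rfl,
      if_neg hij]
    simp

/-- If the map from `M n` to the abelianization of the group factors through `A`, then the exponent
of `A` is divisible by `n - 1`. -/
theorem dvd_exponent_of_hom (hn : 4 ≤ n) {A : Type*} [Group A] (f : M n →* A)
    (r : A →* Abelianization ↥(hanoi n)) (h : ∀ m, r (f m) = inclAb hn m) :
    n - 1 ∣ Monoid.exponent A := by
  obtain ⟨k, hk, i, hi⟩ := exists_exponents_eq hn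
  have h1 : f (cls hk) ^ Monoid.exponent A = 1 := Monoid.pow_exponent_eq_one _
  have h2 := congrArg (fun v => abEquiv (by omega : 3 ≤ n) (r v) i) h1
  simp only [map_pow, h, inclAb_cls, map_one, Pi.pow_apply, Pi.one_apply] at h2
  change exponents (by omega) ⟨k, branching_le hn hk⟩ i ^ _ = 1 at h2
  rw [hi, ← ofAdd_nsmul, ofAdd_eq_one, nsmul_one, ZMod.natCast_eq_zero_iff] at h2
  exact h2

theorem exponent_M (hn : 4 ≤ n) (h : n = 4 ∨ Odd n) :
    n - 1 ≤ Monoid.exponent (M n) ∧ Monoid.exponent (M n) ≤ 2 * (n - 1) := by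
  have h1 : n - 1 ∣ Monoid.exponent (M n) :=
    dvd_exponent_of_hom hn (MonoidHom.id _) (inclAb hn) fun _ => rfl
  have h2 : Monoid.exponent (M n) ∣ 2 * (n - 1) := by
    refine Monoid.exponent_dvd_of_forall_pow_eq_one fun m => ?_
    have x : Fin n := ⟨0, by omega⟩
    have hr : ∀ l ∈ (plant (map_graft_branching_le hn) x).range, l ^ (n - 1) = 1 := by
      intro l hl
      have h3 := (injective_iff_map_eq_one _).1
        (inclAb_injOn_range hn (map_graft_branching_le hn) x) (⟨l, hl⟩ ^ (n - 1))
        (by rw [map_pow, abelianization_pow])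
      exact congrArg Subtype.val h3
    rcases hn.eq_or_lt with rfl | hn5
    · rw [plant_eq hn _ x 0] at hr
      exact pow_eq_one_of_four (map_graft_branching_le hn) hr m
    · rw [mul_comm, pow_mul, hr m (by rw [plant_range_of_five hn5]; exact Subgroup.mem_top m),
        one_pow]
  exact ⟨Nat.le_of_dvd (Nat.pos_of_dvd_of_pos h2 (by omega)) h1, Nat.le_of_dvd (by omega) h2⟩

theorem exponent_range_plant (hn : 4 ≤ n)
    (h : ∀ x : Fin n, (branching n).map (graft x) ≤ branching n) (x : Fin n) :
    n - 1 ≤ Monoid.exponent ↥(plant h x).range ∧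
      Monoid.exponent ↥(plant h x).range ≤ 2 * (n - 1) := by
  have h1 : n - 1 ∣ Monoid.exponent ↥(plant h x).range :=
    dvd_exponent_of_hom hn (plant h x).rangeRestrict
      ((inclAb hn).comp (plant h x).range.subtype) (inclAb_plant hn h x)
  have h2 : Monoid.exponent ↥(plant h x).range ∣ n - 1 :=
    Monoid.exponent_dvd_of_forall_pow_eq_one fun l =>
      (injective_iff_map_eq_one _).1 (inclAb_injOn_range hn h x) _
        (by rw [map_pow, abelianization_pow])
  have h3 := Nat.le_of_dvd (by omega) h2
  exact ⟨Nat.le_of_dvd (Nat.pos_of_dvd_of_pos h2 (by omega)) h1, by omega⟩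

theorem finite_range_plant (hn : 4 ≤ n)
    (h : ∀ x : Fin n, (branching n).map (graft x) ≤ branching n) (x : Fin n) :
    Finite ↥(plant h x).range :=
  have := finite_abelianization (by omega : 3 ≤ n)
  Finite.of_injective _ (inclAb_injOn_range hn h x)

end Exponents


/-! ### Kernels of completions -/

section InvLim

variable {A : ℕ → Type} [∀ m, Group (A m)] {t : ∀ m, A (m + 1) →* A m}

theorem InvLim.ext {x y : InvLim A t} (h : ∀ m, x.1 m = y.1 m) : x = y := Subtype.ext (funext h)

theorem InvLim.continuous_iff {Y : Type*} [TopologicalSpace Y] {f : Y → InvLim A t} :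
    Continuous f ↔ ∀ m, IsLocallyConstant fun y => (f y).1 m := by
  let _ : ∀ m, TopologicalSpace (A m) := fun _ => ⊥
  have : ∀ m, DiscreteTopology (A m) := fun _ => ⟨rfl⟩
  rw [continuous_induced_rng, continuous_pi_iff]
  exact forall_congr' fun m => (IsLocallyConstant.iff_continuous _).symm

theorem InvLim.isLocallyConstant (m : ℕ) : IsLocallyConstant fun x : InvLim A t => x.1 m :=
  InvLim.continuous_iff.1 continuous_id m

instance : T2Space (InvLim A t) := by
  let _ : ∀ m, TopologicalSpace (A m) := fun _ => ⊥
  have : ∀ m, DiscreteTopology (A m) := fun _ => ⟨rfl⟩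
  exact T2Space.of_injective_continuous (f := fun x : InvLim A t => x.1) Subtype.val_injective
    continuous_induced_dom

end InvLim

/-! ### Completion kernels as inverse limits of quotients -/

section Kernel

open ProfiniteGrp.ProfiniteCompletion

variable {G : Type} [Group G]

/-- The coordinate of an element of the profinite completion at a subgroup. -/
def proj (x : ProfCompletion G) (H : Subgroup G) [hn : H.Normal] [hf : H.FiniteIndex] : G ⧸ H :=
  x.1 (@FiniteIndexNormalSubgroup.mk (GrpCat.of G) _ H hn hf)

theorem proj_eq_of_le {x : ProfCompletion G} {H J : Subgroup G} [H.Normal] [H.FiniteIndex]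
    [J.Normal] [J.FiniteIndex] (h : H ≤ J) {g : G} (hg : proj x H = (g : G ⧸ H)) :
    proj x J = (g : G ⧸ J) := by
  have h1 : proj x J = QuotientGroup.map H J (MonoidHom.id G) h (proj x H) :=
    (x.2 (CategoryTheory.homOfLE (show
      @FiniteIndexNormalSubgroup.mk (GrpCat.of G) _ H inferInstance inferInstance ≤
        @FiniteIndexNormalSubgroup.mk (GrpCat.of G) _ J inferInstance inferInstance from h))).symm
  rw [h1, hg]
  rfl

theorem proj_ext {x y : ProfCompletion G}
    (h : ∀ (H : Subgroup G) [H.Normal] [H.FiniteIndex], proj x H = proj y H) : x = y := by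
  refine ProfiniteGrp.limit_ext _ _ _ fun H => ?_
  have := H.isNormal'
  have := H.isFiniteIndex'
  exact h H.toSubgroup

theorem isLocallyConstant_proj (H : Subgroup G) [H.Normal] [H.FiniteIndex] :
    IsLocallyConstant fun x : ProfCompletion G => proj x H := by
  let _ : TopologicalSpace (G ⧸ H) := ⊥
  have : DiscreteTopology (G ⧸ H) := ⟨rfl⟩
  refine (IsLocallyConstant.iff_continuous _).2 ?_
  exact (continuous_apply (A := fun j => (diagram (GrpCat.of G)).obj j)
    (@FiniteIndexNormalSubgroup.mk (GrpCat.of G) _ H inferInstance inferInstance)).comp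
      continuous_subtype_val

/-- The element of the profinite completion with given coordinates. -/
def ofProj (c : ∀ (H : Subgroup G) [H.Normal] [H.FiniteIndex], G)
    (h : ∀ (H J : Subgroup G) [H.Normal] [H.FiniteIndex] [J.Normal] [J.FiniteIndex], H ≤ J →
      (c H : G ⧸ J) = c J) : ProfCompletion G :=
  ⟨fun H => (QuotientGroup.mk
      (@c H.toSubgroup H.isNormal' H.isFiniteIndex') : G ⧸ H.toSubgroup),
    fun H J π => @h H.toSubgroup J.toSubgroup H.isNormal' H.isFiniteIndex' J.isNormal'
      J.isFiniteIndex' π.le⟩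

variable {N : ℕ → Subgroup G} [hnormal : ∀ m, (N m).Normal] {hN : ∀ m, N (m + 1) ≤ N m}
  {hf : ∀ m, (N m).FiniteIndex}

theorem mem_ker_toSeqCompletion {x : ProfCompletion G} :
    x ∈ (toSeqCompletion N hN hf).ker ↔ ∀ m, @proj _ _ x (N m) _ (hf m) = 1 := by
  rw [MonoidHom.mem_ker]
  exact ⟨fun h m => congrFun (congrArg Subtype.val h) m, fun h => InvLim.ext h⟩

variable {A : ℕ → Type} [∀ m, Group (A m)] {t : ∀ m, A (m + 1) →* A m}

section Map

variable (θ : ∀ m, ↥(N m) →* A m)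

/-- The subgroup of the elements of `N m` with trivial image. -/
abbrev kerSub (m : ℕ) : Subgroup G := (θ m).ker.map (N m).subtype

theorem mem_kerSub {m : ℕ} {g : G} : g ∈ kerSub θ m ↔ ∃ h : g ∈ N m, θ m ⟨g, h⟩ = 1 := by
  constructor
  · rintro ⟨⟨g, h⟩, h', rfl⟩
    exact ⟨h, h'⟩
  · rintro ⟨h, h'⟩
    exact ⟨⟨g, h⟩, h', rfl⟩

theorem kerSub_le (m : ℕ) : kerSub θ m ≤ N m := fun _ h => ((mem_kerSub θ).1 h).1

variable [∀ m, (kerSub θ m).Normal] [∀ m, (kerSub θ m).FiniteIndex]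

theorem mk_eq_mk_kerSub {m : ℕ} {g h : ↥(N m)} :
    (g : G ⧸ kerSub θ m) = (h : G) ↔ θ m g = θ m h := by
  rw [QuotientGroup.eq, mem_kerSub]
  constructor
  · rintro ⟨h1, h2⟩
    have h3 : (⟨(g : G)⁻¹ * h, h1⟩ : ↥(N m)) = g⁻¹ * h := rfl
    rw [h3, map_mul, map_inv, inv_mul_eq_one] at h2
    exact h2
  · intro h1
    refine ⟨mul_mem (inv_mem g.2) h.2, ?_⟩
    have h3 : (⟨(g : G)⁻¹ * h, mul_mem (inv_mem g.2) h.2⟩ : ↥(N m)) = g⁻¹ * h := rfl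
    rw [h3, map_mul, map_inv, h1, inv_mul_cancel]

open Classical in
/-- The map that sends the class of an element of `N m` to its image. -/
noncomputable def descend (m : ℕ) (q : G ⧸ kerSub θ m) : A m :=
  -- The default is never used on elements of the completion kernel: by `exists_proj_kerSub` their
  -- coordinates come from N m.
  if h : ∃ g : ↥(N m), q = ((g : G) : G ⧸ kerSub θ m) then θ m h.choose else 1

theorem descend_mk {m : ℕ} (g : ↥(N m)) : descend θ m ((g : G) : G ⧸ kerSub θ m) = θ m g := by
  have h : ∃ g' : ↥(N m), ((g : G) : G ⧸ kerSub θ m) = ((g' : G) : G ⧸ kerSub θ m) := ⟨g, rfl⟩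
  rw [descend, dif_pos h]
  exact ((mk_eq_mk_kerSub θ).1 h.choose_spec).symm

theorem exists_proj_kerSub {x : ProfCompletion G} (hx : x ∈ (toSeqCompletion N hN hf).ker)
    (m : ℕ) : ∃ g : ↥(N m), proj x (kerSub θ m) = ((g : G) : G ⧸ kerSub θ m) := by
  obtain ⟨g, hg⟩ := QuotientGroup.mk_surjective (proj x (kerSub θ m))
  have := hf m
  have h1 := proj_eq_of_le (kerSub_le θ m) hg.symm
  rw [mem_ker_toSeqCompletion.1 hx m, eq_comm, QuotientGroup.eq_one_iff] at h1
  exact ⟨⟨g, h1⟩, hg.symm⟩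

theorem descend_proj {x : ProfCompletion G} {m : ℕ} {g : ↥(N m)}
    (hg : proj x (kerSub θ m) = ((g : G) : G ⧸ kerSub θ m)) :
    descend θ m (proj x (kerSub θ m)) = θ m g := by
  rw [hg, descend_mk]

variable {θ}

theorem kerSub_succ_le (hθ : ∀ m (g : ↥(N (m + 1))), t m (θ (m + 1) g) = θ m ⟨g, hN m g.2⟩)
    (m : ℕ) : kerSub θ (m + 1) ≤ kerSub θ m := by
  intro g hg
  obtain ⟨h, h'⟩ := (mem_kerSub θ).1 hg
  exact (mem_kerSub θ).2 ⟨hN m h, by rw [← hθ m ⟨g, h⟩, h', map_one]⟩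

variable (hθ : ∀ m (g : ↥(N (m + 1))), t m (θ (m + 1) g) = θ m ⟨g, hN m g.2⟩)

/-- The map from the kernel to the inverse limit. -/
noncomputable def kernelMap : ↥(toSeqCompletion N hN hf).ker →* InvLim A t where
  toFun x := ⟨fun m => descend θ m (proj x.1 (kerSub θ m)), fun m => by
    obtain ⟨g, hg⟩ := exists_proj_kerSub θ x.2 (m + 1)
    change t m (descend θ (m + 1) (proj x.1 (kerSub θ (m + 1)))) = _
    rw [descend_proj θ hg, hθ]
    exact (descend_proj θ (g := ⟨g, hN m g.2⟩) (proj_eq_of_le (kerSub_succ_le hθ m) hg)).symm⟩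
  map_one' := InvLim.ext fun m =>
    (descend_proj θ (x := 1) (g := (1 : ↥(N m))) rfl).trans (map_one (θ m))
  map_mul' x y := InvLim.ext fun m => by
    obtain ⟨g, hg⟩ := exists_proj_kerSub θ x.2 m
    obtain ⟨g', hg'⟩ := exists_proj_kerSub θ y.2 m
    change descend θ m (proj (x.1 * y.1) (kerSub θ m)) =
      descend θ m (proj x.1 (kerSub θ m)) * descend θ m (proj y.1 (kerSub θ m))
    rw [descend_proj θ hg, descend_proj θ hg', ← map_mul]
    refine descend_proj θ (g := g * g') ?_
    change proj x.1 (kerSub θ m) * proj y.1 (kerSub θ m) = _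
    rw [hg, hg']
    rfl

theorem continuous_kernelMap : Continuous (kernelMap (hf := hf) hθ) :=
  InvLim.continuous_iff.2 fun m =>
    ((isLocallyConstant_proj (kerSub θ m)).comp_continuous continuous_subtype_val).comp
      (descend θ m)

/-- By cofinality an element of the completion is determined by its coordinates at the subgroups
`kerSub θ m`, and there θ m is faithful. -/
theorem kernelMap_injective
    (hcof : ∀ (H : Subgroup G) [H.Normal] [H.FiniteIndex], ∃ m, kerSub θ m ≤ H) :
    Function.Injective (kernelMap (hf := hf) hθ) := by
  refine (injective_iff_map_eq_one _).2 fun x hx => Subtype.ext (proj_ext fun H _ _ => ?_)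
  obtain ⟨m, hm⟩ := hcof H
  obtain ⟨g, hg⟩ := exists_proj_kerSub θ x.2 m
  have h1 : descend θ m (proj x.1 (kerSub θ m)) = 1 := congrFun (congrArg Subtype.val hx) m
  rw [descend_proj θ hg] at h1
  have h2 : (g : G) ∈ H := hm ((mem_kerSub θ).2 ⟨g.2, h1⟩)
  rw [proj_eq_of_le hm hg, (QuotientGroup.eq_one_iff _).2 h2]
  rfl

theorem kernelMap_surjective (hsurj : ∀ m, Function.Surjective (θ m))
    (hcof : ∀ (H : Subgroup G) [H.Normal] [H.FiniteIndex], ∃ m, kerSub θ m ≤ H) :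
    Function.Surjective (kernelMap (hf := hf) hθ) := by
  intro a
  choose g hg using fun m => hsurj m (a.1 m)
  -- Later lifts are also lifts of earlier coordinates, so the g m converge: modulo any H they are
  -- eventually constant, from the index given by cofinality on.
  have hmono : ∀ m r, ∃ h : (g (m + r) : G) ∈ N m, θ m ⟨g (m + r), h⟩ = a.1 m := by
    intro m r
    induction r generalizing m with
    | zero => exact ⟨(g m).2, hg m⟩
    | succ r ih =>
      have h1 := ih (m + 1)
      rw [show m + 1 + r = m + (r + 1) by ring] at h1
      obtain ⟨h2, h3⟩ := h1
      exact ⟨hN m h2, by rw [← hθ m ⟨_, h2⟩, h3, a.2 m]⟩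
  have hle : ∀ m m', m ≤ m' → ((g m' : G) : G ⧸ kerSub θ m) = (g m : G) := by
    intro m m' h
    obtain ⟨r, rfl⟩ := Nat.exists_eq_add_of_le h
    obtain ⟨h1, h2⟩ := hmono m r
    exact (mk_eq_mk_kerSub θ (g := ⟨g (m + r), h1⟩)).2 (h2.trans (hg m).symm)
  have heq : ∀ (J : Subgroup G) (m m' : ℕ), kerSub θ m ≤ J → kerSub θ m' ≤ J →
      ((g m : G) : G ⧸ J) = (g m' : G) := by
    intro J m m' h h'
    rcases le_total m m' with h1 | h1
    · have := hle m m' h1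
      rw [eq_comm, QuotientGroup.eq] at this ⊢
      exact inv_mem_iff.1 (by simpa using h this)
    · have := hle m' m h1
      rw [QuotientGroup.eq] at this ⊢
      exact h' this
  let x : ProfCompletion G := ofProj (fun H _ _ => (g (hcof H).choose : G))
    fun H J _ _ _ _ h => heq J _ _ ((hcof H).choose_spec.trans h) (hcof J).choose_spec
  have hx : ∀ (H : Subgroup G) [H.Normal] [H.FiniteIndex] (m : ℕ), kerSub θ m ≤ H →
      proj x H = ((g m : G) : G ⧸ H) := fun H _ _ m h => heq H _ m (hcof H).choose_spec h
  have hxk : x ∈ (toSeqCompletion N hN hf).ker := by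
    refine mem_ker_toSeqCompletion.2 fun m => ?_
    have := hf m
    exact (hx (N m) m (kerSub_le θ m)).trans ((QuotientGroup.eq_one_iff _).2 (g m).2)
  refine ⟨⟨x, hxk⟩, InvLim.ext fun m => ?_⟩
  exact (descend_proj θ (hx (kerSub θ m) m le_rfl)).trans (hg m)

instance compactSpace_ker : CompactSpace ↥(toSeqCompletion N hN hf).ker := by
  refine isCompact_iff_compactSpace.1 (IsClosed.isCompact ?_)
  have h1 : ((toSeqCompletion N hN hf).ker : Set (ProfCompletion G)) =
      ⋂ m, {x | @proj _ _ x (N m) _ (hf m) = 1} := by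
    ext x
    rw [SetLike.mem_coe, mem_ker_toSeqCompletion, Set.mem_iInter]
    rfl
  rw [h1]
  refine isClosed_iInter fun m => ?_
  have := hf m
  exact (isLocallyConstant_proj (N m)).isClosed_fiber 1

/-- The kernel of the map to the completion with respect to the subgroups `N m` is the inverse
limit of the quotients of the `N m` by a cofinal sequence of subgroups. -/
noncomputable def kernelEquiv (hsurj : ∀ m, Function.Surjective (θ m))
    (hcof : ∀ (H : Subgroup G) [H.Normal] [H.FiniteIndex], ∃ m, kerSub θ m ≤ H) :
    ↥(toSeqCompletion N hN hf).ker ≃ₜ* InvLim A t :=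
  { MulEquiv.ofBijective (kernelMap (hf := hf) hθ)
      ⟨kernelMap_injective hθ hcof, kernelMap_surjective hθ hsurj hcof⟩,
    -- The kernel is compact and the limit Hausdorff, so the continuous bijection is a
    -- homeomorphism.
    Continuous.homeoOfEquivCompactToT2
      (f := Equiv.ofBijective (kernelMap (hf := hf) hθ)
        ⟨kernelMap_injective hθ hcof, kernelMap_surjective hθ hsurj hcof⟩)
      (continuous_kernelMap hθ) with }

end Map

end Kernel


/-! ### Sections at words -/

section WordSections

open commutatorElement

variable {n : ℕ}

/-- The section of a tree automorphism at a word. -/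
noncomputable def wordSec : TreeAut (Fin n) → List (Fin n) → TreeAut (Fin n)
  | g, [] => g
  | g, x :: u => wordSec (sec g x) u

theorem wordSec_one (u : List (Fin n)) : wordSec (1 : TreeAut (Fin n)) u = 1 := by
  induction u with
  | nil => rfl
  | cons x u ih => rw [wordSec, sec_one, ih]

theorem wordSec_mem {H : Subgroup (TreeAut (Fin n))} {g : TreeAut (Fin n)} {u : List (Fin n)}
    {m : ℕ} (hu : u.length = m) (hg : g ∈ levelProd H m) : wordSec g u ∈ H := by
  induction u generalizing g m with
  | nil =>
    subst hu
    exact hg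
  | cons x u ih =>
    subst hu
    exact ih rfl ((mem_levelProd_succ.1 hg).2 x)

/-- The right factor fixes the level of u, so no vertex is permuted between the two sections. -/
theorem wordSec_mul {H : Subgroup (TreeAut (Fin n))} (f : TreeAut (Fin n)) {g : TreeAut (Fin n)}
    {u : List (Fin n)} {m : ℕ} (hu : u.length = m) (hg : g ∈ levelProd H m) :
    wordSec (f * g) u = wordSec f u * wordSec g u := by
  subst hu
  induction u generalizing f g with
  | nil => rfl
  | cons x u ih =>
    obtain ⟨h1, h2⟩ := mem_levelProd_succ.1 hg
    rw [wordSec, sec_mul, h1, Equiv.Perm.one_apply]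
    exact ih _ (h2 x)

theorem mem_levelProd_of_wordSec {H J : Subgroup (TreeAut (Fin n))} {m : ℕ} {g : TreeAut (Fin n)}
    (hg : g ∈ levelProd J m) (h : ∀ u, u.length = m → wordSec g u ∈ H) : g ∈ levelProd H m := by
  induction m generalizing g with
  | zero => exact h [] rfl
  | succ m ih =>
    obtain ⟨h1, h2⟩ := mem_levelProd_succ.1 hg
    exact mem_levelProd_succ.2 ⟨h1, fun x => ih (h2 x) fun u hu => h (x :: u) (by simp [hu])⟩

theorem exists_wordSec_eq {H : Subgroup (TreeAut (Fin n))} {m : ℕ}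
    (k : List (Fin n) → TreeAut (Fin n)) (hk : ∀ u, u.length = m → k u ∈ H) :
    ∃ g ∈ levelProd H m, ∀ u, u.length = m → wordSec g u = k u := by
  induction m generalizing k with
  | zero =>
    refine ⟨k [], hk [] rfl, fun u hu => ?_⟩
    rw [List.length_eq_zero_iff.1 hu]
    rfl
  | succ m ih =>
    choose d hd hd' using fun x => ih (fun u => k (x :: u)) fun u hu => hk _ (by simp [hu])
    refine ⟨spread d, mem_levelProd_succ.2 ⟨perm_spread d, fun x => ?_⟩, ?_⟩
    · rw [sec_spread]
      exact hd x
    · rintro (_ | ⟨x, u⟩) hu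
      · simp at hu
      · rw [wordSec, sec_spread]
        exact hd' x u (by simpa using hu)

theorem wordSec_concat (g : TreeAut (Fin n)) (u : List (Fin n)) (x : Fin n) :
    wordSec g (u ++ [x]) = sec (wordSec g u) x := by
  induction u generalizing g with
  | nil => rfl
  | cons y u ih => exact ih _

theorem perm_wordSec {H : Subgroup (TreeAut (Fin n))} {g : TreeAut (Fin n)} {u : List (Fin n)}
    {m : ℕ} (hu : u.length = m) (hg : g ∈ levelProd H (m + 1)) : perm (wordSec g u) = 1 := by
  subst hu
  induction u generalizing g with
  | nil => exact (mem_levelProd_succ.1 hg).1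
  | cons y u ih => exact ih ((mem_levelProd_succ.1 hg).2 y)

/-- Both sides are homomorphisms on a finite product, compared on each factor. This is why the
inclusions of level products induce `treeTransition`. -/
theorem cls_spread (hn : 4 ≤ n) (h : ∀ x : Fin n, (branching n).map (graft x) ≤ branching n)
    {d : Fin n → TreeAut (Fin n)} (hd : ∀ x, d x ∈ branching n) :
    cls (spread_branching_mem hn hd) = ∏ x, plant h x (cls (hd x)) := by
  let F : (Fin n → ↥(branching n)) →* M n :=
    Abelianization.of.comp ((spread.comp ((branching n).subtype.compLeft (Fin n))).codRestrict
      (branching n) fun d => spread_branching_mem hn fun x => (d x).2)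
  let F' : (Fin n → ↥(branching n)) →* M n :=
    ∏ x, ((plant h x).comp Abelianization.of).comp (Pi.evalMonoidHom (fun _ => ↥(branching n)) x)
  have hF : F = F' := by
    suffices Subgroup.pi Set.univ (fun _ : Fin n => (⊤ : Subgroup ↥(branching n))) ≤
      F.eqLocus F' from MonoidHom.ext fun d => this fun x _ => Subgroup.mem_top (d x)
    refine Subgroup.pi_le_iff.2 fun x => Subgroup.map_le_iff_le_comap.2 fun k _ => ?_
    change F (Pi.mulSingle x k) = F' (Pi.mulSingle x k)
    have h1 : F' (Pi.mulSingle x k) = plant h x (Abelianization.of k) := by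
      rw [MonoidHom.finsetProd_apply, Finset.prod_eq_single x]
      · change plant h x (Abelianization.of ((Pi.mulSingle x k : Fin n → ↥(branching n)) x)) = _
        rw [Pi.mulSingle_eq_same]
      · intro y _ hy
        change plant h y (Abelianization.of ((Pi.mulSingle x k : Fin n → ↥(branching n)) y)) = _
        rw [Pi.mulSingle_eq_of_ne hy, map_one, map_one]
      · exact fun h => absurd (Finset.mem_univ x) h
    rw [h1]
    refine congrArg Abelianization.of (Subtype.ext ?_)
    refine Eq.trans ?_ (graft_eq_spread x k.1).symm
    change spread (fun y => ((Pi.mulSingle x k : Fin n → ↥(branching n)) y : TreeAut (Fin n))) = _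
    congr 1
    funext y
    rw [Pi.mulSingle_apply, Pi.mulSingle_apply]
    split_ifs <;> rfl
  have h2 := DFunLike.congr_fun hF fun x => ⟨d x, hd x⟩
  refine h2.trans ?_
  rw [MonoidHom.finsetProd_apply]
  rfl

/-- The classes of the sections at the words of a level. -/
noncomputable def levelCls (hn : 4 ≤ n) (m : ℕ) :
    ↥(levelRist (hanoi n) (m + 1)) →* (Level (Fin n) (m + 1) → M n) where
  toFun g u := cls (wordSec_mem u.2 ((mem_levelRist_iff hn).1 g.2))
  map_one' := funext fun u => (cls_eq_one_iff _).2 (by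
    change wordSec 1 u.1 ∈ _
    rw [wordSec_one]
    exact one_mem _)
  map_mul' f g := funext fun u => by
    rw [Pi.mul_apply, ← cls_mul]
    refine cls_congr _ ?_
    exact wordSec_mul _ u.2 ((mem_levelRist_iff hn).1 g.2)

theorem levelCls_surjective (hn : 4 ≤ n) (m : ℕ) : Function.Surjective (levelCls hn m) := by
  intro f
  choose k hk hk' using fun u => exists_cls_eq (f u)
  classical
  obtain ⟨g, hg, hg'⟩ := exists_wordSec_eq (H := branching n) (m := m + 1)
    (fun u => if h : u.length = m + 1 then k ⟨u, h⟩ else 1)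
    (fun u hu => by rw [dif_pos hu]; exact hk _)
  have hgG : g ∈ hanoi n := by
    have : levelProd (branching n) (m + 1) ≤ hanoi n :=
      levelProd_le_iff.2 fun u _ k hk => branching_le hn (graftWord_mem_branching hn u hk)
    exact this hg
  refine ⟨⟨⟨g, hgG⟩, (mem_levelRist_iff hn).2 hg⟩, funext fun u => ?_⟩
  rw [hk']
  refine cls_congr _ ?_
  exact (hg' u.1 u.2).trans (dif_pos u.2)

theorem treeTransition_levelCls (hn : 4 ≤ n)
    (h : ∀ x : Fin n, (branching n).map (graft x) ≤ branching n) (m : ℕ)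
    (g : ↥(levelRist (hanoi n) (m + 1 + 1))) :
    treeTransition h (m + 1) (levelCls hn (m + 1) g) =
      levelCls hn m ⟨g, levelRist_succ_le (m + 1) g.2⟩ := by
  funext u
  have hg := (mem_levelRist_iff hn).1 g.2
  have h1 : ∀ x, wordSec g.1.1 (u.1 ++ [x]) ∈ branching n := fun x =>
    wordSec_mem (by simp [u.2]) hg
  refine (cls_spread hn h h1).symm.trans (cls_congr _ ?_)
  refine (eq_spread_iff.2 ⟨perm_wordSec u.2 hg, fun x => ?_⟩).symm
  rw [wordSec_concat]

theorem kerSub_levelCls (hn : 4 ≤ n) (m : ℕ) : kerSub (levelCls (n := n) hn) m =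
    (levelProd ⁅branching n, branching n⁆ (m + 1)).subgroupOf (hanoi n) := by
  ext g
  rw [mem_kerSub, Subgroup.mem_subgroupOf]
  constructor
  · rintro ⟨h1, h2⟩
    refine mem_levelProd_of_wordSec ((mem_levelRist_iff hn).1 h1) fun u hu => ?_
    exact (cls_eq_one_iff _).1 (congrFun h2 ⟨u, hu⟩)
  · intro h
    refine ⟨(mem_levelRist_iff hn).2 (levelProd_mono (Subgroup.commutator_le_self _) _ h),
      funext fun u => (cls_eq_one_iff _).2 (wordSec_mem u.2 h)⟩

theorem conj_mem_commutator_branching (hn : 4 ≤ n) {g k : TreeAut (Fin n)} (hg : g ∈ hanoi n)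
    (hk : k ∈ ⁅branching n, branching n⁆) : g * k * g⁻¹ ∈ ⁅branching n, branching n⁆ := by
  suffices ⁅branching n, branching n⁆ ≤
      ⁅branching n, branching n⁆.comap (MulAut.conj g).toMonoidHom from this hk
  refine Subgroup.commutator_le.2 fun a ha b hb => ?_
  rw [Subgroup.mem_comap, map_commutatorElement]
  exact Subgroup.commutator_mem_commutator (conj_mem_branching hn hg ha)
    (conj_mem_branching hn hg hb)

theorem kerSub_levelCls_normal (hn : 4 ≤ n) (m : ℕ) :
    (kerSub (levelCls (n := n) hn) m).Normal := by
  rw [kerSub_levelCls]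
  refine ⟨fun k hk g => ?_⟩
  rw [Subgroup.mem_subgroupOf] at hk ⊢
  exact conj_mem_levelProd (fun g hg k hk => conj_mem_commutator_branching hn hg hk) g.2 hk

theorem finite_level (m : ℕ) : Finite (Level (Fin n) m) :=
  inferInstanceAs (Finite (List.Vector (Fin n) m))

theorem kerSub_levelCls_finiteIndex (hn : 4 ≤ n) [Finite (M n)] (m : ℕ) :
    (kerSub (levelCls (n := n) hn) m).FiniteIndex := by
  have := finite_level (n := n) (m + 1)
  have h1 := (levelRist_finiteIndex hn m).index_ne_zero
  have h2 : (levelCls (n := n) hn m).ker.index ≠ 0 := by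
    rw [Subgroup.index_ker]
    exact Nat.card_pos.ne'
  refine ⟨?_⟩
  rw [Subgroup.index_map_subtype]
  exact mul_ne_zero h2 h1

/-- The branch kernel is the inverse limit of the powers of `M n`. -/
theorem nonempty_branchKernel_equiv (hn : 4 ≤ n) [Finite (M n)]
    (hR : ∀ m, (levelRist (hanoi n) (m + 1)).FiniteIndex)
    (h : ∀ x : Fin n, (branching n).map (graft x) ≤ branching n) :
    Nonempty (↥(branchKernel (hanoi n) hR) ≃ₜ* TreeLim h) := by
  have h1 := kerSub_levelCls_normal (n := n) hn
  have h2 := kerSub_levelCls_finiteIndex (n := n) hn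
  have h3 : ∀ (H : Subgroup ↥(hanoi n)) [H.Normal] [H.FiniteIndex],
      ∃ m, kerSub (levelCls hn) m ≤ H := fun H _ _ => by
    simp only [kerSub_levelCls hn]
    exact exists_levelProd_commutator_le hn H
  have e := kernelEquiv (N := fun m => levelRist (hanoi n) (m + 1))
    (hN := fun m => levelRist_succ_le (m + 1)) (hf := hR) (θ := levelCls hn)
    (t := fun m => treeTransition h (m + 1)) (treeTransition_levelCls hn h)
    (levelCls_surjective hn) h3
  exact ⟨e⟩

/-- The sequences of level and rigid stabilizers interlace with a shift of one level, so they define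
the same kernel. -/
theorem branchKernel_eq (hn : 4 ≤ n) (hR : ∀ m, (levelRist (hanoi n) (m + 1)).FiniteIndex) :
    branchKernel (hanoi n) hR = congruenceKernel (hanoi n) := by
  ext x
  unfold branchKernel congruenceKernel
  rw [mem_ker_toSeqCompletion, mem_ker_toSeqCompletion]
  constructor
  · intro h m
    have := hR m
    exact proj_eq_of_le (levelRist_le_levelStab hn m) (h m)
  · intro h m
    have := hR m
    exact proj_eq_of_le (levelStab_le_levelRist hn m) (h (m + 1))

end WordSections


/-! ### The inverse limit as a power -/

section Limits

theorem isLocallyConstant_pi {Y ι B : Type*} [TopologicalSpace Y] [Finite ι] {f : Y → ι → B}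
    (h : ∀ i, IsLocallyConstant fun y => f y i) : IsLocallyConstant f := by
  let _ : TopologicalSpace B := ⊥
  have : DiscreteTopology B := ⟨rfl⟩
  rw [IsLocallyConstant.iff_continuous, continuous_pi_iff]
  exact fun i => (h i).continuous

variable {n : ℕ} {h : ∀ x : Fin n, (branching n).map (graft x) ≤ branching n}

/-- The coordinate of an element of the limit at a nonempty word. -/
def coordAt (f : TreeLim h) (u : List (Fin n)) (hu : u ≠ []) : M n :=
  f.1 (u.length - 1) ⟨u, (Nat.sub_add_cancel (List.length_pos_iff.2 hu)).symm⟩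

theorem coordAt_eq (f : TreeLim h) {k : ℕ} {u : List (Fin n)} (hk : u.length = k + 1) (hu : u ≠ []) :
    f.1 k ⟨u, hk⟩ = coordAt f u hu := by
  obtain rfl : k = u.length - 1 := by omega
  rfl

theorem coordAt_mul (f g : TreeLim h) (u : List (Fin n)) (hu : u ≠ []) :
    coordAt (f * g) u hu = coordAt f u hu * coordAt g u hu := rfl

theorem coordAt_one (u : List (Fin n)) (hu : u ≠ []) : coordAt (1 : TreeLim h) u hu = 1 := rfl

theorem coordAt_eq_prod (f : TreeLim h) (u : List (Fin n)) (hu : u ≠ []) :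
    coordAt f u hu = ∏ x, plant h x (coordAt f (u ++ [x]) (by simp)) := by
  have h1 := congrFun (f.2 (u.length - 1))
    ⟨u, (Nat.sub_add_cancel (List.length_pos_iff.2 hu)).symm⟩
  refine h1.symm.trans ?_
  change (∏ y, plant h y (f.1 (u.length - 1 + 1) ⟨u ++ [y], _⟩)) = _
  exact Finset.prod_congr rfl fun x _ => congrArg (plant h x) (coordAt_eq f _ _)

theorem isLocallyConstant_coordAt (u : List (Fin n)) (hu : u ≠ []) :
    IsLocallyConstant fun f : TreeLim h => coordAt f u hu := by
  have h1 : IsLocallyConstant fun f : TreeLim h => f.1 (u.length - 1) :=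
    InvLim.isLocallyConstant _
  exact h1.comp fun v => v ⟨u, (Nat.sub_add_cancel (List.length_pos_iff.2 hu)).symm⟩

/-- Every coordinate is a product of planted classes, hence lies in the image of the idempotent, on
which the transition maps are plain products. -/
theorem plant_coordAt (hn : 4 ≤ n) (f : TreeLim h) (u : List (Fin n)) (hu : u ≠ []) (x : Fin n) :
    plant h x (coordAt f u hu) = coordAt f u hu := by
  rw [coordAt_eq_prod f u hu, map_prod]
  refine Finset.prod_congr rfl fun y _ => ?_
  rw [plant_eq hn h y x, plant_plant hn]

/-- The words at which the coordinates of an element of the limit can be prescribed. -/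
def IsFree [NeZero n] (u : List (Fin n)) : Prop := u ≠ [] ∧ ∀ v, u = v ++ [0] → v = []

/-- The coordinate at v 0, with v nonempty, is that at v divided by those at the other children.
Words of one letter are free, since the limit starts at level 1. -/
theorem eq_one_of_isFree [NeZero n] (hn : 4 ≤ n) {f : TreeLim h}
    (hf : ∀ u (hu : IsFree u), coordAt f u hu.1 = 1) : f = 1 := by
  have key : ∀ u (hu : u ≠ []), coordAt f u hu = 1 := by
    intro u
    induction u using List.reverseRecOn with
    | nil => exact fun hu => absurd rfl hu
    | append_singleton v x ih =>
      intro hu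
      by_cases hfree : IsFree (v ++ [x])
      · exact hf _ hfree
      have h1 : x = 0 ∧ v ≠ [] := by
        simp only [IsFree, not_and, not_forall] at hfree
        obtain ⟨w, hw, hw'⟩ := hfree hu
        obtain ⟨rfl, h2⟩ := List.append_inj' hw rfl
        exact ⟨by simpa using h2, hw'⟩
      obtain ⟨rfl, hv⟩ := h1
      have h2 := coordAt_eq_prod f v hv
      rw [ih hv, Finset.prod_eq_single 0, plant_coordAt hn] at h2
      · exact h2.symm
      · intro y _ hy
        rw [hf (v ++ [y]) ⟨by simp, fun w hw => ?_⟩, map_one]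
        exact absurd (by simpa using (List.append_inj' hw rfl).2) hy
      · exact fun h => absurd (Finset.mem_univ _) h
  refine InvLim.ext fun k => funext fun u => ?_
  have hu : u.1 ≠ [] := fun h => by simpa [h] using u.2
  exact (coordAt_eq f u.2 hu).trans (key u.1 hu)

/-- The coordinates, at reversed words, of the element of the limit with prescribed coordinates. -/
def extend [NeZero n] (c : List (Fin n) → M n) : List (Fin n) → M n
  | [] => 1
  -- Reversal puts the last letter first, so the recursion passes to the parent vertex; the non-free
  -- branch solves "parent = product of children" for the child 0.
  | x :: v => if v = [] ∨ x ≠ 0 then c (x :: v).reverse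
      else extend c v * (∏ y ∈ Finset.univ.erase 0, c (y :: v).reverse)⁻¹

theorem extend_mem [NeZero n] {c : List (Fin n) → M n} {R : Subgroup (M n)} (hc : ∀ u, c u ∈ R)
    (u : List (Fin n)) : extend c u ∈ R := by
  induction u with
  | nil => exact one_mem _
  | cons x v ih =>
    rw [extend]
    split_ifs
    · exact hc _
    · exact mul_mem ih (inv_mem (prod_mem fun y _ => hc _))

theorem extend_eq_prod [NeZero n] (c : List (Fin n) → M n) {v : List (Fin n)} (hv : v ≠ []) :
    extend c v = ∏ x, extend c (x :: v) := by
  rw [← Finset.mul_prod_erase Finset.univ _ (Finset.mem_univ (0 : Fin n)), extend,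
    if_neg (by simp [hv]), Finset.prod_congr rfl fun y hy => ?_, inv_mul_cancel_right]
  rw [extend, if_pos (Or.inr (Finset.ne_of_mem_erase hy))]

theorem extend_of_isFree [NeZero n] (c : List (Fin n) → M n) {u : List (Fin n)} (hu : IsFree u) :
    extend c u.reverse = c u := by
  rcases List.eq_nil_or_concat u with rfl | ⟨v, x, rfl⟩
  · exact absurd rfl hu.1
  · rw [List.concat_eq_append] at hu ⊢
    rw [List.reverse_append, List.reverse_singleton, List.singleton_append, extend, if_pos]
    · simp
    · by_cases hx : x = 0
      · left
        rw [hu.2 v (by rw [hx]), List.reverse_nil]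
      · exact Or.inr hx

theorem exists_coordAt_eq [NeZero n] (hn : 4 ≤ n) {x : Fin n} {c : List (Fin n) → M n}
    (hc : ∀ u, c u ∈ (plant h x).range) :
    ∃ f : TreeLim h, ∀ u (hu : IsFree u), coordAt f u hu.1 = c u := by
  refine ⟨⟨fun k u => extend c u.1.reverse, fun k => funext fun u => ?_⟩,
    fun u hu => extend_of_isFree c hu⟩
  have hu : u.1.reverse ≠ [] := fun h => by simpa [List.reverse_eq_nil_iff.1 h] using u.2
  refine Eq.trans ?_ (extend_eq_prod c hu).symm
  change (∏ y, plant h y (extend c (u.1 ++ [y]).reverse)) = _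
  refine Finset.prod_congr rfl fun y _ => ?_
  rw [List.reverse_append, List.reverse_singleton, List.singleton_append]
  obtain ⟨m, hm⟩ := extend_mem hc (y :: u.1.reverse)
  rw [← hm, plant_eq hn h y x, plant_plant hn]

theorem infinite_isFree [NeZero n] (hn : 2 ≤ n) : Infinite {u : List (Fin n) // IsFree u} := by
  have h1 : ∀ k, IsFree (List.replicate (k + 1) (⟨1, by omega⟩ : Fin n)) := by
    refine fun k => ⟨by simp, fun v hv => ?_⟩
    rw [List.replicate_succ'] at hv
    have h2 := (List.append_inj' hv rfl).2
    have h3 := congrArg Fin.val (List.singleton_inj.1 h2)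
    simp at h3
  refine Infinite.of_injective (fun k => ⟨_, h1 k⟩) fun k l hkl => ?_
  have := congrArg (fun u => u.1.length) hkl
  simpa using this

/-- The limit of the forgetful maps is a countable power of A: the i-th factor is read off where it
first appears, as the last coordinate. -/
theorem PowerLim.apply_eq {A : Type} [CommGroup A] (s : PowerLim A) (m : ℕ) (i : Fin (m + 1)) :
    s.1 m i = s.1 i (Fin.last i) := by
  induction m with
  | zero =>
    obtain rfl : i = 0 := Fin.ext (by omega)
    rfl
  | succ m ih =>
    induction i using Fin.lastCases with
    | last => rfl
    | cast i =>
      exact (congrFun (s.2 m) i).trans (ih i)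

variable {A J : Type} [CommGroup A]

/-- The map that reads off the coordinates at the free words. -/
def freeCoords [NeZero n] {x : Fin n} (φ : ↥(plant h x).range ≃* (J → A))
    (e : {u : List (Fin n) // IsFree u} × J ≃ ℕ) : TreeLim h →* PowerLim A where
  toFun f := ⟨fun m i => φ ((plant h x).rangeRestrict
    (coordAt f (e.symm i).1.1 (e.symm i).1.2.1)) (e.symm i).2, fun _ => rfl⟩
  map_one' := InvLim.ext fun m => funext fun i => by
    change φ ((plant h x).rangeRestrict (coordAt 1 _ _)) _ = 1
    rw [coordAt_one, map_one, map_one]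
    rfl
  map_mul' f g := InvLim.ext fun m => funext fun i => by
    change φ ((plant h x).rangeRestrict (coordAt (f * g) _ _)) _ = _
    rw [coordAt_mul, map_mul, map_mul]
    rfl

theorem continuous_freeCoords [NeZero n] {x : Fin n} (φ : ↥(plant h x).range ≃* (J → A))
    (e : {u : List (Fin n) // IsFree u} × J ≃ ℕ) : Continuous (freeCoords φ e) :=
  InvLim.continuous_iff.2 fun _ => isLocallyConstant_pi fun i =>
    (isLocallyConstant_coordAt _ _).comp
      fun v => φ ((plant h x).rangeRestrict v) (e.symm i).2

theorem rangeRestrict_coordAt (hn : 4 ≤ n) (f : TreeLim h) (u : List (Fin n)) (hu : u ≠ [])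
    (x : Fin n) : ((plant h x).rangeRestrict (coordAt f u hu) : M n) = coordAt f u hu :=
  plant_coordAt hn f u hu x

theorem freeCoords_bijective [NeZero n] (hn : 4 ≤ n) {x : Fin n}
    (φ : ↥(plant h x).range ≃* (J → A)) (e : {u : List (Fin n) // IsFree u} × J ≃ ℕ) :
    Function.Bijective (freeCoords φ e) := by
  constructor
  · refine (injective_iff_map_eq_one _).2 fun f hf => eq_one_of_isFree hn fun u hu => ?_
    rw [← rangeRestrict_coordAt hn f u hu.1 x]
    suffices φ ((plant h x).rangeRestrict (coordAt f u hu.1)) = 1 by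
      rw [(map_eq_one_iff φ φ.injective).1 this]
      rfl
    funext j
    have h1 := congrFun (congrFun (congrArg Subtype.val hf) (e (⟨u, hu⟩, j))) (Fin.last _)
    change φ ((plant h x).rangeRestrict (coordAt f (e.symm (e (⟨u, hu⟩, j))).1.1
      (e.symm (e (⟨u, hu⟩, j))).1.2.1)) (e.symm (e (⟨u, hu⟩, j))).2 = 1 at h1
    rw [Equiv.symm_apply_apply] at h1
    exact h1
  · intro s
    classical
    let c : List (Fin n) → ↥(plant h x).range := fun u =>
      if hu : IsFree u then φ.symm fun j => s.1 (e (⟨u, hu⟩, j)) (Fin.last _) else 1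
    obtain ⟨f, hf⟩ := exists_coordAt_eq hn (x := x) (c := fun u => (c u : M n)) fun u => (c u).2
    refine ⟨f, InvLim.ext fun m => funext fun i => ?_⟩
    rw [PowerLim.apply_eq s]
    have h1 : ∀ u (hu : IsFree u), (plant h x).rangeRestrict (coordAt f u hu.1) =
        φ.symm fun j => s.1 (e (⟨u, hu⟩, j)) (Fin.last _) := by
      intro u hu
      refine Subtype.ext ?_
      rw [rangeRestrict_coordAt hn, hf u hu]
      simp only [c, dif_pos hu]
    change φ ((plant h x).rangeRestrict (coordAt f (e.symm i).1.1 (e.symm i).1.2.1))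
      (e.symm i).2 = _
    rw [h1 _ (e.symm i).1.2, MulEquiv.apply_symm_apply]
    have h2 : e (⟨(e.symm i).1.1, (e.symm i).1.2⟩, (e.symm i).2) = i := e.apply_symm_apply _
    rw [h2]

/-- Free words times J form a countably infinite set, so a countable power of A^J is regrouped into
one of A. -/
theorem nonempty_treeLim_equiv (hn : 4 ≤ n) [CompactSpace (TreeLim h)] [Finite J] [Nonempty J]
    {x : Fin n} (φ : ↥(plant h x).range ≃* (J → A)) :
    Nonempty (TreeLim h ≃ₜ* PowerLim A) := by
  have : NeZero n := ⟨by omega⟩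
  have := infinite_isFree (n := n) (by omega)
  obtain ⟨e⟩ : Nonempty ({u : List (Fin n) // IsFree u} × J ≃ ℕ) := by
    obtain ⟨hd⟩ := nonempty_denumerable ({u : List (Fin n) // IsFree u} × J)
    exact ⟨Denumerable.eqv _⟩
  have hbij := freeCoords_bijective hn φ e
  exact ⟨{ MulEquiv.ofBijective (freeCoords φ e) hbij,
    Continuous.homeoOfEquivCompactToT2 (f := Equiv.ofBijective (freeCoords φ e) hbij)
      (continuous_freeCoords φ e) with }⟩

end Limits

end HanoiCSP

/-! ### The main theorem -/

theorem theorem3p12 (n : ℕ) (hn : 3 ≤ n) (hn3 : n ≠ 3) :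
    ∃ (hR : ∀ m, (HanoiCSP.levelRist (HanoiCSP.hanoi n) (m + 1)).FiniteIndex)
      (hK : ∀ x : Fin n,
        (HanoiCSP.branching n).map (HanoiCSP.graft x) ≤ HanoiCSP.branching n),
      -- the branch kernel is the congruence kernel
      HanoiCSP.branchKernel (HanoiCSP.hanoi n) hR =
          HanoiCSP.congruenceKernel (HanoiCSP.hanoi n) ∧
      -- it is the inverse limit of powers of `M_n`
      Nonempty (↥(HanoiCSP.branchKernel (HanoiCSP.hanoi n) hR) ≃ₜ* HanoiCSP.TreeLim hK) ∧
      -- the structure of `M_n`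
      Finite (HanoiCSP.M n) ∧
      (Even n → 5 ≤ n →
        Nonempty (HanoiCSP.M n ≃* (Fin n → Multiplicative (ZMod (n - 1))))) ∧
      (n = 4 ∨ Odd n →
        n - 1 ≤ Monoid.exponent (HanoiCSP.M n) ∧
          Monoid.exponent (HanoiCSP.M n) ≤ 2 * (n - 1)) ∧
      -- the description by the plain powers of one finite abelian group
      ∃ (A : Type) (_ : CommGroup A),
        Finite A ∧
        Nonempty (↥(HanoiCSP.branchKernel (HanoiCSP.hanoi n) hR) ≃ₜ* HanoiCSP.PowerLim A) ∧
        (Even n → 5 ≤ n → IsCyclic A ∧ Nat.card A = n - 1) ∧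
        (Odd n → Nonempty (A ≃* HanoiCSP.M n)) ∧
        (n = 4 ∨ Odd n →
          n - 1 ≤ Monoid.exponent A ∧ Monoid.exponent A ≤ 2 * (n - 1)) := by
  have hn4 : 4 ≤ n := by omega
  have hK := HanoiCSP.map_graft_branching_le hn4
  have hR := HanoiCSP.levelRist_finiteIndex hn4
  let x : Fin n := ⟨0, by omega⟩
  have hfin := HanoiCSP.finite_range_plant hn4 hK x
  have hM : Finite (HanoiCSP.M n) := HanoiCSP.finite_M hn4 hK x
  obtain ⟨e⟩ := HanoiCSP.nonempty_branchKernel_equiv hn4 hR hK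
  have hcomp : CompactSpace ↥(HanoiCSP.branchKernel (HanoiCSP.hanoi n) hR) :=
    HanoiCSP.compactSpace_ker
  have hcomp' : CompactSpace (HanoiCSP.TreeLim hK) := e.toHomeomorph.compactSpace
  have heven : Even n → 5 ≤ n →
      Nonempty (HanoiCSP.M n ≃* (Fin n → Multiplicative (ZMod (n - 1)))) := fun he h5 =>
    ⟨(MulEquiv.subgroupCongr (HanoiCSP.branching_of_even h5 he)).abelianizationCongr.trans
      (HanoiCSP.abEquiv hn)⟩
  refine ⟨hR, hK, HanoiCSP.branchKernel_eq hn4 hR, ⟨e⟩, hM, heven, HanoiCSP.exponent_M hn4, ?_⟩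
  -- For even n ≥ 6 the image of planting is all of M, a power of ℤ/(n-1) indexed by the letters, so
  -- the cyclic group serves as A. Otherwise A is that image itself, with a one-point index set.
  by_cases h : Even n ∧ 5 ≤ n
  · obtain ⟨φ⟩ := heven h.1 h.2
    have : NeZero (n - 1) := ⟨by omega⟩
    have : Nonempty (Fin n) := ⟨x⟩
    obtain ⟨e'⟩ := HanoiCSP.nonempty_treeLim_equiv hn4 (h := hK) (x := x)
      (((MulEquiv.subgroupCongr (HanoiCSP.plant_range_of_five h.2 hK x)).trans
        Subgroup.topEquiv).trans φ)
    refine ⟨Multiplicative (ZMod (n - 1)), inferInstance, inferInstance, ⟨e.trans e'⟩,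
      fun _ _ => ⟨inferInstance, ?_⟩, fun ho => absurd h.1 (Nat.not_even_iff_odd.2 ho), ?_⟩
    · rw [Nat.card_eq_fintype_card, Fintype.card_multiplicative, ZMod.card]
    · rintro (h4 | ho)
      · omega
      · exact absurd h.1 (Nat.not_even_iff_odd.2 ho)
  · obtain ⟨e'⟩ := HanoiCSP.nonempty_treeLim_equiv hn4 (h := hK) (x := x)
      (MulEquiv.funUnique Unit ↥(HanoiCSP.plant hK x).range).symm
    refine ⟨↥(HanoiCSP.plant hK x).range, inferInstance, hfin, ⟨e.trans e'⟩,
      fun he h5 => absurd ⟨he, h5⟩ h, fun ho => ?_, fun _ => HanoiCSP.exponent_range_plant hn4 hK x⟩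
    have h5 : 5 ≤ n := by
      rcases hn4.eq_or_lt with rfl | h5
      · exact absurd ho (by decide)
      · exact h5
    exact ⟨(MulEquiv.subgroupCongr (HanoiCSP.plant_range_of_five h5 hK x)).trans
      Subgroup.topEquiv⟩
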